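/- Let $2<\alpha<4$, $\theta=\arcsin\big(\tfrac12\sqrt{\alpha(4-\alpha)}\big)$, and let $\psi_1,\dots,\psi_4:\mathbb C\to\mathbb C$ be the Koch similitudes $$\psi_1(z)=\tfrac z\alpha,\quad \psi_2(z)=\tfrac z\alpha e^{i\theta}+\tfrac1\alpha,\quad \psi_3(z)=\tfrac z\alpha e^{-i\theta}+\tfrac12+i\sqrt{\tfrac1\alpha-\tfrac14},\quad \psi_4(z)=\tfrac{z-1}\alpha+1 ,$$ where $\mathbb R^2$ is identified with $\mathbb C$. Let $\Omega^0$ be an open regular polygon, and let $\Omega^n_\alpha$ ($n\ge 0$) be the polygonal domain obtained by replacing each side of $\Omega^0$ with the (scaled, outward pointing) $n$-th pre-fractal Koch curve $K^n_\alpha=\bigcup_{|w|=n}\psi_{w}([0,1])$, where $\psi_w=\psi_{i_1}\circ\cdots\circ\psi_{i_n}$ for $w=(i_1,\dots,i_n)\in\{1,\dots,4\}^n$. Let $\Omega_\alpha=\bigcup_n\Omega^n_\alpha$ be the limit domain, whose boundary is the union of the corresponding Koch curves. Fix $0<\vartheta^-\le\min\{\pi/2-\theta,\theta/2\}$ and let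 $T_0^-$ be the open triangle with vertices $0$, $1$ and $S^-=\tfrac12-\tfrac i2\tan\vartheta^-$. For each side of $\Omega^0$ let $\sigma$ be the orientation preserving similitude that carries $[0,1]$ onto it, with $\Omega^0$ on the side of the image of the lower half plane. The inner fibers at level $n$ are the triangles $S(T_0^-)$ with $S=\sigma\circ\psi_{w}$, $|w|=n$; the fiber $S(T_0^-)$ lies in $\Omega^n_\alpha$ along the side $S([0,1])$ of $\Omega^n_\alpha$. Let $\Sigma^n_-$ be the union of the inner fibers at level $n$. For $x\in\Sigma^n_-$ in the fiber $S(T_0^-)$, let $x^\perp$ be the orthogonal projection of $x$ on the side $S([0,1])$, and let $x^-$ be the point where the line through $x$ and $x^\perp$ meets the other two sides of the fiber. Put $$\lambda_n(x)=\begin{cases}\dfrac{|x_1^\perp-x_1|+|x_2^\perp-x_2|}{|x_1^\perp-x_1^-|+|x_2^\perp-x_2^-|},& x\in\Sigma^n_-,\\[2mm] 1,& x\in\Omega^n_\alpha\setminus\Sigma^n_-,\\ 0,& x\notin\Omega^n_\alpha.\end{cases}$$ For $1\le p<\infty$ let $\|w\|_{1,p,\Omega_\alpha}=\big(\|w\|_{L^p(\Omega_\alpha)}^p+\|\nabla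 w\|_{L^p(\Omega_\alpha)}^p\big)^{1/p}$, let $W^{1,p}_0(\Omega_\alpha)$ be the closure of $C_c^\infty(\Omega_\alpha)$ in $W^{1,p}(\Omega_\alpha)$, and let $W^{1,p}_g(\Omega_\alpha)=\{w\in W^{1,p}(\Omega_\alpha): w=g\text{ on }\partial\Omega_\alpha\}$, the boundary condition meaning $w-g\in W^{1,p}_0(\Omega_\alpha)$. Let $g\in W^{1,\infty}(\Omega_\alpha)$ and $u\in W^{1,r}_g(\Omega_\alpha)$ with $2<r<\infty$, and let $z_n(x)=\lambda_n(x)u(x)+(1-\lambda_n(x))g(x)$. Then for every $s$ with $2<s<r$: (i) $z_n\in W^{1,s}_g(\Omega_\alpha)$ for every $n\ge0$; (ii) $\|z_n\|_{1,s,\Omega_\alpha}\le C$ for every $n\ge 0$, with $C$ independent of $n$; (iii) $z_n\to u$ in $W^{1,s}(\Omega_\alpha)$ as $n\to\infty$. -/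

import Mathlib

open MeasureTheory Filter Topology
open scoped ENNReal

noncomputable section

namespace Snowflake

/-! Sobolev spaces on an open subset of the plane; the plane is `ℂ`, with its Euclidean norm and
Lebesgue measure, and a plane vector `(v₁, v₂)` is the complex number `v₁ + i v₂`. -/

/-- The test functions `C_c^∞(Ω)`. -/
def IsTest (Ω : Set ℂ) (φ : ℂ → ℝ) : Prop :=
  ContDiff ℝ (⊤ : ℕ∞) φ ∧ HasCompactSupport φ ∧ tsupport φ ⊆ Ω

/-- `G` is a weak (distributional) gradient of `u` on `Ω`; the partial derivatives are
`∂₁ u = (G ·).re` and `∂₂ u = (G ·).im`. -/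
def HasWeakGradient (Ω : Set ℂ) (u : ℂ → ℝ) (G : ℂ → ℂ) : Prop :=
  LocallyIntegrableOn u Ω ∧ LocallyIntegrableOn G Ω ∧
    ∀ φ : ℂ → ℝ, IsTest Ω φ → ∀ v : ℂ,
      ∫ x in Ω, u x * fderiv ℝ φ x v = -∫ x in Ω, inner ℝ (G x) v * φ x

/-- `u ∈ W^{1,p}(Ω)`, for `1 ≤ p ≤ ∞`. -/
def MemW (Ω : Set ℂ) (p : ℝ≥0∞) (u : ℂ → ℝ) : Prop :=
  MemLp u p (volume.restrict Ω) ∧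
    ∃ G : ℂ → ℂ, HasWeakGradient Ω u G ∧ MemLp G p (volume.restrict Ω)

/-- The norm `‖u‖_{1,p,Ω} = (‖u‖_p^p + ‖∇u‖_p^p)^{1/p}`, for finite `p`. The weak gradient is unique
up to null sets, so the infimum runs over equal values; it is `∞` if there is no weak gradient. -/
def sobolevNorm (Ω : Set ℂ) (p : ℝ) (u : ℂ → ℝ) : ℝ≥0∞ :=
  ⨅ (G : ℂ → ℂ) (_ : HasWeakGradient Ω u G),
    (eLpNorm u (ENNReal.ofReal p) (volume.restrict Ω) ^ p +
      eLpNorm G (ENNReal.ofReal p) (volume.restrict Ω) ^ p) ^ (1 / p)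

/-- `u ∈ W_0^{1,p}(Ω)`, the closure of `C_c^∞(Ω)` in `W^{1,p}(Ω)`, for finite `p`. -/
def MemWZero (Ω : Set ℂ) (p : ℝ) (u : ℂ → ℝ) : Prop :=
  MemW Ω (ENNReal.ofReal p) u ∧
    ∃ φ : ℕ → ℂ → ℝ, (∀ k, IsTest Ω (φ k)) ∧
      Tendsto (fun k => sobolevNorm Ω p (fun x => u x - φ k x)) atTop (𝓝 0)

/-- `u ∈ W_g^{1,p}(Ω)`: `u ∈ W^{1,p}(Ω)` and `u = g` on `∂Ω`, that is, `u - g ∈ W_0^{1,p}(Ω)`. -/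
def MemWBdry (Ω : Set ℂ) (p : ℝ) (g u : ℂ → ℝ) : Prop :=
  MemW Ω (ENNReal.ofReal p) u ∧ MemWZero Ω p (fun x => u x - g x)

/-! The Koch similitudes and the domains. -/

/-- The rotation angle `θ(α)`. -/
def angle (α : ℝ) : ℝ := Real.arcsin (√(α * (4 - α)) / 2)

/-- The four similitudes `ψ_{1,α}, …, ψ_{4,α}`, numbered from `0` to `3`. -/
def kochMap (α : ℝ) : Fin 4 → ℂ → ℂ
  | 0, z => z / α
  | 1, z => z / α * Complex.exp (Complex.I * angle α) + 1 / α
  | 2, z => z / α * Complex.exp (-(Complex.I * angle α)) +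
      (1 / 2 + Complex.I * (√(1 / α - 1 / 4) : ℝ))
  | 3, z => (z - 1) / α + 1

/-- The composition `ψ_{i_1} ∘ ⋯ ∘ ψ_{i_n}` for a word `i_1 … i_n`. -/
def kochWord (α : ℝ) : List (Fin 4) → ℂ → ℂ
  | [] => id
  | i :: w => kochMap α i ∘ kochWord α w

/-- The vertices, in clockwise order, of the regular `m`-gon with first vertex `a` and with
first side going from `a` to `a + c`. -/
def vertex (m : ℕ) (a c : ℂ) (j : ℕ) : ℂ :=
  a + c * ∑ k ∈ Finset.range j, Complex.exp (-(2 * Real.pi * Complex.I / m)) ^ k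

/-- The orientation preserving similitude that carries the unit segment from `0` to `1` onto the
side from `vertex m a c j` to `vertex m a c (j + 1)`. The interior of the polygon lies on the side
of the lower half plane, so that Koch curves (which lie in the upper half plane) point outwards. -/
def sideMap (m : ℕ) (a c : ℂ) (j : ℕ) (z : ℂ) : ℂ :=
  vertex m a c j + (vertex m a c (j + 1) - vertex m a c j) * z

/-- The similitude that carries the unit segment onto the side with index `(j, w)` of the `n`-th
polygon, where `n` is the length of `w`: the piece with word `w` of the `n`-th pre-fractal Koch
curve that replaces the side `j` of the regular `m`-gon. -/
def pieceMap (α : ℝ) (m : ℕ) (a c : ℂ) (j : ℕ) (w : List (Fin 4)) : ℂ → ℂ :=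
  sideMap m a c j ∘ kochWord α w

/-- The closed triangle between the unit segment and the polygonal of four segments that replaces
it in the first Koch step; that polygonal has the corners `1/α`, `1/2 + i √(1/α - 1/4)`,
`1 - 1/α`. -/
def bump (α : ℝ) : Set ℂ :=
  convexHull ℝ {1 / (α : ℂ), 1 / 2 + Complex.I * (√(1 / α - 1 / 4) : ℝ), 1 - 1 / (α : ℂ)}

/-- The pre-fractal domain `Ω_α^n`: the interior of the polygonal region that arises from the
closed regular `m`-gon when, in the steps `k = 0, …, n - 1`, each side of the current polygon is
replaced with the scaled first step polygonal (pointing outwards). -/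
def prefractal (α : ℝ) (m : ℕ) (a c : ℂ) (n : ℕ) : Set ℂ :=
  interior (convexHull ℝ {z | ∃ j < m, z = vertex m a c j} ∪
    {z | ∃ j < m, ∃ w : List (Fin 4), w.length < n ∧ z ∈ pieceMap α m a c j w '' bump α})

/-- The domain `Ω_α` with fractal boundary: the limit (increasing union) of the `Ω_α^n`. -/
def domain (α : ℝ) (m : ℕ) (a c : ℂ) : Set ℂ :=
  ⋃ n : ℕ, prefractal α m a c n

/-! The inner fibers and the coefficient functions. -/

/-- The lower vertex `S^- = (1/2, -tan(ϑ)/2)` of the open triangle `T_0^-`. -/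
def lowVertex (ϑ : ℝ) : ℂ := 1 / 2 - Complex.I * (Real.tan ϑ / 2 : ℝ)

/-- The open triangle `T_0^-` with vertices `0`, `1`, `S^-`. -/
def innerTriangle (ϑ : ℝ) : Set ℂ := interior (convexHull ℝ {0, 1, lowVertex ϑ})

/-- `Σ_-^n`: the union of the inner fibers attached to the sides of `Ω_α^n`. -/
def innerFibers (α ϑ : ℝ) (m : ℕ) (a c : ℂ) (n : ℕ) : Set ℂ :=
  {x | ∃ j < m, ∃ w : List (Fin 4), w.length = n ∧ x ∈ pieceMap α m a c j w '' innerTriangle ϑ}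

/-- For `x ∈ Σ_-^n`, `p` and `q` are the points `P_⊥` and `P_-` that belong to `x`. If `S` is the
similitude of the fiber that contains `x`, then `p` is the orthogonal projection of `x` on the side
`S([0, 1])` of `Ω_α^n`, and `q` is the intersection of the straight line through `x` and `p` with
the part of the boundary of the fiber off that side, the two segments from its ends to `S(S^-)`. -/
def IsProjPair (α ϑ : ℝ) (m : ℕ) (a c : ℂ) (n : ℕ) (x p q : ℂ) : Prop :=
  ∃ j < m, ∃ w : List (Fin 4), w.length = n ∧
    ∃ S : ℂ → ℂ, S = pieceMap α m a c j w ∧ x ∈ S '' innerTriangle ϑ ∧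
      p ∈ segment ℝ (S 0) (S 1) ∧ inner ℝ (x - p) (S 1 - S 0) = 0 ∧
      q ∈ affineSpan ℝ {x, p} ∧
      q ∈ segment ℝ (S 0) (S (lowVertex ϑ)) ∪ segment ℝ (S (lowVertex ϑ)) (S 1)

/-- A choice of the pair `(P_⊥, P_-)` (for `x ∈ Σ_-^n` there is exactly one). -/
def projPair (α ϑ : ℝ) (m : ℕ) (a c : ℂ) (n : ℕ) (x : ℂ) : ℂ × ℂ :=
  Classical.epsilon fun pq : ℂ × ℂ => IsProjPair α ϑ m a c n x pq.1 pq.2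

open Classical in
/-- The coefficient function `λ_n`: the quotient of the lengths of `P_⊥ - x` and `P_⊥ - P_-` on
`Σ_-^n`, `1` on the rest of `Ω_α^n`, and `0` outside `Ω_α^n`. -/
def coeff (α ϑ : ℝ) (m : ℕ) (a c : ℂ) (n : ℕ) (x : ℂ) : ℝ :=
  if x ∈ innerFibers α ϑ m a c n then
    (|(projPair α ϑ m a c n x).1.re - x.re| + |(projPair α ϑ m a c n x).1.im - x.im|) /
      (|(projPair α ϑ m a c n x).1.re - (projPair α ϑ m a c n x).2.re| +
        |(projPair α ϑ m a c n x).1.im - (projPair α ϑ m a c n x).2.im|)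
  else if x ∈ prefractal α m a c n then 1
  else 0

/-- `z_n = λ_n u + (1 - λ_n) g`. -/
def blend (α ϑ : ℝ) (m : ℕ) (a c : ℂ) (g u : ℂ → ℝ) (n : ℕ) (x : ℂ) : ℝ :=
  coeff α ϑ m a c n x * u x + (1 - coeff α ϑ m a c n x) * g x

end Snowflake

end

noncomputable section

namespace Snowflake

set_option linter.unusedSectionVars false

/-! Put v = u - g, an element of W_0^{1,r}. Then z_n - g = λ_n v and z_n - u = (λ_n - 1) v, so
everything reduces to multiplication by λ_n: λ_n v must stay in W_0^{1,r}, and (λ_n - 1) v must tend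
to 0 together with its gradient (`sobolev_blend`).

The obstacle is that ∇λ_n is unbounded. In the fiber over a side with ends P and Q its size is at
most M (1/|x - P| + 1/|x - Q|). This bound is invariant under similitudes, so M depends only on the
slope K = tan ϑ⁻ and not on n (`IsSim.exists_hasFDerivAt_tooth`). For r > 2 Hardy's inequality about
a single point of the plane compensates the singularity: if φ vanishes at p and A is star-shaped
about p, then |φ| / |x - p| is controlled in L^r(A) by ∇φ (`hardy_of_starShaped`). A fiber is
star-shaped about both ends of its side, and these ends never belong to the limit domain
(`vertex_notMem_domain`), so test functions vanish there. Summing over the disjoint fibers of one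
level gives ‖φ ∇λ_n‖_r ≤ C ‖∇φ‖_r, with the right-hand norm taken over the fibers only and C
independent of n (`lintegral_cutoff_le`). Fatou's lemma carries the bound over to v.

Off the fibers and off Ω \ Ω^n one has λ_n = 1. The exceptional set has measure tending to 0: there
are m 4^n fibers, each of area proportional to α^(-2n), with α > 2. Absolute continuity of the
integral makes all error terms vanish, and the finite measure of Ω allows passing from the exponent
r to s.

It remains to see that λ_n is locally Lipschitz in Ω, also across the sides of Ω^n that lie inside
Ω. Up to a null set λ_n is `cutoff`, which counts the polygon and the bumps and subtracts one
`tooth` per side (`coeff_eq_cutoff`). Passing from n to n + 1 adds one scaled copy of a single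
function `cellFun` per side, and this function is Lipschitz near every point other than the vertices
of the subdivided cell (`locLipAt_cellFun`). The geometry behind all this is that fibers of one
level, and likewise bumps of all levels, are disjoint. The conditions on ϑ⁻ enter as tan ϑ⁻ ≤ 2H and
tan ϑ⁻ ≤ d/H, where H is the height and d the half base of the bump (`Admissible`). -/

theorem inner_gradient (f : ℂ → ℝ) (x v : ℂ) : inner ℝ (gradient f x) v = fderiv ℝ f x v := by
  rw [gradient, InnerProductSpace.toDual_symm_apply]

theorem norm_gradient (f : ℂ → ℝ) (x : ℂ) : ‖gradient f x‖ = ‖fderiv ℝ f x‖ := by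
  rw [gradient, LinearIsometryEquiv.norm_map]

theorem enorm_gradient (f : ℂ → ℝ) (x : ℂ) : ‖gradient f x‖ₑ = ‖fderiv ℝ f x‖ₑ := by
  rw [← ofReal_norm, ← ofReal_norm, norm_gradient]

theorem measurable_gradient (f : ℂ → ℝ) : Measurable (gradient f) :=
  (InnerProductSpace.toDual ℝ ℂ).symm.continuous.measurable.comp (measurable_fderiv ℝ f)

/-! ### Test functions and weak gradients. -/

theorem IsTest.lipschitz {Ω : Set ℂ} {φ : ℂ → ℝ} (h : IsTest Ω φ) : ∃ C, LipschitzWith C φ :=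
  ContDiff.lipschitzWith_of_hasCompactSupport h.2.1 h.1 (by simp)

theorem IsTest.contDiff_one {Ω : Set ℂ} {φ : ℂ → ℝ} (h : IsTest Ω φ) : ContDiff ℝ 1 φ :=
  h.1.of_le (by exact_mod_cast le_top)

theorem IsTest.eq_zero {Ω : Set ℂ} {φ : ℂ → ℝ} (h : IsTest Ω φ) {x : ℂ} (hx : x ∉ Ω) : φ x = 0 :=
  image_eq_zero_of_notMem_tsupport fun h' => hx (h.2.2 h')

theorem IsTest.fderiv_eq_zero {Ω : Set ℂ} {φ : ℂ → ℝ} (h : IsTest Ω φ) {x : ℂ} (hx : x ∉ Ω) :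
    fderiv ℝ φ x = 0 :=
  image_eq_zero_of_notMem_tsupport fun h' => hx (h.2.2 (tsupport_fderiv_subset ℝ h'))

theorem IsTest.sub {Ω : Set ℂ} {φ ψ : ℂ → ℝ} (h : IsTest Ω φ) (h' : IsTest Ω ψ) :
    IsTest Ω (fun x => φ x - ψ x) :=
  ⟨h.1.sub h'.1, h.2.1.sub h'.2.1, (tsupport_sub φ ψ).trans (Set.union_subset h.2.2 h'.2.2)⟩

/-- By Rademacher's theorem the pointwise gradient exists almost everywhere, and Lipschitz functions
may be integrated by parts against a compactly supported Lipschitz function. Test functions vanish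
off Ω, so the integrals may be taken over the whole plane. -/
theorem hasWeakGradient_of_lipschitz (Ω : Set ℂ) {f : ℂ → ℝ} {C : NNReal} (hf : LipschitzWith C f) :
    HasWeakGradient Ω f (gradient f) := by
  refine ⟨hf.continuous.locallyIntegrable.locallyIntegrableOn _, ?_, ?_⟩
  · refine LocallyIntegrable.locallyIntegrableOn ?_ _
    refine (memLp_top_of_bound (measurable_gradient f).aestronglyMeasurable C
      (.of_forall fun x => ?_)).locallyIntegrable le_top
    rw [norm_gradient]
    exact norm_fderiv_le_of_lipschitz ℝ hf
  · intro φ hφ v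
    obtain ⟨D, hD⟩ := hφ.lipschitz
    have h := hf.integral_lineDeriv_mul_eq (μ := volume) hD hφ.2.1 v
    rw [setIntegral_eq_integral_of_forall_compl_eq_zero,
      setIntegral_eq_integral_of_forall_compl_eq_zero]
    · have h1 : ∫ x, inner ℝ (gradient f x) v * φ x = ∫ x, lineDeriv ℝ f x v * φ x := by
        refine integral_congr_ae ?_
        filter_upwards [hf.ae_differentiableAt (μ := volume)] with x hx
        rw [inner_gradient, hx.lineDeriv_eq_fderiv]
      rw [h1, h, ← integral_neg]
      refine integral_congr_ae (.of_forall fun x => ?_)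
      have : DifferentiableAt ℝ φ x := hφ.contDiff_one.differentiable (by simp) x
      simp only [this.lineDeriv_eq_fderiv, map_neg]
      ring
    · intro x hx
      rw [hφ.eq_zero hx, mul_zero]
    · intro x hx
      rw [hφ.fderiv_eq_zero hx]; simp

theorem IsTest.hasWeakGradient {Ω : Set ℂ} {φ : ℂ → ℝ} (h : IsTest Ω φ) :
    HasWeakGradient Ω φ (gradient φ) :=
  hasWeakGradient_of_lipschitz Ω h.lipschitz.choose_spec

theorem IsTest.integrableOn_mul_fderiv {Ω : Set ℂ} {φ : ℂ → ℝ} (h : IsTest Ω φ)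
    {f : ℂ → ℝ} (hf : LocallyIntegrableOn f Ω) (v : ℂ) :
    IntegrableOn (fun x => f x * fderiv ℝ φ x v) Ω := by
  have hc : IsCompact (tsupport φ) := h.2.1
  have h1 : IntegrableOn f (tsupport φ) := hf.integrableOn_compact_subset h.2.2 hc
  have hcont : Continuous fun x => fderiv ℝ φ x v :=
    (h.contDiff_one.continuous_fderiv (by simp)).clm_apply continuous_const
  have h2 : IntegrableOn (fun x => f x * fderiv ℝ φ x v) (tsupport φ) :=
    h1.mul_continuousOn hcont.continuousOn hc
  refine (h2.integrable_of_forall_notMem_eq_zero fun x hx => ?_).integrableOn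
  have : fderiv ℝ φ x = 0 :=
    image_eq_zero_of_notMem_tsupport fun h' => hx (tsupport_fderiv_subset ℝ h')
  simp [this]

theorem IsTest.integrableOn_inner_mul {Ω : Set ℂ} {φ : ℂ → ℝ} (h : IsTest Ω φ)
    {G : ℂ → ℂ} (hG : LocallyIntegrableOn G Ω) (v : ℂ) :
    IntegrableOn (fun x => inner ℝ (G x) v * φ x) Ω := by
  have hc : IsCompact (tsupport φ) := h.2.1
  have h1 : IntegrableOn G (tsupport φ) := hG.integrableOn_compact_subset h.2.2 hc
  have h1' : IntegrableOn (fun x => inner ℝ (G x) v) (tsupport φ) := h1.inner_const v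
  have h2 : IntegrableOn (fun x => inner ℝ (G x) v * φ x) (tsupport φ) :=
    h1'.mul_continuousOn h.1.continuous.continuousOn hc
  refine (h2.integrable_of_forall_notMem_eq_zero fun x hx => ?_).integrableOn
  rw [image_eq_zero_of_notMem_tsupport hx, mul_zero]

theorem HasWeakGradient.sub {Ω : Set ℂ} {f g : ℂ → ℝ} {F G : ℂ → ℂ} (hf : HasWeakGradient Ω f F)
    (hg : HasWeakGradient Ω g G) :
    HasWeakGradient Ω (fun x => f x - g x) (fun x => F x - G x) := by
  refine ⟨hf.1.sub hg.1, hf.2.1.sub hg.2.1, fun φ hφ v => ?_⟩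
  simp only [sub_mul, inner_sub_left]
  rw [integral_sub (hφ.integrableOn_mul_fderiv hf.1 v) (hφ.integrableOn_mul_fderiv hg.1 v),
    integral_sub (hφ.integrableOn_inner_mul hf.2.1 v) (hφ.integrableOn_inner_mul hg.2.1 v),
    hf.2.2 φ hφ v, hg.2.2 φ hφ v]
  ring

theorem HasWeakGradient.add {Ω : Set ℂ} {f g : ℂ → ℝ} {F G : ℂ → ℂ} (hf : HasWeakGradient Ω f F)
    (hg : HasWeakGradient Ω g G) :
    HasWeakGradient Ω (fun x => f x + g x) (fun x => F x + G x) := by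
  refine ⟨hf.1.add hg.1, hf.2.1.add hg.2.1, fun φ hφ v => ?_⟩
  simp only [add_mul, inner_add_left]
  rw [integral_add (hφ.integrableOn_mul_fderiv hf.1 v) (hφ.integrableOn_mul_fderiv hg.1 v),
    integral_add (hφ.integrableOn_inner_mul hf.2.1 v) (hφ.integrableOn_inner_mul hg.2.1 v),
    hf.2.2 φ hφ v, hg.2.2 φ hφ v]
  ring

/-- Fundamental lemma of the calculus of variations, applied to the components in the directions 1
and i. -/
theorem HasWeakGradient.ae_eq {Ω : Set ℂ} (hΩ : IsOpen Ω) {f : ℂ → ℝ} {F G : ℂ → ℂ}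
    (hF : HasWeakGradient Ω f F) (hG : HasWeakGradient Ω f G) :
    F =ᵐ[volume.restrict Ω] G := by
  have key : ∀ v : ℂ, ∀ᵐ x, x ∈ Ω → inner ℝ (F x - G x) v = (0 : ℝ) := by
    intro v
    refine IsOpen.ae_eq_zero_of_integral_contDiff_smul_eq_zero hΩ ?_ ?_
    · intro x hx
      obtain ⟨t, ht, h⟩ := (hF.2.1.sub hG.2.1) x hx
      exact ⟨t, ht, h.inner_const v⟩
    · intro φ h1 h2 h3
      have hφ : IsTest Ω φ := ⟨h1, h2, h3⟩
      have e1 := hF.2.2 φ hφ v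
      have e2 := hG.2.2 φ hφ v
      have e3 : ∫ x, φ x • (inner ℝ (F x - G x) v : ℝ) =
          ∫ x in Ω, (inner ℝ (F x) v * φ x - inner ℝ (G x) v * φ x) := by
        rw [setIntegral_eq_integral_of_forall_compl_eq_zero]
        · congr 1; ext x; simp [inner_sub_left]; ring
        · intro x hx; simp [hφ.eq_zero hx]
      rw [e3, integral_sub (hφ.integrableOn_inner_mul hF.2.1 v)
        (hφ.integrableOn_inner_mul hG.2.1 v)]
      linarith
  rw [Filter.EventuallyEq, ae_restrict_iff' hΩ.measurableSet]
  filter_upwards [key 1, key Complex.I] with x h1 h2 hx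
  have h1 := h1 hx
  have h2 := h2 hx
  simp [Complex.inner] at h1 h2
  apply Complex.ext
  · linarith
  · linarith

theorem isFiniteMeasure_restrict {Ω : Set ℂ} (hΩ' : volume Ω ≠ ∞) :
    IsFiniteMeasure (volume.restrict Ω) := ⟨by simpa using hΩ'.lt_top⟩

theorem locallyIntegrableOn_of_memLp {E : Type*} [NormedAddCommGroup E] {Ω : Set ℂ}
    {p : ℝ≥0∞} (hp : 1 ≤ p) (hΩ' : volume Ω ≠ ∞) {f : ℂ → E}
    (hf : MemLp f p (volume.restrict Ω)) : LocallyIntegrableOn f Ω := by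
  have := isFiniteMeasure_restrict hΩ'
  have h : IntegrableOn f Ω := hf.integrable hp
  exact h.locallyIntegrableOn

/-- For pairing with a bounded weight: on a finite measure space convergence in L^p gives
convergence in L¹, hence of the integrals. -/
theorem tendsto_integral_of_tendsto_eLpNorm {E : Type*} [NormedAddCommGroup E] {μ : Measure ℂ}
    [IsFiniteMeasure μ] {p : ℝ≥0∞} (hp : 1 ≤ p) {h : ℂ → ℝ} {H : ℕ → ℂ → ℝ} {D : ℕ → ℂ → E} {C : ℝ}
    (hh : Integrable h μ) (hH : ∀ k, Integrable (H k) μ) (hD : ∀ k, AEStronglyMeasurable (D k) μ)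
    (hle : ∀ k x, ‖H k x - h x‖ ≤ C * ‖D k x‖)
    (hlim : Tendsto (fun k => eLpNorm (D k) p μ) atTop (𝓝 0)) :
    Tendsto (fun k => ∫ x, H k x ∂μ) atTop (𝓝 (∫ x, h x ∂μ)) := by
  refine tendsto_integral_of_L1' h hh.1 (.of_forall hH) ?_
  set M : ℝ≥0∞ := μ Set.univ ^ (1 / (1 : ℝ≥0∞).toReal - 1 / p.toReal) with hM
  have hM' : M ≠ ∞ := by
    refine ENNReal.rpow_ne_top_of_nonneg ?_ (measure_ne_top _ _)
    rcases eq_or_ne p ∞ with rfl | hp'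
    · simp
    · have : 1 ≤ p.toReal := by simpa using ENNReal.toReal_mono hp' hp
      simp only [ENNReal.toReal_one, div_one, sub_nonneg]
      exact (div_le_one (by linarith)).2 this
  have h1 : ∀ k, eLpNorm (H k - h) 1 μ ≤ ENNReal.ofReal C * (eLpNorm (D k) p μ * M) := fun k =>
    (eLpNorm_le_mul_eLpNorm_of_ae_le_mul (.of_forall fun x => hle k x) 1).trans
      (by gcongr; exact eLpNorm_le_eLpNorm_mul_rpow_measure_univ hp (hD k))
  refine tendsto_of_tendsto_of_tendsto_of_le_of_le tendsto_const_nhds ?_ (fun _ => zero_le) h1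
  have h2 := ENNReal.Tendsto.const_mul (a := ENNReal.ofReal C)
    (ENNReal.Tendsto.mul_const (b := M) hlim (.inr hM')) (.inr ENNReal.ofReal_ne_top)
  simpa using h2

/-- The weak gradient is a closed operator: both sides of the defining identity pass to the limit,
since a test function and its derivative are bounded. -/
theorem HasWeakGradient.of_tendsto {Ω : Set ℂ} (hΩ' : volume Ω ≠ ∞) {p : ℝ≥0∞} (hp : 1 ≤ p)
    {f : ℂ → ℝ} {F : ℂ → ℂ} {φ : ℕ → ℂ → ℝ} {Φ : ℕ → ℂ → ℂ}
    (hf : MemLp f p (volume.restrict Ω)) (hF : MemLp F p (volume.restrict Ω))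
    (hφ : ∀ k, HasWeakGradient Ω (φ k) (Φ k))
    (hφm : ∀ k, MemLp (φ k) p (volume.restrict Ω)) (hΦm : ∀ k, MemLp (Φ k) p (volume.restrict Ω))
    (h1 : Tendsto (fun k => eLpNorm (fun x => f x - φ k x) p (volume.restrict Ω)) atTop (𝓝 0))
    (h2 : Tendsto (fun k => eLpNorm (fun x => F x - Φ k x) p (volume.restrict Ω)) atTop (𝓝 0)) :
    HasWeakGradient Ω f F := by
  have := isFiniteMeasure_restrict hΩ'
  have l1 := locallyIntegrableOn_of_memLp hp hΩ' hf
  have l2 := locallyIntegrableOn_of_memLp hp hΩ' hF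
  refine ⟨l1, l2, fun ψ hψ v => ?_⟩
  obtain ⟨C, hC⟩ := (hψ.2.1.fderiv ℝ).exists_bound_of_continuous
    (hψ.contDiff_one.continuous_fderiv (by simp))
  obtain ⟨B, hB⟩ := hψ.2.1.exists_bound_of_continuous hψ.1.continuous
  have t1 : Tendsto (fun k => ∫ x in Ω, φ k x * fderiv ℝ ψ x v) atTop
      (𝓝 (∫ x in Ω, f x * fderiv ℝ ψ x v)) := by
    refine tendsto_integral_of_tendsto_eLpNorm hp (C := C * ‖v‖)
      (hψ.integrableOn_mul_fderiv l1 v) (fun k => hψ.integrableOn_mul_fderiv (hφ k).1 v)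
      (fun k => (hf.sub (hφm k)).1) (fun k x => ?_) h1
    rw [← sub_mul, norm_mul, mul_comm]
    refine mul_le_mul ?_ (by simp only [Pi.sub_apply, norm_sub_rev, le_refl]) (norm_nonneg _) ?_
    · exact ((fderiv ℝ ψ x).le_opNorm v).trans (by gcongr; exact hC x)
    · exact mul_nonneg ((norm_nonneg _).trans (hC 0)) (norm_nonneg _)
  have t2 : Tendsto (fun k => ∫ x in Ω, inner ℝ (Φ k x) v * ψ x) atTop
      (𝓝 (∫ x in Ω, inner ℝ (F x) v * ψ x)) := by
    refine tendsto_integral_of_tendsto_eLpNorm hp (C := ‖v‖ * B)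
      (hψ.integrableOn_inner_mul l2 v) (fun k => hψ.integrableOn_inner_mul (hφ k).2.1 v)
      (fun k => (hF.sub (hΦm k)).1) (fun k x => ?_) h2
    rw [← sub_mul, norm_mul, ← inner_sub_left, Pi.sub_apply, norm_sub_rev (F x)]
    calc ‖(inner ℝ (Φ k x - F x) v : ℝ)‖ * ‖ψ x‖ ≤ (‖Φ k x - F x‖ * ‖v‖) * B := by
          gcongr
          · exact norm_inner_le_norm _ _
          · exact hB x
      _ = _ := by ring
  refine tendsto_nhds_unique t1 ?_
  simp only [(hφ _).2.2 ψ hψ v]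
  exact t2.neg

theorem sobolevNorm_le {Ω : Set ℂ} {p : ℝ} (hp : 1 ≤ p) {f : ℂ → ℝ} {F : ℂ → ℂ}
    (h : HasWeakGradient Ω f F) :
    sobolevNorm Ω p f ≤ eLpNorm f (ENNReal.ofReal p) (volume.restrict Ω) +
      eLpNorm F (ENNReal.ofReal p) (volume.restrict Ω) :=
  (iInf₂_le F h).trans (ENNReal.rpow_add_rpow_le_add _ _ hp)

theorem exists_of_sobolevNorm_lt {Ω : Set ℂ} {p : ℝ} (hp : 1 ≤ p) {f : ℂ → ℝ} {ε : ℝ≥0∞}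
    (h : sobolevNorm Ω p f < ε) : ∃ F, HasWeakGradient Ω f F ∧
      eLpNorm f (ENNReal.ofReal p) (volume.restrict Ω) < ε ∧
      eLpNorm F (ENNReal.ofReal p) (volume.restrict Ω) < ε := by
  simp only [sobolevNorm, iInf_lt_iff] at h
  obtain ⟨F, hF, h⟩ := h
  have hp0 : 0 < p := by linarith
  refine ⟨F, hF, lt_of_le_of_lt ?_ h, lt_of_le_of_lt ?_ h⟩
  · rw [one_div, ENNReal.le_rpow_inv_iff hp0]
    exact le_self_add
  · rw [one_div, ENNReal.le_rpow_inv_iff hp0]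
    exact le_add_self

/-! ### Convergence in L^p and mollification. -/

theorem eLpNorm_ofReal {E : Type*} [NormedAddCommGroup E] {μ : Measure ℂ} {p : ℝ} (hp : 0 < p)
    (f : ℂ → E) : eLpNorm f (ENNReal.ofReal p) μ = (∫⁻ x, ‖f x‖ₑ ^ p ∂μ) ^ (1 / p) := by
  rw [eLpNorm_eq_lintegral_rpow_enorm_toReal (by simpa using hp) (by simp),
    ENNReal.toReal_ofReal hp.le]

theorem tendsto_eLpNorm_zero_iff {E : Type*} [NormedAddCommGroup E] {μ : Measure ℂ} {p : ℝ}
    (hp : 0 < p) (f : ℕ → ℂ → E) :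
    Tendsto (fun k => eLpNorm (f k) (ENNReal.ofReal p) μ) atTop (𝓝 0) ↔
      Tendsto (fun k => ∫⁻ x, ‖f k x‖ₑ ^ p ∂μ) atTop (𝓝 0) := by
  simp only [eLpNorm_ofReal hp]
  constructor <;> intro h
  · have := h.ennrpow_const p
    simp only [← ENNReal.rpow_mul, one_div_mul_cancel hp.ne', ENNReal.rpow_one,
      ENNReal.zero_rpow_of_pos hp] at this
    exact this
  · have := h.ennrpow_const (1 / p)
    rwa [ENNReal.zero_rpow_of_pos (by positivity)] at this

theorem tendsto_eLpNorm_zero_of_dominated {E : Type*} [NormedAddCommGroup E] {μ : Measure ℂ}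
    {p : ℝ} (hp : 0 < p) {f : ℕ → ℂ → E} {bound : ℂ → ℝ≥0∞}
    (hm : ∀ k, AEStronglyMeasurable (f k) μ) (hb : ∀ k, ∀ x, ‖f k x‖ₑ ≤ bound x)
    (hi : ∫⁻ x, bound x ^ p ∂μ ≠ ∞)
    (hlim : ∀ᵐ x ∂μ, Tendsto (fun k => ‖f k x‖ₑ) atTop (𝓝 0)) :
    Tendsto (fun k => eLpNorm (f k) (ENNReal.ofReal p) μ) atTop (𝓝 0) := by
  rw [tendsto_eLpNorm_zero_iff hp]
  have : ∫⁻ _, (0 : ℝ≥0∞) ∂μ = 0 := by simp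
  rw [← this]
  refine tendsto_lintegral_of_dominated_convergence' (fun x => bound x ^ p)
    (fun k => (hm k).enorm.pow_const p) (fun k => .of_forall fun x => ?_) hi ?_
  · exact ENNReal.rpow_le_rpow (hb k x) hp.le
  · filter_upwards [hlim] with x hx
    have := hx.ennrpow_const p
    rwa [ENNReal.zero_rpow_of_pos hp] at this

-- Differentiation under the integral sign falls on f, which is only Lipschitz: its derivative
-- exists at x - t for almost every t, and the Lipschitz constant provides the dominating function.
open ContinuousLinearMap in
theorem hasFDerivAt_convolution_lipschitz {f : ℂ → ℝ} {C : NNReal} (hf : LipschitzWith C f)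
    {ρ : ℂ → ℝ} (hρ : Continuous ρ) (hρc : HasCompactSupport ρ) (x : ℂ) :
    HasFDerivAt (convolution ρ f (lsmul ℝ ℝ) volume)
      (convolution ρ (fderiv ℝ f) (lsmul ℝ ℝ) volume x) x := by
  have hint : ∀ y, Integrable fun t => ρ t * f (y - t) := fun y =>
    (hρ.mul (hf.continuous.comp (by fun_prop))).integrable_of_hasCompactSupport
      hρc.mul_right
  have h := hasFDerivAt_integral_of_dominated_loc_of_lip' (𝕜 := ℝ) (μ := volume)
    (F := fun y t => ρ t * f (y - t)) (F' := fun t => ρ t • fderiv ℝ f (x - t))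
    (x₀ := x) (s := Set.univ) (bound := fun t => ‖ρ t‖ * C) univ_mem
    (fun y _ => (hint y).1) (hint x) ?_ ?_ ?_ ?_
  · exact h.2
  · exact (hρ.measurable.smul
      ((measurable_fderiv ℝ f).comp (by fun_prop))).aestronglyMeasurable
  · refine .of_forall fun t y _ => ?_
    have := hf.dist_le_mul (y - t) (x - t)
    rw [← mul_sub, norm_mul, mul_assoc]
    gcongr
    simpa [dist_eq_norm] using this
  · exact (hρ.integrable_of_hasCompactSupport hρc).norm.mul_const _
  · have h1 : ∀ᵐ t : ℂ, DifferentiableAt ℝ f (x - t) :=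
      (Measure.measurePreserving_sub_left volume x).quasiMeasurePreserving.ae
        hf.ae_differentiableAt
    filter_upwards [h1] with t ht
    have := ht.hasFDerivAt.comp x ((hasFDerivAt_id x).sub_const t)
    have h2 := this.const_smul (ρ t)
    rw [ContinuousLinearMap.comp_id] at h2
    exact h2

open ContinuousLinearMap in
theorem norm_convolution_normed_le {E : Type*} [NormedAddCommGroup E] [NormedSpace ℝ E]
    (ρ : ContDiffBump (0 : ℂ)) {g : ℂ → E} {C : ℝ} (hg : ∀ x, ‖g x‖ ≤ C) (x : ℂ) :
    ‖convolution (ρ.normed volume) g (lsmul ℝ ℝ) volume x‖ ≤ C := by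
  rw [convolution_def]
  calc ‖∫ t, (lsmul ℝ ℝ) (ρ.normed volume t) (g (x - t))‖
      ≤ ∫ t, ρ.normed volume t * C := by
        refine norm_integral_le_of_norm_le (ρ.integrable_normed.mul_const C) (.of_forall fun t => ?_)
        rw [lsmul_apply, norm_smul, Real.norm_of_nonneg (ρ.nonneg_normed t)]
        gcongr
        · exact ρ.nonneg_normed t
        · exact hg _
    _ = C := by rw [integral_mul_const, ρ.integral_normed, one_mul]

open ContinuousLinearMap in
/-- Mollification of a compactly supported Lipschitz function. -/
theorem exists_isTest_tendsto {Ω : Set ℂ} (hΩ : IsOpen Ω) {f : ℂ → ℝ} {C : NNReal}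
    (hf : LipschitzWith C f) (hc : HasCompactSupport f) (hs : tsupport f ⊆ Ω) {p : ℝ}
    (hp : 1 ≤ p) : ∃ χ : ℕ → ℂ → ℝ, (∀ k, IsTest Ω (χ k)) ∧
      Tendsto (fun k => eLpNorm (fun x => f x - χ k x) (ENNReal.ofReal p) (volume.restrict Ω))
        atTop (𝓝 0) ∧
      Tendsto (fun k => eLpNorm (fun x => gradient f x - gradient (χ k) x) (ENNReal.ofReal p)
        (volume.restrict Ω)) atTop (𝓝 0) := by
  obtain ⟨δ, hδ, hδΩ⟩ := IsCompact.exists_cthickening_subset_open hc hΩ hs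
  have hp0 : 0 < p := by linarith
  -- The outer radius is at most δ, so the mollified functions are supported in the δ-thickening of
  -- the support of f, inside Ω. The fixed ratio 2 of the radii is what Lebesgue differentiation
  -- along bump averages requires.
  let ρ : ℕ → ContDiffBump (0 : ℂ) := fun k =>
    { rIn := δ / 2 / (k + 1), rOut := δ / (k + 1), rIn_pos := by positivity
      rIn_lt_rOut := by gcongr; linarith }
  have hρ0 : Tendsto (fun k => (ρ k).rOut) atTop (𝓝 0) := by
    have := tendsto_one_div_add_atTop_nhds_zero_nat (𝕜 := ℝ) |>.const_mul δ
    simpa [ρ, div_eq_mul_inv] using this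
  have hρδ : ∀ k, (ρ k).rOut ≤ δ := fun k => div_le_self hδ.le (by simp)
  let χ : ℕ → ℂ → ℝ := fun k => convolution ((ρ k).normed volume) f (lsmul ℝ ℝ) volume
  have hρcont : ∀ k, Continuous ((ρ k).normed volume) := fun k => (ρ k).continuous_normed
  have hχd : ∀ k x, HasFDerivAt (χ k)
      (convolution ((ρ k).normed volume) (fderiv ℝ f) (lsmul ℝ ℝ) volume x) x := fun k x =>
    hasFDerivAt_convolution_lipschitz hf (hρcont k) (ρ k).hasCompactSupport_normed x
  have hsupp : ∀ k, tsupport (χ k) ⊆ Metric.cthickening δ (tsupport f) := by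
    intro k
    refine closure_minimal (fun x hx => ?_) Metric.isClosed_cthickening
    obtain ⟨a, ha, b, hb, rfl⟩ := support_convolution_subset (lsmul ℝ ℝ) hx
    rw [(ρ k).support_normed_eq] at ha
    refine Metric.mem_cthickening_of_dist_le (a + b) b δ _ (subset_tsupport f hb) ?_
    have ha' : dist a 0 < (ρ k).rOut := ha
    have := hρδ k
    simp [dist_eq_norm] at ha' ⊢
    linarith
  have hχc : ∀ k, HasCompactSupport (χ k) := fun k =>
    (ρ k).hasCompactSupport_normed.convolution (lsmul ℝ ℝ) hc
  obtain ⟨B, hB⟩ := hc.exists_bound_of_continuous hf.continuous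
  have hB' : ∀ k x, ‖χ k x‖ ≤ B := fun k => norm_convolution_normed_le (ρ k) hB
  have hC : ∀ x, ‖fderiv ℝ f x‖ ≤ C := fun x => norm_fderiv_le_of_lipschitz ℝ hf
  have hC' : ∀ k x, ‖fderiv ℝ (χ k) x‖ ≤ C := fun k x => by
    rw [(hχd k x).fderiv]; exact norm_convolution_normed_le (ρ k) hC x
  set K := Metric.cthickening δ (tsupport f) with hK
  have hKc : IsCompact K := IsCompact.cthickening hc
  have hfK : tsupport f ⊆ K := Metric.self_subset_cthickening _
  have hbound : ∀ M : ℝ, ∫⁻ x in Ω, (K.indicator (fun _ => ENNReal.ofReal M) x) ^ p ≠ ∞ := by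
    intro M
    have h1 : ∀ x, (K.indicator (fun _ => ENNReal.ofReal M) x) ^ p =
        K.indicator (fun _ => ENNReal.ofReal M ^ p) x := fun x => by
      by_cases hx : x ∈ K <;> simp [hx, hp0]
    simp only [h1]
    refine ((setLIntegral_le_lintegral _ _).trans_lt ?_).ne
    rw [lintegral_indicator hKc.measurableSet, setLIntegral_const]
    exact ENNReal.mul_lt_top (ENNReal.rpow_lt_top_of_nonneg hp0.le ENNReal.ofReal_ne_top)
      hKc.measure_lt_top
  refine ⟨χ, fun k => ⟨?_, hχc k, (hsupp k).trans hδΩ⟩, ?_, ?_⟩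
  · exact (ρ k).hasCompactSupport_normed.contDiff_convolution_left (lsmul ℝ ℝ)
      (ρ k).contDiff_normed hf.continuous.locallyIntegrable
  · refine tendsto_eLpNorm_zero_of_dominated hp0
      (bound := K.indicator fun _ => ENNReal.ofReal (B + B)) (fun k => ?_) (fun k x => ?_)
      (hbound _) (.of_forall fun x => ?_)
    · have : Continuous (χ k) := continuous_iff_continuousAt.2 fun x => (hχd k x).continuousAt
      exact (hf.continuous.sub this).aestronglyMeasurable
    · by_cases hx : x ∈ K
      · rw [Set.indicator_of_mem hx, ← ofReal_norm]
        exact ENNReal.ofReal_le_ofReal ((norm_sub_le _ _).trans (add_le_add (hB x) (hB' k x)))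
      · rw [image_eq_zero_of_notMem_tsupport fun h => hx (hfK h),
          image_eq_zero_of_notMem_tsupport fun h => hx (hsupp k h)]
        simp
    · have := ContDiffBump.convolution_tendsto_right_of_continuous (μ := volume) hρ0
        hf.continuous x
      have := (tendsto_const_nhds (x := f x)).sub this
      simpa using this.enorm
  · refine tendsto_eLpNorm_zero_of_dominated hp0
      (bound := K.indicator fun _ => ENNReal.ofReal (C + C)) (fun k => ?_) (fun k x => ?_)
      (hbound _) (ae_restrict_of_ae ?_)
    · exact ((measurable_gradient f).sub (measurable_gradient _)).aestronglyMeasurable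
    · by_cases hx : x ∈ K
      · rw [Set.indicator_of_mem hx, ← ofReal_norm]
        refine ENNReal.ofReal_le_ofReal ((norm_sub_le _ _).trans ?_)
        rw [norm_gradient, norm_gradient]
        exact add_le_add (hC x) (hC' k x)
      · rw [← ofReal_norm]
        have h1 : gradient f x = 0 := by
          rw [← norm_eq_zero, norm_gradient, norm_eq_zero]
          exact image_eq_zero_of_notMem_tsupport fun h => hx (hfK (tsupport_fderiv_subset ℝ h))
        have h2 : gradient (χ k) x = 0 := by
          rw [← norm_eq_zero, norm_gradient, norm_eq_zero]
          exact image_eq_zero_of_notMem_tsupport fun h => hx (hsupp k (tsupport_fderiv_subset ℝ h))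
        simp [h1, h2]
    -- The gradient of f need not be continuous; its averages converge at Lebesgue points, hence
    -- almost everywhere.
    · have hloc : LocallyIntegrable (fderiv ℝ f) (volume : Measure ℂ) :=
        (memLp_top_of_bound (measurable_fderiv ℝ f).aestronglyMeasurable C
          (.of_forall hC)).locallyIntegrable le_top
      filter_upwards [ContDiffBump.ae_convolution_tendsto_right_of_locallyIntegrable
        (μ := volume) (K := 2) hρ0 (.of_forall fun k => le_of_eq (by simp only [ρ]; ring)) hloc]
        with x hx
      have h1 : ∀ k, ‖gradient f x - gradient (χ k) x‖ₑ = ‖fderiv ℝ f x -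
          convolution ((ρ k).normed volume) (fderiv ℝ f) (lsmul ℝ ℝ) volume x‖ₑ := fun k => by
        rw [← (hχd k x).fderiv, gradient, gradient, ← map_sub, ← ofReal_norm,
          LinearIsometryEquiv.norm_map, ofReal_norm]
      simp only [h1, ← ofReal_norm]
      have h2 := tendsto_iff_norm_sub_tendsto_zero.1 hx
      simp only [norm_sub_rev _ (fderiv ℝ f x)] at h2
      simpa using ENNReal.tendsto_ofReal h2

/-! ### Hardy's inequality about a point of the plane. -/

/-- The constant of the Hardy inequality. -/
def hardyConst (r : ℝ) : ℝ≥0∞ :=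
  (∫⁻ t in Set.Ioo (0 : ℝ) 1, ENNReal.ofReal (t ^ (-(r / (r - 1) / 2)))) ^ (r - 1) *
    ∫⁻ t in Set.Ioo (0 : ℝ) 1, ENNReal.ofReal (t ^ (r / 2 - 2))

theorem lintegral_rpow_Ioo_lt_top {s : ℝ} (hs : -1 < s) :
    ∫⁻ t in Set.Ioo (0 : ℝ) 1, ENNReal.ofReal (t ^ s) < ∞ := by
  have h := (intervalIntegral.integrableOn_Ioo_rpow_iff (s := s) one_pos).2 hs
  exact h.lintegral_lt_top

theorem hardyConst_lt_top {r : ℝ} (hr : 2 < r) : hardyConst r < ∞ := by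
  refine ENNReal.mul_lt_top (ENNReal.rpow_lt_top_of_nonneg (by linarith) ?_) ?_
  · refine (lintegral_rpow_Ioo_lt_top ?_).ne
    rw [div_div, neg_lt_neg_iff, div_lt_one (by linarith)]
    linarith
  · exact lintegral_rpow_Ioo_lt_top (by linarith)

/-- A homothety of ratio t multiplies area by t². The resulting factor t^(-2) is the reason why r >
2 is needed below. -/
theorem lintegral_homothety {t : ℝ} (ht : 0 < t) (p : ℂ) {F : ℂ → ℝ≥0∞} (hF : Measurable F) :
    ∫⁻ x, F (p + t • (x - p)) = ENNReal.ofReal (t ^ (-2 : ℝ)) * ∫⁻ x, F x := by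
  have h1 : ∫⁻ x, F (p + t • (x - p)) = ∫⁻ x, F (p + t • x) :=
    lintegral_sub_right_eq_self (μ := volume) (fun x => F (p + t • x)) p
  have h2 : ∫⁻ x, F (p + t • x) = ∫⁻ y, F (p + y) ∂(Measure.map (t • ·) volume) := by
    rw [lintegral_map (by fun_prop) (by fun_prop)]
  rw [h1, h2, Measure.map_addHaar_smul _ ht.ne', lintegral_smul_measure,
    lintegral_add_left_eq_self (μ := volume) F p, Complex.finrank_real_complex, smul_eq_mul,
    Real.rpow_neg ht.le, abs_of_pos (by positivity)]
  norm_num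

/-- The fundamental theorem of calculus along the segment from p to x. -/
theorem enorm_le_lintegral_radial {φ : ℂ → ℝ} (hφ : ContDiff ℝ 1 φ) {p : ℂ} (hp : φ p = 0)
    (x : ℂ) : ‖φ x‖ₑ ≤ ‖x - p‖ₑ *
      ∫⁻ t in Set.Ioo (0 : ℝ) 1, ‖fderiv ℝ φ (p + t • (x - p))‖ₑ := by
  have hd : ∀ t : ℝ, HasDerivAt (fun t : ℝ => φ (p + t • (x - p)))
      (fderiv ℝ φ (p + t • (x - p)) (x - p)) t := by
    intro t
    have h1 : HasDerivAt (fun t : ℝ => p + t • (x - p)) (x - p) t := by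
      simpa using ((hasDerivAt_id t).smul_const (x - p)).const_add p
    exact ((hφ.differentiable (by simp) _).hasFDerivAt.comp_hasDerivAt t h1)
  have hcont : Continuous fun t : ℝ => fderiv ℝ φ (p + t • (x - p)) :=
    (hφ.continuous_fderiv (by simp)).comp (by fun_prop)
  have hftc := intervalIntegral.integral_eq_sub_of_hasDerivAt (a := 0) (b := 1) (fun t _ => hd t)
    ((hcont.clm_apply continuous_const).intervalIntegrable _ _)
  simp only [one_smul, zero_smul, add_zero, hp, sub_zero, add_sub_cancel] at hftc
  rw [← hftc, intervalIntegral.integral_of_le zero_le_one, integral_Ioc_eq_integral_Ioo,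
    ← lintegral_const_mul _ (by fun_prop)]
  refine (enorm_integral_le_lintegral_enorm _).trans (lintegral_mono fun t => ?_)
  rw [mul_comm]
  exact (fderiv ℝ φ (p + t • (x - p))).le_opENorm _

/-- Hölder's inequality after writing F = t^(-1/2) · t^(1/2) F. With r' = r/(r - 1), the weight
t^(-r'/2) is integrable on (0, 1) exactly when r > 2. The other weight t^(r/2) becomes t^(r/2 - 2)
after the homothety, which is again integrable exactly when r > 2. -/
theorem lintegral_rpow_le_weighted {r : ℝ} (hr : 2 < r) {F : ℝ → ℝ≥0∞} (hF : Measurable F) :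
    (∫⁻ t in Set.Ioo (0 : ℝ) 1, F t) ^ r ≤
      (∫⁻ t in Set.Ioo (0 : ℝ) 1, ENNReal.ofReal (t ^ (-(r / (r - 1) / 2)))) ^ (r - 1) *
        ∫⁻ t in Set.Ioo (0 : ℝ) 1, ENNReal.ofReal (t ^ (r / 2)) * F t ^ r := by
  have hpq : (r / (r - 1)).HolderConjugate r :=
    (Real.HolderConjugate.conjExponent (by linarith)).symm
  have hr0 : 0 < r := by linarith
  have hr1 : 0 < r - 1 := by linarith
  have h := ENNReal.lintegral_mul_le_Lp_mul_Lq (volume.restrict (Set.Ioo (0 : ℝ) 1)) hpq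
    (f := fun t => ENNReal.ofReal (t ^ (-(1 / 2) : ℝ)))
    (g := fun t => ENNReal.ofReal (t ^ (1 / 2 : ℝ)) * F t) (by fun_prop) (by fun_prop)
  have e0 : ∫⁻ t in Set.Ioo (0 : ℝ) 1, F t = ∫⁻ t in Set.Ioo (0 : ℝ) 1,
      ((fun t => ENNReal.ofReal (t ^ (-(1 / 2) : ℝ))) *
        fun t => ENNReal.ofReal (t ^ (1 / 2 : ℝ)) * F t) t := by
    refine setLIntegral_congr_fun measurableSet_Ioo fun t ht => ?_
    simp only [Pi.mul_apply]
    rw [← mul_assoc, ← ENNReal.ofReal_mul (Real.rpow_nonneg ht.1.le _), ← Real.rpow_add ht.1]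
    simp
  have e1 : ∫⁻ t in Set.Ioo (0 : ℝ) 1, ENNReal.ofReal (t ^ (-(1 / 2) : ℝ)) ^ (r / (r - 1)) =
      ∫⁻ t in Set.Ioo (0 : ℝ) 1, ENNReal.ofReal (t ^ (-(r / (r - 1) / 2))) := by
    refine setLIntegral_congr_fun measurableSet_Ioo fun t ht => ?_
    rw [ENNReal.ofReal_rpow_of_pos (Real.rpow_pos_of_pos ht.1 _), ← Real.rpow_mul ht.1.le]
    ring_nf
  have e2 : ∫⁻ t in Set.Ioo (0 : ℝ) 1, (ENNReal.ofReal (t ^ (1 / 2 : ℝ)) * F t) ^ r =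
      ∫⁻ t in Set.Ioo (0 : ℝ) 1, ENNReal.ofReal (t ^ (r / 2)) * F t ^ r := by
    refine setLIntegral_congr_fun measurableSet_Ioo fun t ht => ?_
    rw [ENNReal.mul_rpow_of_nonneg _ _ hr0.le,
      ENNReal.ofReal_rpow_of_pos (Real.rpow_pos_of_pos ht.1 _), ← Real.rpow_mul ht.1.le]
    ring_nf
  rw [← e0, e1, e2] at h
  refine (ENNReal.rpow_le_rpow h hr0.le).trans_eq ?_
  rw [ENNReal.mul_rpow_of_nonneg _ _ hr0.le, ← ENNReal.rpow_mul, ← ENNReal.rpow_mul,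
    one_div_mul_cancel hr0.ne', ENNReal.rpow_one]
  congr 2
  field_simp

/-- Hardy's inequality on a set that is star-shaped about `p`, for a function vanishing at `p`. -/
theorem hardy_of_starShaped {r : ℝ} (hr : 2 < r) {A : Set ℂ} (hA : MeasurableSet A) {p : ℂ}
    (hstar : ∀ x ∈ A, ∀ t ∈ Set.Ioo (0 : ℝ) 1, p + t • (x - p) ∈ A)
    {φ : ℂ → ℝ} (hφ : ContDiff ℝ 1 φ) (hp : φ p = 0) :
    ∫⁻ x in A, (‖φ x‖ₑ / ‖x - p‖ₑ) ^ r ≤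
      hardyConst r * ∫⁻ x in A, ‖fderiv ℝ φ x‖ₑ ^ r := by
  have hr0 : 0 < r := by linarith
  set D : ℂ → ℝ≥0∞ := fun x => ‖fderiv ℝ φ x‖ₑ with hD
  have hDm : Measurable D := (measurable_fderiv ℝ φ).enorm
  set W := (∫⁻ t in Set.Ioo (0 : ℝ) 1, ENNReal.ofReal (t ^ (-(r / (r - 1) / 2)))) ^ (r - 1)
    with hW
  have hm2 : Measurable fun z : ℂ × ℝ => D (p + z.2 • (z.1 - p)) := hDm.comp (by fun_prop)
  have step1 : ∀ x, (‖φ x‖ₑ / ‖x - p‖ₑ) ^ r ≤ W * ∫⁻ t in Set.Ioo (0 : ℝ) 1,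
      ENNReal.ofReal (t ^ (r / 2)) * D (p + t • (x - p)) ^ r := by
    intro x
    refine le_trans (ENNReal.rpow_le_rpow ?_ hr0.le)
      (lintegral_rpow_le_weighted hr (F := fun t => D (p + t • (x - p))) (by fun_prop))
    exact ENNReal.div_le_of_le_mul' (enorm_le_lintegral_radial hφ hp x)
  calc ∫⁻ x in A, (‖φ x‖ₑ / ‖x - p‖ₑ) ^ r
      ≤ ∫⁻ x in A, W * ∫⁻ t in Set.Ioo (0 : ℝ) 1,
          ENNReal.ofReal (t ^ (r / 2)) * D (p + t • (x - p)) ^ r := lintegral_mono step1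
    _ = W * ∫⁻ t in Set.Ioo (0 : ℝ) 1, ∫⁻ x in A,
          ENNReal.ofReal (t ^ (r / 2)) * D (p + t • (x - p)) ^ r := by
        rw [lintegral_const_mul _ (Measurable.lintegral_prod_right'
          (f := fun z : ℂ × ℝ => ENNReal.ofReal (z.2 ^ (r / 2)) * D (p + z.2 • (z.1 - p)) ^ r)
          (by fun_prop)),
          lintegral_lintegral_swap]
        fun_prop
    _ ≤ W * ∫⁻ t in Set.Ioo (0 : ℝ) 1, ENNReal.ofReal (t ^ (r / 2 - 2)) *
          ∫⁻ x in A, D x ^ r := by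
        gcongr W * ?_
        refine setLIntegral_mono' measurableSet_Ioo fun t ht => ?_
        rw [lintegral_const_mul _ (by fun_prop), sub_eq_add_neg, Real.rpow_add ht.1,
          ENNReal.ofReal_mul (Real.rpow_nonneg ht.1.le _), mul_assoc]
        gcongr
        -- Substituting y = p + t(x - p) produces the factor t^(-2); star-shapedness says that x ∈ A
        -- forces y ∈ A, so the indicators compare pointwise.
        rw [← lintegral_indicator hA, ← lintegral_indicator hA,
          ← lintegral_homothety ht.1 p ((hDm.pow_const r).indicator hA)]
        refine lintegral_mono fun x => ?_
        by_cases hx : x ∈ A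
        · rw [Set.indicator_of_mem hx, Set.indicator_of_mem (hstar x hx t ht)]
        · rw [Set.indicator_of_notMem hx]; exact zero_le
    _ = hardyConst r * ∫⁻ x in A, D x ^ r := by
        rw [lintegral_mul_const _ (by fun_prop), hardyConst, mul_assoc]

/-! ### Functions that are Lipschitz near a point. -/

/-- `f` is Lipschitz in a neighbourhood of `x`. -/
def LocLipAt (f : ℂ → ℝ) (x : ℂ) : Prop := ∃ K, ∃ t ∈ 𝓝 x, LipschitzOnWith K f t

namespace LocLipAt
variable {f g : ℂ → ℝ} {x : ℂ}

theorem const (a : ℝ) (x : ℂ) : LocLipAt (fun _ => a) x :=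
  ⟨0, Set.univ, univ_mem, (LipschitzWith.const a).lipschitzOnWith⟩

theorem of_contDiffAt (h : ContDiffAt ℝ 1 f x) : LocLipAt f x :=
  ContDiffAt.exists_lipschitzOnWith (by simpa using h)

theorem add (hf : LocLipAt f x) (hg : LocLipAt g x) : LocLipAt (fun z => f z + g z) x := by
  obtain ⟨K, t, ht, h⟩ := hf
  obtain ⟨K', t', ht', h'⟩ := hg
  exact ⟨K + K', t ∩ t', inter_mem ht ht',
    (h.mono Set.inter_subset_left).add (h'.mono Set.inter_subset_right)⟩

theorem comp_left {F : ℝ → ℝ} {C : NNReal} (hF : LipschitzWith C F) (hf : LocLipAt f x) :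
    LocLipAt (fun z => F (f z)) x := by
  obtain ⟨K, t, ht, h⟩ := hf
  exact ⟨C * K, t, ht, hF.comp_lipschitzOnWith h⟩

theorem neg (hf : LocLipAt f x) : LocLipAt (fun z => -f z) x :=
  hf.comp_left (F := fun t => -t) (LipschitzWith.id.neg)

theorem sub (hf : LocLipAt f x) (hg : LocLipAt g x) : LocLipAt (fun z => f z - g z) x := by
  simpa only [sub_eq_add_neg] using hf.add hg.neg

theorem sum {ι : Type*} (s : Finset ι) {F : ι → ℂ → ℝ} (h : ∀ i ∈ s, LocLipAt (F i) x) :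
    LocLipAt (fun z => ∑ i ∈ s, F i z) x := by
  classical
  induction s using Finset.induction_on with
  | empty => simpa using const 0 x
  | insert a s ha ih =>
    simp only [Finset.sum_insert ha]
    exact (h a (by simp)).add (ih fun i hi => h i (by simp [hi]))

theorem comp {S : ℂ → ℂ} {C : NNReal} (hS : LipschitzWith C S) (hf : LocLipAt f (S x)) :
    LocLipAt (fun z => f (S z)) x := by
  obtain ⟨K, t, ht, h⟩ := hf
  exact ⟨K * C, S ⁻¹' t, hS.continuous.continuousAt ht,
    h.comp hS.lipschitzOnWith (Set.mapsTo_preimage _ _)⟩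

theorem congr (hf : LocLipAt f x) (h : ∀ᶠ z in 𝓝 x, g z = f z) : LocLipAt g x := by
  obtain ⟨K, t, ht, h'⟩ := hf
  refine ⟨K, t ∩ {z | g z = f z}, inter_mem ht h, fun y hy z hz => ?_⟩
  rw [show g y = f y from hy.2, show g z = f z from hz.2]
  exact h' hy.1 hz.1

theorem continuousAt (hf : LocLipAt f x) : ContinuousAt f x := by
  obtain ⟨K, t, ht, h⟩ := hf
  exact h.continuousOn.continuousAt ht

theorem mul (hf : LocLipAt f x) (hg : LocLipAt g x) : LocLipAt (fun z => f z * g z) x := by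
  have hb : ∀ {h : ℂ → ℝ}, LocLipAt h x → ∀ᶠ z in 𝓝 x, |h z| ≤ |h x| + 1 := fun hh =>
    (hh.continuousAt.abs.eventually_lt continuousAt_const (by simp)).mono fun _ h => h.le
  have bf := hb hf
  have bg := hb hg
  obtain ⟨K, t, ht, h⟩ := hf
  obtain ⟨K', t', ht', h'⟩ := hg
  refine ⟨K * Real.toNNReal (|g x| + 1) + Real.toNNReal (|f x| + 1) * K', _,
    inter_mem (inter_mem ht ht') (inter_mem bf bg), LipschitzOnWith.of_dist_le_mul ?_⟩
  intro y hy z hz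
  have h1 := h.dist_le_mul y hy.1.1 z hz.1.1
  have h2 := h'.dist_le_mul y hy.1.2 z hz.1.2
  have b1 : |f z| ≤ |f x| + 1 := hz.2.1
  have b2 : |g y| ≤ |g x| + 1 := hy.2.2
  rw [Real.dist_eq] at h1 h2 ⊢
  have e : f y * g y - f z * g z = (f y - f z) * g y + f z * (g y - g z) := by ring
  rw [e, NNReal.coe_add, NNReal.coe_mul, NNReal.coe_mul, Real.coe_toNNReal _ (by positivity),
    Real.coe_toNNReal _ (by positivity)]
  refine (abs_add_le _ _).trans ?_
  rw [abs_mul, abs_mul, add_mul]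
  refine add_le_add ?_ ?_
  · calc |f y - f z| * |g y| ≤ (K * dist y z) * (|g x| + 1) := by gcongr
      _ = _ := by ring
  · calc |f z| * |g y - g z| ≤ (|f x| + 1) * (K' * dist y z) := by gcongr
      _ = _ := by ring

end LocLipAt

/-- Induction on the number of closed sets. Let A i contain a, and let c be the last point of [a, b]
in A i. From a to c the bound on A i applies. Beyond c only the other sets are met, and since their
union is closed it contains c too, so the induction hypothesis applies on [c, b]. -/
theorem abs_sub_le_of_closed_cover {ι : Type*} (s : Finset ι) {A : ι → Set ℝ}
    (hA : ∀ i ∈ s, IsClosed (A i)) {h : ℝ → ℝ} {K b : ℝ} : ∀ a ≤ b,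
    (∀ t ∈ Set.Icc a b, ∃ i ∈ s, t ∈ A i) →
    (∀ i ∈ s, ∀ t ∈ A i ∩ Set.Icc a b, ∀ t' ∈ A i ∩ Set.Icc a b, |h t - h t'| ≤ K * |t - t'|) →
    |h a - h b| ≤ K * (b - a) := by
  classical
  induction s using Finset.strongInduction with
  | H s ih =>
    intro a hab hcov hlip
    obtain ⟨i, hi, hai⟩ := hcov a ⟨le_rfl, hab⟩
    have hcomp : IsCompact (A i ∩ Set.Icc a b) := isCompact_Icc.inter_left (hA i hi)
    obtain ⟨c, hc, hmax⟩ := hcomp.exists_isMaxOn (f := id) ⟨a, hai, le_rfl, hab⟩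
      continuous_id.continuousOn
    have h1 := hlip i hi a ⟨hai, le_rfl, hab⟩ c hc
    rw [abs_of_nonpos (by linarith [hc.2.1] : a - c ≤ 0)] at h1
    rcases hc.2.2.eq_or_lt with hcb | hcb
    · subst hcb; linarith
    have hcl : IsClosed (⋃ j ∈ s.erase i, A j) :=
      isClosed_biUnion_finset fun j hj => hA j (Finset.mem_of_mem_erase hj)
    have hsub : Set.Ioc c b ⊆ ⋃ j ∈ s.erase i, A j := by
      intro t ht
      obtain ⟨j, hj, htj⟩ := hcov t ⟨hc.2.1.trans ht.1.le, ht.2⟩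
      refine Set.mem_biUnion (Finset.mem_erase.2 ⟨?_, hj⟩) htj
      rintro rfl
      exact absurd (hmax ⟨htj, hc.2.1.trans ht.1.le, ht.2⟩) (not_le.2 ht.1)
    have hsub' := closure_minimal hsub hcl
    rw [closure_Ioc hcb.ne] at hsub'
    have h2 := ih (s.erase i) (Finset.erase_ssubset hi)
      (fun j hj => hA j (Finset.mem_of_mem_erase hj)) c hcb.le
      (fun t ht => by
        obtain ⟨j, hj, htj⟩ := Set.mem_iUnion₂.1 (hsub' ht)
        exact ⟨j, hj, htj⟩)
      (fun j hj t ht t' ht' => hlip j (Finset.mem_of_mem_erase hj) t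
        ⟨ht.1, hc.2.1.trans ht.2.1, ht.2.2⟩ t' ⟨ht'.1, hc.2.1.trans ht'.2.1, ht'.2.2⟩)
    have := abs_sub_le (h a) (h c) (h b)
    linarith

/-- A function that agrees with locally Lipschitz functions on the members of a finite closed
cover is locally Lipschitz. -/
theorem LocLipAt.of_closed_cover {ι : Type*} [Fintype ι] {A : ι → Set ℂ} (hA : ∀ i, IsClosed (A i))
    {x : ℂ} (hcov : ∀ᶠ z in 𝓝 x, ∃ i, z ∈ A i) {f : ℂ → ℝ} {F : ι → ℂ → ℝ}
    (h : ∀ i, x ∈ A i → LocLipAt (F i) x ∧ ∀ᶠ z in 𝓝 x, z ∈ A i → f z = F i z) :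
    LocLipAt f x := by
  have key : ∀ i, ∃ K : NNReal, ∃ t ∈ 𝓝 x, ∀ y ∈ t ∩ A i, ∀ z ∈ t ∩ A i,
      |f y - f z| ≤ K * dist y z := by
    intro i
    by_cases hx : x ∈ A i
    · obtain ⟨⟨K, t, ht, hK⟩, he⟩ := h i hx
      refine ⟨K, _, inter_mem ht he, fun y hy z hz => ?_⟩
      rw [show f y = F i y from hy.1.2 hy.2, show f z = F i z from hz.1.2 hz.2]
      exact hK.dist_le_mul y hy.1.1 z hz.1.1
    · exact ⟨0, (A i)ᶜ, (hA i).isOpen_compl.mem_nhds hx, fun y hy => absurd hy.2 hy.1⟩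
  choose K t ht hK using key
  obtain ⟨ε, hε, hball⟩ := Metric.mem_nhds_iff.1
    (inter_mem hcov (iInter_mem.2 ht))
  refine ⟨∑ i, K i, Metric.ball x ε, Metric.ball_mem_nhds x hε, LipschitzOnWith.of_dist_le_mul ?_⟩
  intro y hy z hz
  -- The ball is convex, so the problem reduces to the segment from y to z, where the
  -- one-dimensional statement applies with the sum of the constants.
  have hseg : ∀ s ∈ Set.Icc (0 : ℝ) 1, y + s • (z - y) ∈ Metric.ball x ε := by
    intro s hs
    exact (convex_ball x ε).add_smul_sub_mem hy hz hs
  have hKle : ∀ i, (K i : ℝ) ≤ (∑ i, K i : NNReal) := fun i => by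
    exact_mod_cast Finset.single_le_sum (fun _ _ => zero_le) (Finset.mem_univ i)
  have := abs_sub_le_of_closed_cover (Finset.univ : Finset ι)
    (A := fun i => (fun s : ℝ => y + s • (z - y)) ⁻¹' A i)
    (fun i _ => (hA i).preimage (by fun_prop)) (h := fun s : ℝ => f (y + s • (z - y)))
    (K := (∑ i, K i : NNReal) * dist y z) (b := 1) 0 zero_le_one
    (fun s hs => by
      obtain ⟨i, hi⟩ := (hball (hseg s hs)).1
      exact ⟨i, Finset.mem_univ _, hi⟩)
    (fun i _ s hs s' hs' => by
      have h1 := hK i _ ⟨Set.mem_iInter.1 (hball (hseg s hs.2)).2 i, hs.1⟩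
        _ ⟨Set.mem_iInter.1 (hball (hseg s' hs'.2)).2 i, hs'.1⟩
      refine h1.trans ?_
      rw [dist_add_left, dist_eq_norm, ← sub_smul, norm_smul, Real.norm_eq_abs,
        dist_eq_norm, norm_sub_rev z y, mul_assoc, mul_comm ‖y - z‖]
      gcongr
      exact hKle i)
  simpa [Real.dist_eq] using this

/-- Compactness gives one constant on a ball whose radius exceeds that of the support by 1. A point
of the support and a point outside that ball are at distance at least 1, so there the supremum of
|f| serves as a constant. -/
theorem exists_lipschitzWith_of_hasCompactSupport {f : ℂ → ℝ} (h : ∀ x, LocLipAt f x)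
    (hc : HasCompactSupport f) : ∃ C, LipschitzWith C f := by
  have hcont : Continuous f := continuous_iff_continuousAt.2 fun x => (h x).continuousAt
  obtain ⟨B, hB⟩ := hc.exists_bound_of_continuous hcont
  obtain ⟨R, hR⟩ := hc.isBounded.subset_closedBall (0 : ℂ)
  have hloc : LocallyLipschitzOn (Metric.closedBall (0 : ℂ) (R + 1)) f := by
    intro x _
    obtain ⟨K, t, ht, hK⟩ := h x
    exact ⟨K, t, mem_nhdsWithin_of_mem_nhds ht, hK⟩
  obtain ⟨C, hC⟩ := hloc.exists_lipschitzOnWith_of_compact (isCompact_closedBall _ _)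
  have hB0 : 0 ≤ B := (norm_nonneg _).trans (hB 0)
  have key : ∀ y z, y ∈ tsupport f → dist (f y) (f z) ≤ max C B.toNNReal * dist y z := by
    intro y z hy
    have hy' : ‖y‖ ≤ R := by simpa using hR hy
    by_cases hz : ‖z‖ ≤ R + 1
    · refine (hC.dist_le_mul y (by simp; linarith) z (by simpa using hz)).trans ?_
      gcongr
      exact_mod_cast le_max_left _ _
    · have hz0 : f z = 0 := image_eq_zero_of_notMem_tsupport fun h' => by
        have : ‖z‖ ≤ R := by simpa using hR h'
        linarith
      have hd : 1 ≤ dist y z := by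
        rw [dist_comm, dist_eq_norm]
        linarith [norm_sub_norm_le z y]
      rw [hz0, dist_zero_right]
      calc ‖f y‖ ≤ B * 1 := by linarith [hB y]
        _ ≤ (max C B.toNNReal : NNReal) * dist y z := by
          gcongr
          rw [NNReal.coe_max, Real.coe_toNNReal _ hB0]
          exact le_max_right _ _
  refine ⟨max C B.toNNReal, LipschitzWith.of_dist_le_mul fun y z => ?_⟩
  by_cases hy : y ∈ tsupport f
  · exact key y z hy
  by_cases hz : z ∈ tsupport f
  · rw [dist_comm (f y), dist_comm y]; exact key z y hz
  · rw [image_eq_zero_of_notMem_tsupport hy, image_eq_zero_of_notMem_tsupport hz, dist_self]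
    positivity

/-! ### Limits of test functions. -/

/-- The test functions `φ k` converge to `v`, with weak gradient `H`, in `W^{1,p}(Ω)`. -/
structure IsTestLimit (Ω : Set ℂ) (p : ℝ) (v : ℂ → ℝ) (H : ℂ → ℂ) (φ : ℕ → ℂ → ℝ) : Prop where
  memLp : MemLp v (ENNReal.ofReal p) (volume.restrict Ω)
  memLp_grad : MemLp H (ENNReal.ofReal p) (volume.restrict Ω)
  isTest : ∀ k, IsTest Ω (φ k)
  tendsto : Tendsto (fun k => eLpNorm (fun x => v x - φ k x) (ENNReal.ofReal p)
    (volume.restrict Ω)) atTop (𝓝 0)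
  tendsto_grad : Tendsto (fun k => eLpNorm (fun x => H x - gradient (φ k) x) (ENNReal.ofReal p)
    (volume.restrict Ω)) atTop (𝓝 0)

theorem IsTest.exists_bound_gradient {Ω : Set ℂ} {φ : ℂ → ℝ} (h : IsTest Ω φ) :
    ∃ C, ∀ x, ‖gradient φ x‖ ≤ C := by
  obtain ⟨C, hC⟩ := h.lipschitz
  exact ⟨C, fun x => by rw [norm_gradient]; exact norm_fderiv_le_of_lipschitz ℝ hC⟩

theorem IsTest.memLp {Ω : Set ℂ} {φ : ℂ → ℝ} (h : IsTest Ω φ) (hΩ : volume Ω ≠ ∞) (p : ℝ≥0∞) :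
    MemLp φ p (volume.restrict Ω) := by
  have := isFiniteMeasure_restrict hΩ
  obtain ⟨C, hC⟩ := h.2.1.exists_bound_of_continuous h.1.continuous
  exact MemLp.of_bound h.1.continuous.aestronglyMeasurable C (.of_forall hC)

theorem IsTest.memLp_gradient {Ω : Set ℂ} {φ : ℂ → ℝ} (h : IsTest Ω φ) (hΩ : volume Ω ≠ ∞)
    (p : ℝ≥0∞) : MemLp (gradient φ) p (volume.restrict Ω) := by
  have := isFiniteMeasure_restrict hΩ
  obtain ⟨C, hC⟩ := h.exists_bound_gradient
  exact MemLp.of_bound (measurable_gradient φ).aestronglyMeasurable C (.of_forall hC)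

theorem gradient_sub_of_isTest {Ω : Set ℂ} {φ ψ : ℂ → ℝ} (h : IsTest Ω φ) (h' : IsTest Ω ψ)
    (x : ℂ) : gradient (fun x => φ x - ψ x) x = gradient φ x - gradient ψ x := by
  have h1 : DifferentiableAt ℝ φ x := h.contDiff_one.differentiable (by simp) x
  have h2 : DifferentiableAt ℝ ψ x := h'.contDiff_one.differentiable (by simp) x
  rw [gradient, fderiv_fun_sub h1 h2, map_sub]
  rfl

theorem gradient_mul {f g : ℂ → ℝ} {x : ℂ} (hf : DifferentiableAt ℝ f x)
    (hg : DifferentiableAt ℝ g x) :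
    gradient (fun x => f x * g x) x = f x • gradient g x + g x • gradient f x := by
  rw [gradient, fderiv_fun_mul hf hg, map_add, map_smulₛₗ, map_smulₛₗ]
  rfl

/-- Hölder's inequality on a set of finite measure; the constant depends on neither the function nor
the target space. -/
theorem exists_le_mul_eLpNorm {Ω : Set ℂ} (hΩ : volume Ω ≠ ∞) {s r : ℝ} (hs : 1 ≤ s)
    (hsr : s ≤ r) : ∃ M : ℝ≥0∞, M ≠ ∞ ∧ ∀ {E : Type} [NormedAddCommGroup E] {f : ℂ → E},
      AEStronglyMeasurable f (volume.restrict Ω) →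
      eLpNorm f (ENNReal.ofReal s) (volume.restrict Ω) ≤
        eLpNorm f (ENNReal.ofReal r) (volume.restrict Ω) * M := by
  have := isFiniteMeasure_restrict hΩ
  refine ⟨_, ?_, fun hf => eLpNorm_le_eLpNorm_mul_rpow_measure_univ
    (ENNReal.ofReal_le_ofReal hsr) hf⟩
  refine ENNReal.rpow_ne_top_of_nonneg ?_ (measure_ne_top _ _)
  rw [ENNReal.toReal_ofReal (by linarith), ENNReal.toReal_ofReal (by linarith), sub_nonneg]
  exact one_div_le_one_div_of_le (by linarith) hsr

theorem tendsto_eLpNorm_of_exponent_le {Ω : Set ℂ} (hΩ : volume Ω ≠ ∞) {s r : ℝ} (hs : 1 ≤ s)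
    (hsr : s ≤ r) {E : Type} [NormedAddCommGroup E] {f : ℕ → ℂ → E}
    (hf : ∀ k, AEStronglyMeasurable (f k) (volume.restrict Ω))
    (h : Tendsto (fun k => eLpNorm (f k) (ENNReal.ofReal r) (volume.restrict Ω)) atTop (𝓝 0)) :
    Tendsto (fun k => eLpNorm (f k) (ENNReal.ofReal s) (volume.restrict Ω)) atTop (𝓝 0) := by
  obtain ⟨M, hM, hle⟩ := exists_le_mul_eLpNorm hΩ hs hsr
  refine tendsto_of_tendsto_of_tendsto_of_le_of_le tendsto_const_nhds ?_ (fun _ => zero_le)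
    fun k => hle (hf k)
  simpa using ENNReal.Tendsto.mul_const h (.inr hM)

namespace IsTestLimit
variable {Ω : Set ℂ} {p : ℝ} {v : ℂ → ℝ} {H : ℂ → ℂ} {φ : ℕ → ℂ → ℝ}

theorem exponent_le (h : IsTestLimit Ω p v H φ) (hΩ : volume Ω ≠ ∞) {s : ℝ} (hs : 1 ≤ s)
    (hsp : s ≤ p) : IsTestLimit Ω s v H φ := by
  have := isFiniteMeasure_restrict hΩ
  have hle := ENNReal.ofReal_le_ofReal hsp
  exact ⟨h.memLp.mono_exponent hle, h.memLp_grad.mono_exponent hle, h.isTest,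
    tendsto_eLpNorm_of_exponent_le hΩ hs hsp
      (fun k => h.memLp.1.sub ((h.isTest k).memLp hΩ 1).1) h.tendsto,
    tendsto_eLpNorm_of_exponent_le hΩ hs hsp
      (fun k => h.memLp_grad.1.sub ((h.isTest k).memLp_gradient hΩ 1).1) h.tendsto_grad⟩

theorem hasWeakGradient (h : IsTestLimit Ω p v H φ) (hΩ : volume Ω ≠ ∞) (hp : 1 ≤ p) :
    HasWeakGradient Ω v H :=
  HasWeakGradient.of_tendsto hΩ (by simpa using hp) h.memLp h.memLp_grad
    (fun k => (h.isTest k).hasWeakGradient) (fun k => (h.isTest k).memLp hΩ _)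
    (fun k => (h.isTest k).memLp_gradient hΩ _) h.tendsto h.tendsto_grad

theorem memWZero (h : IsTestLimit Ω p v H φ) (hΩ : volume Ω ≠ ∞) (hp : 1 ≤ p) :
    MemWZero Ω p v := by
  have hw := h.hasWeakGradient hΩ hp
  refine ⟨⟨h.memLp, H, hw, h.memLp_grad⟩, φ, h.isTest, ?_⟩
  refine tendsto_of_tendsto_of_tendsto_of_le_of_le tendsto_const_nhds ?_ (fun _ => zero_le)
    fun k => sobolevNorm_le hp (hw.sub (h.isTest k).hasWeakGradient)
  simpa using h.tendsto.add h.tendsto_grad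

theorem sub_isTest (h : IsTestLimit Ω p v H φ) (hΩ : volume Ω ≠ ∞) {ψ : ℂ → ℝ}
    (hψ : IsTest Ω ψ) : IsTestLimit Ω p (fun x => v x - ψ x) (fun x => H x - gradient ψ x)
      (fun k x => φ k x - ψ x) := by
  refine ⟨h.memLp.sub (hψ.memLp hΩ _), h.memLp_grad.sub (hψ.memLp_gradient hΩ _),
    fun k => (h.isTest k).sub hψ, ?_, ?_⟩
  · simpa using h.tendsto
  · simpa [gradient_sub_of_isTest (h.isTest _) hψ] using h.tendsto_grad

end IsTestLimit

/-- The infimum in `sobolevNorm` may be nearly attained by a different weak gradient for each k. By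
uniqueness each of them is almost everywhere H - ∇φ_k with one fixed H. -/
theorem MemWZero.exists_isTestLimit {Ω : Set ℂ} (hO : IsOpen Ω) {p : ℝ}
    (hp : 1 ≤ p) {v : ℂ → ℝ} (h : MemWZero Ω p v) : ∃ H φ, IsTestLimit Ω p v H φ := by
  obtain ⟨⟨hv, H, hH, hHm⟩, φ, hφ, hlim⟩ := h
  have key : ∀ ε > 0, ∀ᶠ k in atTop,
      eLpNorm (fun x => v x - φ k x) (ENNReal.ofReal p) (volume.restrict Ω) ≤ ε ∧
      eLpNorm (fun x => H x - gradient (φ k) x) (ENNReal.ofReal p) (volume.restrict Ω) ≤ ε := by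
    intro ε hε
    filter_upwards [hlim.eventually (gt_mem_nhds hε)] with k hk
    obtain ⟨F, hF, h1, h2⟩ := exists_of_sobolevNorm_lt hp hk
    refine ⟨h1.le, le_of_eq_of_le (eLpNorm_congr_ae ?_) h2.le⟩
    exact (hH.sub (hφ k).hasWeakGradient).ae_eq hO hF
  exact ⟨H, φ, hv, hHm, hφ, ENNReal.tendsto_nhds_zero.2 fun ε hε => (key ε hε).mono fun _ h => h.1,
    ENNReal.tendsto_nhds_zero.2 fun ε hε => (key ε hε).mono fun _ h => h.2⟩

/-! ### Multiplication by Hardy cut-off functions. -/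

/-- A cut-off function on `Ω` whose gradient is controlled by a Hardy inequality, so that it
multiplies `W_0^{1,r}(Ω)`; it equals `1` off the set `E`. -/
structure IsHardyCutoff (Ω : Set ℂ) (r : ℝ) (C : ℝ≥0∞) (E : Set ℂ) (Λ : ℂ → ℝ) : Prop where
  measurableSet : MeasurableSet E
  locLip : ∀ x ∈ Ω, LocLipAt Λ x
  differentiable : ∀ᵐ x ∂volume.restrict Ω, DifferentiableAt ℝ Λ x
  mem_Icc : ∀ᵐ x ∂volume.restrict Ω, Λ x ∈ Set.Icc 0 1
  eq_one : ∀ᵐ x ∂volume.restrict Ω, x ∉ E → Λ x = 1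
  hardy : ∀ φ, IsTest Ω φ →
    eLpNorm (fun x => φ x • gradient Λ x) (ENNReal.ofReal r) (volume.restrict Ω) ≤
      C * eLpNorm (gradient φ) (ENNReal.ofReal r) (volume.restrict (Ω ∩ E))

namespace IsHardyCutoff
variable {Ω : Set ℂ} {r : ℝ} {C : ℝ≥0∞} {E : Set ℂ} {Λ : ℂ → ℝ}

theorem aestronglyMeasurable (h : IsHardyCutoff Ω r C E Λ) (hO : IsOpen Ω) :
    AEStronglyMeasurable Λ (volume.restrict Ω) := by
  have : ContinuousOn Λ Ω := fun x hx => (h.locLip x hx).continuousAt.continuousWithinAt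
  exact this.aestronglyMeasurable hO.measurableSet

theorem locLipAt_mul (h : IsHardyCutoff Ω r C E Λ) {φ : ℂ → ℝ} (hφ : IsTest Ω φ) (x : ℂ) :
    LocLipAt (fun x => Λ x * φ x) x := by
  by_cases hx : x ∈ Ω
  · exact (h.locLip x hx).mul (.of_contDiffAt hφ.contDiff_one.contDiffAt)
  · have hx' : x ∉ tsupport φ := fun h' => hx (hφ.2.2 h')
    refine (LocLipAt.const 0 x).congr ?_
    filter_upwards [(isClosed_tsupport φ).isOpen_compl.mem_nhds hx'] with z hz
    rw [image_eq_zero_of_notMem_tsupport hz, mul_zero]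

theorem hasCompactSupport_mul {φ : ℂ → ℝ} (hφ : IsTest Ω φ) :
    HasCompactSupport fun x => Λ x * φ x := hφ.2.1.mul_left

theorem tsupport_mul_subset {φ : ℂ → ℝ} (hφ : IsTest Ω φ) :
    tsupport (fun x => Λ x * φ x) ⊆ Ω :=
  (tsupport_mul_subset_right (f := Λ) (g := φ)).trans hφ.2.2

theorem gradient_mul_ae (h : IsHardyCutoff Ω r C E Λ) {φ : ℂ → ℝ} (hφ : IsTest Ω φ) :
    gradient (fun x => Λ x * φ x) =ᵐ[volume.restrict Ω]
      fun x => Λ x • gradient φ x + φ x • gradient Λ x := by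
  filter_upwards [h.differentiable] with x hx
  exact gradient_mul hx (hφ.contDiff_one.differentiable (by simp) x)

/-- Extends the Hardy bound from test functions to their limits: a subsequence of φ converges almost
everywhere, and Fatou's lemma applies because the bounds converge with the gradients. -/
theorem eLpNorm_smul_gradient_le (h : IsHardyCutoff Ω r C E Λ) (hΩ : volume Ω ≠ ∞) (hr : 1 ≤ r)
    (hC : C ≠ ∞) {v : ℂ → ℝ} {H : ℂ → ℂ} {φ : ℕ → ℂ → ℝ} (hv : IsTestLimit Ω r v H φ) :
    eLpNorm (fun x => v x • gradient Λ x) (ENNReal.ofReal r) (volume.restrict Ω) ≤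
      C * eLpNorm H (ENNReal.ofReal r) (volume.restrict (Ω ∩ E)) := by
  have hr' : (1 : ℝ≥0∞) ≤ ENNReal.ofReal r := by simpa using hr
  have hmono : volume.restrict (Ω ∩ E) ≤ volume.restrict Ω :=
    Measure.restrict_mono Set.inter_subset_left le_rfl
  have hm : TendstoInMeasure (volume.restrict Ω) φ atTop v := by
    refine tendstoInMeasure_of_tendsto_eLpNorm (p := ENNReal.ofReal r) (by positivity)
      (fun k => ((hv.isTest k).memLp hΩ 1).1) hv.memLp.1 ?_
    refine hv.tendsto.congr fun k => ?_
    rw [← eLpNorm_neg]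
    congr 1; ext x; simp
  obtain ⟨ns, hns, hae⟩ := hm.exists_seq_tendsto_ae
  have hmeas : ∀ k, AEStronglyMeasurable (fun x => φ (ns k) x • gradient Λ x)
      (volume.restrict Ω) := fun k =>
    ((hv.isTest _).memLp hΩ 1).1.smul (measurable_gradient Λ).aestronglyMeasurable
  have hlim : ∀ᵐ x ∂volume.restrict Ω, Tendsto (fun k => φ (ns k) x • gradient Λ x) atTop
      (𝓝 (v x • gradient Λ x)) := by
    filter_upwards [hae] with x hx
    exact hx.smul_const _
  refine (Lp.eLpNorm_lim_le_liminf_eLpNorm hmeas _ hlim).trans ?_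
  have hb : ∀ k, eLpNorm (fun x => φ (ns k) x • gradient Λ x) (ENNReal.ofReal r)
      (volume.restrict Ω) ≤ C * (eLpNorm H (ENNReal.ofReal r) (volume.restrict (Ω ∩ E)) +
        eLpNorm (fun x => H x - gradient (φ (ns k)) x) (ENNReal.ofReal r)
          (volume.restrict Ω)) := by
    intro k
    refine (h.hardy _ (hv.isTest _)).trans ?_
    gcongr
    have e : gradient (φ (ns k)) = H - fun x => H x - gradient (φ (ns k)) x := by
      ext x; simp
    have hHm := hv.memLp_grad.1.mono_measure hmono
    rw [e]
    refine (eLpNorm_sub_le hHm (hHm.sub ?_) hr').trans ?_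
    · exact (measurable_gradient _).aestronglyMeasurable
    · rw [← e]
      gcongr
      exact eLpNorm_mono_measure _ hmono
  have ht : Tendsto (fun k => C * (eLpNorm H (ENNReal.ofReal r) (volume.restrict (Ω ∩ E)) +
        eLpNorm (fun x => H x - gradient (φ (ns k)) x) (ENNReal.ofReal r)
          (volume.restrict Ω))) atTop
      (𝓝 (C * (eLpNorm H (ENNReal.ofReal r) (volume.restrict (Ω ∩ E)) + 0))) :=
    ENNReal.Tendsto.const_mul
      (tendsto_const_nhds.add (hv.tendsto_grad.comp hns.tendsto_atTop)) (.inr hC)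
  rw [add_zero] at ht
  rw [← ht.liminf_eq]
  exact liminf_le_liminf (.of_forall hb)

theorem eLpNorm_smul_le (h : IsHardyCutoff Ω r C E Λ) {F : Type*} [NormedAddCommGroup F]
    [NormedSpace ℝ F] (f : ℂ → F) (p : ℝ≥0∞) :
    eLpNorm (fun x => Λ x • f x) p (volume.restrict Ω) ≤ eLpNorm f p (volume.restrict Ω) := by
  refine eLpNorm_mono_ae ?_
  filter_upwards [h.mem_Icc] with x hx
  rw [norm_smul, Real.norm_of_nonneg hx.1]
  exact mul_le_of_le_one_left (norm_nonneg _) hx.2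

theorem eLpNorm_sub_one_smul_le (h : IsHardyCutoff Ω r C E Λ) {F : Type*} [NormedAddCommGroup F]
    [NormedSpace ℝ F] (f : ℂ → F) (p : ℝ≥0∞) :
    eLpNorm (fun x => (Λ x - 1) • f x) p (volume.restrict Ω) ≤
      eLpNorm f p (volume.restrict (Ω ∩ E)) := by
  rw [Set.inter_comm, ← Measure.restrict_restrict h.measurableSet,
    ← eLpNorm_indicator_eq_eLpNorm_restrict h.measurableSet]
  refine eLpNorm_mono_ae ?_
  filter_upwards [h.mem_Icc, h.eq_one] with x hx hx'
  by_cases hE : x ∈ E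
  · rw [Set.indicator_of_mem hE, norm_smul, Real.norm_of_nonpos (by linarith [hx.2])]
    exact mul_le_of_le_one_left (norm_nonneg _) (by linarith [hx.1])
  · simp [hx' hE]

theorem exists_isTestLimit (h : IsHardyCutoff Ω r C E Λ) (hO : IsOpen Ω) (hΩ : volume Ω ≠ ∞)
    (hr : 1 ≤ r) (hC : C ≠ ∞) {v : ℂ → ℝ} {H : ℂ → ℂ} {φ : ℕ → ℂ → ℝ}
    (hv : IsTestLimit Ω r v H φ) :
    ∃ χ, IsTestLimit Ω r (fun x => Λ x * v x) (fun x => Λ x • H x + v x • gradient Λ x) χ := by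
  have hr' : (1 : ℝ≥0∞) ≤ ENNReal.ofReal r := by simpa using hr
  set q := ENNReal.ofReal r with hq
  set μ := volume.restrict Ω with hμ
  have hΛ := h.aestronglyMeasurable hO
  have hmono : volume.restrict (Ω ∩ E) ≤ μ := Measure.restrict_mono Set.inter_subset_left le_rfl
  have hgm : AEStronglyMeasurable (gradient Λ) μ := (measurable_gradient Λ).aestronglyMeasurable
  -- The product Λ φ_k is Lipschitz with compact support in Ω but need not be smooth; mollification
  -- gives a test function within 1/(k + 1) of it, for the function and for the gradient.
  have hchoice : ∀ k : ℕ, ∃ χ, IsTest Ω χ ∧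
      eLpNorm (fun x => Λ x * φ k x - χ x) q μ ≤ (k + 1 : ℝ≥0∞)⁻¹ ∧
      eLpNorm (fun x => Λ x • gradient (φ k) x + φ k x • gradient Λ x - gradient χ x) q μ ≤
        (k + 1 : ℝ≥0∞)⁻¹ := by
    intro k
    have hk := hv.isTest k
    obtain ⟨L, hL⟩ := exists_lipschitzWith_of_hasCompactSupport (h.locLipAt_mul hk)
      (hasCompactSupport_mul hk)
    obtain ⟨χ, hχ, h1, h2⟩ := exists_isTest_tendsto hO hL (hasCompactSupport_mul hk)
      (tsupport_mul_subset hk) hr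
    have hpos : (0 : ℝ≥0∞) < (k + 1 : ℝ≥0∞)⁻¹ := 
      ENNReal.inv_pos.2 (ENNReal.add_ne_top.2 ⟨ENNReal.natCast_ne_top k, ENNReal.one_ne_top⟩)
    obtain ⟨i, hi1, hi2⟩ := ((ENNReal.tendsto_nhds_zero.1 h1 _ hpos).and
      (ENNReal.tendsto_nhds_zero.1 h2 _ hpos)).exists
    refine ⟨χ i, hχ i, hi1, le_of_eq_of_le (eLpNorm_congr_ae ?_) hi2⟩
    filter_upwards [h.gradient_mul_ae hk] with x hx using by rw [hx]
  choose χ hχ hχ1 hχ2 using hchoice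
  have hinv : Tendsto (fun k : ℕ => (k + 1 : ℝ≥0∞)⁻¹) atTop (𝓝 0) := by
    have := (tendsto_add_atTop_iff_nat 1).2 ENNReal.tendsto_inv_nat_nhds_zero
    simpa using this
  have hφm := fun k => (hv.isTest k).memLp hΩ q
  have hφm' := fun k => (hv.isTest k).memLp_gradient hΩ q
  have hd1 : ∀ k, AEStronglyMeasurable (fun x => v x - φ k x) μ := fun k =>
    hv.memLp.1.sub (hφm k).1
  have hd2 : ∀ k, AEStronglyMeasurable (fun x => H x - gradient (φ k) x) μ := fun k =>
    hv.memLp_grad.1.sub (hφm' k).1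
  have hHardy : ∀ {w : ℂ → ℝ} {G : ℂ → ℂ} {ψ : ℕ → ℂ → ℝ}, IsTestLimit Ω r w G ψ →
      eLpNorm (fun x => w x • gradient Λ x) q μ ≤ C * eLpNorm G q μ := fun hw =>
    (h.eLpNorm_smul_gradient_le hΩ hr hC hw).trans (by gcongr)
  refine ⟨χ, ⟨hΛ.mul hv.memLp.1, ?_⟩, ⟨(hΛ.smul hv.memLp_grad.1).add (hv.memLp.1.smul hgm), ?_⟩,
    hχ, ?_, ?_⟩
  · exact (h.eLpNorm_smul_le v q).trans_lt hv.memLp.2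
  · refine (eLpNorm_add_le (hΛ.smul hv.memLp_grad.1) (hv.memLp.1.smul hgm) hr').trans_lt ?_
    refine ENNReal.add_lt_top.2 ⟨(h.eLpNorm_smul_le H q).trans_lt hv.memLp_grad.2, ?_⟩
    exact (hHardy hv).trans_lt (ENNReal.mul_lt_top hC.lt_top hv.memLp_grad.2)
  · have hle : ∀ k, eLpNorm (fun x => Λ x * v x - χ k x) q μ ≤
        eLpNorm (fun x => v x - φ k x) q μ + (k + 1 : ℝ≥0∞)⁻¹ := by
      intro k
      have e : (fun x => Λ x * v x - χ k x) = (fun x => Λ x • (v x - φ k x)) +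
          fun x => Λ x * φ k x - χ k x := by
        ext x; simp only [Pi.add_apply, smul_eq_mul]; ring
      rw [e]
      refine (eLpNorm_add_le (hΛ.smul (hd1 k)) ((hΛ.mul (hφm k).1).sub
        ((hχ k).memLp hΩ q).1) hr').trans ?_
      gcongr
      · exact h.eLpNorm_smul_le _ q
      · exact hχ1 k
    refine tendsto_of_tendsto_of_tendsto_of_le_of_le tendsto_const_nhds ?_ (fun _ => zero_le) hle
    simpa using hv.tendsto.add hinv
  · have hle : ∀ k, eLpNorm (fun x => Λ x • H x + v x • gradient Λ x - gradient (χ k) x) q μ ≤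
        eLpNorm (fun x => H x - gradient (φ k) x) q μ +
          C * eLpNorm (fun x => H x - gradient (φ k) x) q μ + (k + 1 : ℝ≥0∞)⁻¹ := by
      intro k
      have e : (fun x => Λ x • H x + v x • gradient Λ x - gradient (χ k) x) =
          ((fun x => Λ x • (H x - gradient (φ k) x)) +
            fun x => (v x - φ k x) • gradient Λ x) +
          fun x => Λ x • gradient (φ k) x + φ k x • gradient Λ x - gradient (χ k) x := by
        ext x; simp only [Pi.add_apply]; module
      have m1 := hΛ.smul (hd2 k)
      have m2 := (hd1 k).smul hgm
      have m3 := ((hΛ.smul (hφm' k).1).add ((hφm k).1.smul hgm)).sub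
        ((hχ k).memLp_gradient hΩ q).1
      rw [e]
      refine (eLpNorm_add_le (m1.add m2) m3 hr').trans (add_le_add ?_ (hχ2 k))
      refine (eLpNorm_add_le m1 m2 hr').trans (add_le_add (h.eLpNorm_smul_le _ q) ?_)
      -- The difference v - φ_k is itself a limit of test functions, so the Hardy bound applies to
      -- it and the unbounded factor ∇Λ costs only the constant C.
      exact hHardy (hv.sub_isTest hΩ (hv.isTest k))
    refine tendsto_of_tendsto_of_tendsto_of_le_of_le tendsto_const_nhds ?_ (fun _ => zero_le) hle
    have := (hv.tendsto_grad.add (ENNReal.Tendsto.const_mul hv.tendsto_grad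
      (.inr hC))).add hinv
    simpa using this

end IsHardyCutoff

theorem HasWeakGradient.congr_ae {Ω : Set ℂ} {f f' : ℂ → ℝ} {F F' : ℂ → ℂ}
    (h : HasWeakGradient Ω f F) (hf : f =ᵐ[volume.restrict Ω] f')
    (hF : F =ᵐ[volume.restrict Ω] F') (hm : LocallyIntegrableOn f' Ω)
    (hm' : LocallyIntegrableOn F' Ω) : HasWeakGradient Ω f' F' := by
  refine ⟨hm, hm', fun φ hφ v => ?_⟩
  have e1 : ∫ x in Ω, f' x * fderiv ℝ φ x v = ∫ x in Ω, f x * fderiv ℝ φ x v :=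
    integral_congr_ae (by filter_upwards [hf] with x hx; rw [hx])
  have e2 : ∫ x in Ω, inner ℝ (F' x) v * φ x = ∫ x in Ω, inner ℝ (F x) v * φ x :=
    integral_congr_ae (by filter_upwards [hF] with x hx; rw [hx])
  rw [e1, e2]
  exact h.2.2 φ hφ v

theorem IsTestLimit.congr_ae {Ω : Set ℂ} {p : ℝ} {v v' : ℂ → ℝ} {H : ℂ → ℂ} {φ : ℕ → ℂ → ℝ}
    (h : IsTestLimit Ω p v H φ) (hv : v =ᵐ[volume.restrict Ω] v') : IsTestLimit Ω p v' H φ := by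
  refine ⟨h.memLp.ae_eq hv, h.memLp_grad, h.isTest, h.tendsto.congr fun k => ?_, h.tendsto_grad⟩
  refine eLpNorm_congr_ae ?_
  filter_upwards [hv] with x hx
  rw [hx]

/-- Absolute continuity of the integral of |f|^p. -/
theorem tendsto_eLpNorm_restrict_inter {F : Type*} [NormedAddCommGroup F] {Ω : Set ℂ} {p : ℝ}
    (hp : 0 < p) {f : ℂ → F} (hf : MemLp f (ENNReal.ofReal p) (volume.restrict Ω))
    {E : ℕ → Set ℂ} (hE : Tendsto (fun n => volume (Ω ∩ E n)) atTop (𝓝 0))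
    (hm : ∀ n, MeasurableSet (E n)) :
    Tendsto (fun n => eLpNorm f (ENNReal.ofReal p) (volume.restrict (Ω ∩ E n))) atTop (𝓝 0) := by
  have h1 : ∫⁻ x in Ω, ‖f x‖ₑ ^ p ≠ ∞ := by
    have := hf.2
    rw [eLpNorm_ofReal hp] at this
    intro h
    rw [h, ENNReal.top_rpow_of_pos (by positivity)] at this
    exact lt_irrefl _ this
  have h2 : Tendsto (fun n => ∫⁻ x in E n, ‖f x‖ₑ ^ p ∂volume.restrict Ω) atTop (𝓝 0) := by
    refine tendsto_setLIntegral_zero h1 ?_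
    refine hE.congr fun n => ?_
    rw [Function.comp_apply, Measure.restrict_apply (hm n), Set.inter_comm]
  have h3 := h2.ennrpow_const (1 / p)
  rw [ENNReal.zero_rpow_of_pos (by positivity)] at h3
  simpa only [eLpNorm_ofReal hp, Measure.restrict_restrict (hm _), Set.inter_comm _ Ω] using h3

/-- Multiplying by Hardy cut-off functions that are `1` off small sets changes the difference
of `u` and `g` little in the Sobolev norm. -/
theorem sobolev_blend {Ω : Set ℂ} (hO : IsOpen Ω) (hΩ : volume Ω ≠ ∞) {r : ℝ}
    {C : ℝ≥0∞} (hC : C ≠ ∞) {E : ℕ → Set ℂ} {Λ lam : ℕ → ℂ → ℝ}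
    (hΛ : ∀ n, IsHardyCutoff Ω r C (E n) (Λ n))
    (hE : Tendsto (fun n => volume (Ω ∩ E n)) atTop (𝓝 0))
    (hlam : ∀ n, lam n =ᵐ[volume.restrict Ω] Λ n) {g u : ℂ → ℝ} (hg : MemW Ω ∞ g)
    (hu : MemWBdry Ω r g u) {s : ℝ} (hs : 2 < s) (hsr : s < r) :
    (∀ n : ℕ, MemWBdry Ω s g (fun x => lam n x * u x + (1 - lam n x) * g x)) ∧
      (∃ B : ℝ, ∀ n : ℕ, sobolevNorm Ω s (fun x => lam n x * u x + (1 - lam n x) * g x) ≤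
        ENNReal.ofReal B) ∧
      Tendsto (fun n : ℕ => sobolevNorm Ω s
        (fun x => lam n x * u x + (1 - lam n x) * g x - u x)) atTop (𝓝 0) := by
  have := isFiniteMeasure_restrict hΩ
  have hs1 : 1 ≤ s := by linarith
  have hr1 : 1 ≤ r := by linarith
  have hs1' : (1 : ℝ≥0∞) ≤ ENNReal.ofReal s := by simpa using hs1
  have hr1' : (1 : ℝ≥0∞) ≤ ENNReal.ofReal r := by simpa using hr1
  set μ := volume.restrict Ω with hμ
  set q := ENNReal.ofReal s with hq
  have hle : q ≤ ENNReal.ofReal r := ENNReal.ofReal_le_ofReal hsr.le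
  obtain ⟨⟨hum, U, hU, hUm⟩, hv⟩ := hu
  obtain ⟨hgm, G, hG, hGm⟩ := hg
  replace hum := hum.mono_exponent hle
  replace hUm := hUm.mono_exponent hle
  replace hgm : MemLp g q μ := hgm.mono_exponent le_top
  replace hGm : MemLp G q μ := hGm.mono_exponent le_top
  obtain ⟨H, φ, hφ⟩ := hv.exists_isTestLimit hO hr1
  set v : ℂ → ℝ := fun x => u x - g x with hvdef
  set Z : ℕ → ℂ → ℂ := fun n x => Λ n x • H x + v x • gradient (Λ n) x with hZ
  have hlim : ∀ n, ∃ χ, IsTestLimit Ω s (fun x => Λ n x * v x) (Z n) χ := fun n => by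
    obtain ⟨χ, hχ⟩ := (hΛ n).exists_isTestLimit hO hΩ hr1 hC hφ
    exact ⟨χ, hχ.exponent_le hΩ hs1 hsr.le⟩
  choose χ hχ using hlim
  have hvs := hφ.exponent_le hΩ hs1 hsr.le
  have hvw := hvs.hasWeakGradient hΩ hs1
  -- the differences `z_n - u = (Λ_n - 1) v` and their weak gradients
  set D : ℕ → ℂ → ℝ := fun n x => lam n x * u x + (1 - lam n x) * g x - u x with hD
  set W : ℕ → ℂ → ℂ := fun n x => Z n x - H x with hW
  have hDae : ∀ n, D n =ᵐ[μ] fun x => Λ n x * v x - v x := fun n => by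
    filter_upwards [hlam n] with x hx
    simp only [hD, hx, hvdef]
    ring
  have hDm : ∀ n, MemLp (D n) q μ := fun n =>
    ((hχ n).memLp.sub hvs.memLp).ae_eq (hDae n).symm
  have hWm : ∀ n, MemLp (W n) q μ := fun n => (hχ n).memLp_grad.sub hvs.memLp_grad
  have hDW : ∀ n, HasWeakGradient Ω (D n) (W n) := fun n =>
    (((hχ n).hasWeakGradient hΩ hs1).sub hvw).congr_ae (hDae n).symm ae_eq_rfl
      (locallyIntegrableOn_of_memLp hs1' hΩ (hDm n)) (locallyIntegrableOn_of_memLp hs1' hΩ (hWm n))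
  have hDlim : Tendsto (fun n => eLpNorm (D n) q μ) atTop (𝓝 0) := by
    refine tendsto_of_tendsto_of_tendsto_of_le_of_le tendsto_const_nhds
      (tendsto_eLpNorm_restrict_inter (by linarith) hvs.memLp hE fun n => (hΛ n).measurableSet)
      (fun _ => zero_le) fun n => ?_
    refine (eLpNorm_congr_ae ((hDae n).trans (.of_eq ?_))).trans_le
      ((hΛ n).eLpNorm_sub_one_smul_le v q)
    ext x; simp only [smul_eq_mul]; ring
  -- The Hardy bound holds at the exponent r, so the gradients are shown to vanish in L^r first;
  -- then the exponent is lowered to s.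
  have hWlim : Tendsto (fun n => eLpNorm (W n) q μ) atTop (𝓝 0) := by
    refine tendsto_eLpNorm_of_exponent_le hΩ hs1 hsr.le (fun n => (hWm n).1) ?_
    have hm := fun n => (hΛ n).measurableSet
    have hb : ∀ n, eLpNorm (W n) (ENNReal.ofReal r) μ ≤
        eLpNorm H (ENNReal.ofReal r) (volume.restrict (Ω ∩ E n)) +
          C * eLpNorm H (ENNReal.ofReal r) (volume.restrict (Ω ∩ E n)) := by
      intro n
      have e : W n = (fun x => (Λ n x - 1) • H x) + fun x => v x • gradient (Λ n) x := by
        ext x; simp only [hW, hZ, Pi.add_apply]; module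
      rw [e]
      have hΛm := (hΛ n).aestronglyMeasurable hO
      refine (eLpNorm_add_le ((hΛm.sub aestronglyMeasurable_const).smul hφ.memLp_grad.1)
        (hφ.memLp.1.smul (measurable_gradient _).aestronglyMeasurable) hr1').trans ?_
      exact add_le_add ((hΛ n).eLpNorm_sub_one_smul_le H _)
        ((hΛ n).eLpNorm_smul_gradient_le hΩ hr1 hC hφ)
    refine tendsto_of_tendsto_of_tendsto_of_le_of_le tendsto_const_nhds ?_ (fun _ => zero_le) hb
    have ht := tendsto_eLpNorm_restrict_inter (by linarith) hφ.memLp_grad hE hm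
    simpa using ht.add (ENNReal.Tendsto.const_mul ht (.inr hC))
  have hz : ∀ n, (fun x => lam n x * u x + (1 - lam n x) * g x) = fun x => u x + D n x := by
    intro n; ext x; simp only [hD]; ring
  refine ⟨fun n => ⟨?_, ?_⟩, ?_, ?_⟩
  · rw [hz]
    exact ⟨hum.add (hDm n), _, hU.add (hDW n), hUm.add (hWm n)⟩
  · refine ((hχ n).congr_ae ?_).memWZero hΩ hs1
    filter_upwards [hlam n] with x hx
    simp only [hx, hvdef]
    ring
  -- Finite values tending to 0 are bounded: eventually by 1, and before that by their finite sum.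
  · have hbdd : ∀ {F : ℕ → ℝ≥0∞}, (∀ n, F n ≠ ∞) → Tendsto F atTop (𝓝 0) →
        ∃ B : ℝ≥0∞, B ≠ ∞ ∧ ∀ n, F n ≤ B := by
      intro F hF hF0
      obtain ⟨N, hN⟩ := eventually_atTop.1 (ENNReal.tendsto_nhds_zero.1 hF0 1 one_pos)
      refine ⟨1 + ∑ i ∈ Finset.range N, F i, ?_, fun n => ?_⟩
      · exact ENNReal.add_ne_top.2 ⟨ENNReal.one_ne_top, ENNReal.sum_ne_top.2 fun i _ => hF i⟩
      · rcases le_or_gt N n with h | h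
        · exact (hN n h).trans le_self_add
        · exact (Finset.single_le_sum (fun _ _ => zero_le) (Finset.mem_range.2 h)).trans
            le_add_self
    obtain ⟨B₁, hB₁, hB₁'⟩ := hbdd (fun n => (hDm n).2.ne) hDlim
    obtain ⟨B₂, hB₂, hB₂'⟩ := hbdd (fun n => (hWm n).2.ne) hWlim
    refine ⟨((eLpNorm u q μ + B₁) + (eLpNorm U q μ + B₂)).toReal, fun n => ?_⟩
    rw [ENNReal.ofReal_toReal (ENNReal.add_ne_top.2 ⟨ENNReal.add_ne_top.2 ⟨hum.2.ne, hB₁⟩,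
      ENNReal.add_ne_top.2 ⟨hUm.2.ne, hB₂⟩⟩), hz]
    refine (sobolevNorm_le hs1 (hU.add (hDW n))).trans (add_le_add ?_ ?_)
    · exact (eLpNorm_add_le hum.1 (hDm n).1 hs1').trans (by gcongr; exact hB₁' n)
    · exact (eLpNorm_add_le hUm.1 (hWm n).1 hs1').trans (by gcongr; exact hB₂' n)
  · refine tendsto_of_tendsto_of_tendsto_of_le_of_le tendsto_const_nhds ?_ (fun _ => zero_le)
      fun n => sobolevNorm_le hs1 (hDW n)
    simpa using hDlim.add hWlim

/-! ### The Koch maps in terms of the half base d and the height H of the bump. -/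

/-- Half of the length of the base of the bump. -/
def halfBase (α : ℝ) : ℝ := 1 / 2 - 1 / α

/-- The height of the bump. -/
def height (α : ℝ) : ℝ := √(1 / α - 1 / 4)

/-- The parameters for which the inner fibers of slope `K` fit into the pre-fractal domains. -/
structure Admissible (α K : ℝ) : Prop where
  two_lt : 2 < α
  lt_four : α < 4
  pos : 0 < K
  le_two_height : K ≤ 2 * height α
  mul_height_le : K * height α ≤ halfBase α

/-- From here on α is traded for d: the contraction ratio 1/α is 1/2 - d. -/
theorem one_div_eq (α : ℝ) : 1 / α = 1 / 2 - halfBase α := by rw [halfBase]; ring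

namespace Admissible
variable {α K : ℝ} (h : Admissible α K)
include h

theorem alpha_pos : 0 < α := by linarith [h.two_lt]

theorem halfBase_pos : 0 < halfBase α := by
  have : 1 / α < 1 / 2 := one_div_lt_one_div_of_lt (by norm_num) h.two_lt
  rw [halfBase]; linarith

/-- Equivalent to d² + H² = (1/2 - d)²: the slanted sides of the bump have length 1/α. The
polynomial estimates below rest on this relation. -/
theorem height_sq : height α ^ 2 = 1 / 4 - halfBase α := by
  have : 1 / 4 < 1 / α := one_div_lt_one_div_of_lt h.alpha_pos h.lt_four
  rw [height, Real.sq_sqrt (by linarith), halfBase]; ring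

theorem height_pos : 0 < height α := by
  have : 1 / 4 < 1 / α := one_div_lt_one_div_of_lt h.alpha_pos h.lt_four
  exact Real.sqrt_pos.2 (by linarith)

theorem halfBase_lt : halfBase α < 1 / 4 := by
  have := h.height_sq
  have := h.height_pos
  nlinarith

end Admissible

/-- The slanted side of the bump from 1/α to the apex is the vector d + iH, of length 1/α and
direction θ. The cosine is the nonnegative root, and this is αd because d > 0. -/
theorem exp_angle {α K : ℝ} (h : Admissible α K) :
    Complex.exp (Complex.I * angle α) = α * (halfBase α + Complex.I * height α) := by
  have hα := h.alpha_pos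
  have h2 := h.two_lt
  have h4 := h.lt_four
  have hs : √(α * (4 - α)) / 2 = α * height α := by
    have : α * (4 - α) = (2 * (α * height α)) ^ 2 := by
      rw [mul_pow, mul_pow, h.height_sq, halfBase]
      field_simp
      ring
    rw [this, Real.sqrt_sq (by have := h.height_pos; positivity)]
    ring
  have hle : α * height α ≤ 1 := by
    have h1 : (α * height α) ^ 2 ≤ 1 := by
      rw [mul_pow, h.height_sq, halfBase]
      field_simp
      nlinarith [sq_nonneg (α - 2)]
    nlinarith
  have hsin : Real.sin (angle α) = α * height α := by
    rw [angle, hs, Real.sin_arcsin _ hle]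
    have := h.height_pos
    have : 0 < α * height α := by positivity
    linarith
  have hcos : Real.cos (angle α) = α * halfBase α := by
    rw [angle, hs, Real.cos_arcsin]
    have : 1 - (α * height α) ^ 2 = (α * halfBase α) ^ 2 := by
      rw [mul_pow, h.height_sq, halfBase]
      field_simp
      ring
    rw [this, Real.sqrt_sq (by have := h.halfBase_pos; positivity)]
  rw [mul_comm, Complex.exp_mul_I, ← Complex.ofReal_cos, ← Complex.ofReal_sin, hsin, hcos]
  push_cast
  ring

theorem exp_neg_angle {α K : ℝ} (h : Admissible α K) :
    Complex.exp (-(Complex.I * angle α)) = α * (halfBase α - Complex.I * height α) := by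
  have := congrArg (starRingEnd ℂ) (exp_angle h)
  rw [← Complex.exp_conj] at this
  simpa [sub_eq_add_neg] using this

section koch
variable {α K : ℝ} (h : Admissible α K)
include h

theorem kochMap_zero (z : ℂ) : kochMap α 0 z = ((1 / 2 - halfBase α : ℝ) : ℂ) * z := by
  rw [kochMap, ← one_div_eq α]; push_cast; ring

theorem kochMap_one (z : ℂ) : kochMap α 1 z =
    (halfBase α + Complex.I * height α) * z + ((1 / 2 - halfBase α : ℝ) : ℂ) := by
  have : (α : ℂ) ≠ 0 := by exact_mod_cast h.alpha_pos.ne'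
  rw [kochMap, exp_angle h, ← one_div_eq α]; push_cast; field_simp

theorem kochMap_two (z : ℂ) : kochMap α 2 z =
    (halfBase α - Complex.I * height α) * z + (1 / 2 + Complex.I * height α) := by
  have : (α : ℂ) ≠ 0 := by exact_mod_cast h.alpha_pos.ne'
  rw [kochMap, exp_neg_angle h, height]; field_simp

theorem kochMap_three (z : ℂ) : kochMap α 3 z =
    ((1 / 2 - halfBase α : ℝ) : ℂ) * z + ((1 / 2 + halfBase α : ℝ) : ℂ) := by
  have h1 : (1 / 2 + halfBase α : ℝ) = 1 - 1 / α := by rw [one_div_eq α]; ring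
  rw [kochMap, h1, ← one_div_eq α]; push_cast; ring

theorem kochMap_zero_re (z : ℂ) : (kochMap α 0 z).re = (1 / 2 - halfBase α) * z.re := by
  rw [kochMap_zero h]; exact Complex.re_ofReal_mul ..

theorem kochMap_zero_im (z : ℂ) : (kochMap α 0 z).im = (1 / 2 - halfBase α) * z.im := by
  rw [kochMap_zero h]; exact Complex.im_ofReal_mul ..

theorem kochMap_one_re (z : ℂ) : (kochMap α 1 z).re =
    halfBase α * z.re - height α * z.im + (1 / 2 - halfBase α) := by
  rw [kochMap_one h]; simp

theorem kochMap_one_im (z : ℂ) : (kochMap α 1 z).im = halfBase α * z.im + height α * z.re := by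
  rw [kochMap_one h]; simp

theorem kochMap_two_re (z : ℂ) : (kochMap α 2 z).re =
    halfBase α * z.re + height α * z.im + 1 / 2 := by
  rw [kochMap_two h]; simp

theorem kochMap_two_im (z : ℂ) : (kochMap α 2 z).im =
    halfBase α * z.im - height α * z.re + height α := by
  rw [kochMap_two h]; simp; ring

theorem kochMap_three_re (z : ℂ) : (kochMap α 3 z).re =
    (1 / 2 - halfBase α) * z.re + (1 / 2 + halfBase α) := by
  rw [kochMap_three h, Complex.add_re, Complex.re_ofReal_mul, Complex.ofReal_re]

theorem kochMap_three_im (z : ℂ) : (kochMap α 3 z).im = (1 / 2 - halfBase α) * z.im := by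
  rw [kochMap_three h, Complex.add_im, Complex.im_ofReal_mul, Complex.ofReal_im, add_zero]

end koch

/-! Regions in the unit cell. -/

/-- The open triangle below the unit segment with slope `K`. -/
def lowerTriangle (K : ℝ) : Set ℂ :=
  {z | z.im < 0 ∧ 0 < K * z.re + z.im ∧ 0 < K * (1 - z.re) + z.im}

/-- The open triangle above the unit segment that contains the Koch curve. -/
def upperTriangle (α : ℝ) : Set ℂ :=
  {z | 0 < z.im ∧ z.im < 2 * height α * z.re ∧ z.im < 2 * height α * (1 - z.re)}

/-- The interior of the bump. -/
def openBump (α : ℝ) : Set ℂ :=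
  {z | 0 < z.im ∧ halfBase α * z.im < height α * (z.re - (1 / 2 - halfBase α)) ∧
    halfBase α * z.im < height α * (1 / 2 + halfBase α - z.re)}

/-- The bump. -/
def closedBump (α : ℝ) : Set ℂ :=
  {z | 0 ≤ z.im ∧ halfBase α * z.im ≤ height α * (z.re - (1 / 2 - halfBase α)) ∧
    halfBase α * z.im ≤ height α * (1 / 2 + halfBase α - z.re)}

section cell
variable {α K : ℝ} (h : Admissible α K)
include h

/-- The upper triangle shares its apex with the bump and has base angles θ/2, since tan(θ/2) = 2H.
It is the triangle of the open set condition: four scaled copies fit inside, those over the slanted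
sides having an edge along an edge of the large triangle. -/
theorem kochMap_mem_upperTriangle (i : Fin 4) {z : ℂ} (hz : z ∈ upperTriangle α) :
    kochMap α i z ∈ upperTriangle α := by
  obtain ⟨h1, h2, h3⟩ := hz
  have hd := h.halfBase_pos
  have hH := h.height_pos
  have hs := h.height_sq
  have hd4 := h.halfBase_lt
  have ht0 : 0 < z.re := by nlinarith
  have ht1 : z.re < 1 := by nlinarith
  fin_cases i
  · refine ⟨?_, ?_, ?_⟩ <;>
      simp only [Fin.mk_zero, Fin.isValue, kochMap_zero_re h, kochMap_zero_im h] <;>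
      nlinarith
  · refine ⟨?_, ?_, ?_⟩ <;>
      simp only [Fin.mk_one, Fin.isValue, kochMap_one_re h, kochMap_one_im h]
    · nlinarith
    · nlinarith
    · nlinarith
  · refine ⟨?_, ?_, ?_⟩ <;>
      simp only [Fin.reduceFinMk, Fin.isValue, kochMap_two_re h, kochMap_two_im h]
    · nlinarith
    · nlinarith
    · nlinarith
  · refine ⟨?_, ?_, ?_⟩ <;>
      simp only [Fin.reduceFinMk, Fin.isValue, kochMap_three_re h, kochMap_three_im h]
    · nlinarith
    · nlinarith
    · nlinarith

theorem kochMap_mem_lowerTriangle {i : Fin 4} (hi : i = 0 ∨ i = 3) {z : ℂ}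
    (hz : z ∈ lowerTriangle K) : kochMap α i z ∈ lowerTriangle K := by
  obtain ⟨h1, h2, h3⟩ := hz
  have hd := h.halfBase_pos
  have hK := h.pos
  have hd4 := h.halfBase_lt
  rcases hi with rfl | rfl <;> refine ⟨?_, ?_, ?_⟩ <;>
    simp only [kochMap_zero_re h, kochMap_zero_im h, kochMap_three_re h, kochMap_three_im h] <;>
    nlinarith

/-- The second piece maps the triangle below the unit segment, with its open upper side,
into the left half of the bump. -/
theorem kochMap_one_fiber {z : ℂ} (h1 : z.im ≤ 0) (h2 : 0 < K * z.re + z.im)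
    (h3 : 0 < K * (1 - z.re) + z.im) : 0 < (kochMap α 1 z).im ∧ (kochMap α 1 z).re < 1 / 2 ∧
      halfBase α * (kochMap α 1 z).im - height α * ((kochMap α 1 z).re - (1 / 2 - halfBase α)) =
        (1 / 2 - halfBase α) ^ 2 * z.im := by
  have hd := h.halfBase_pos
  have hH := h.height_pos
  have hs := h.height_sq
  have hK := h.pos
  have hK2 := h.le_two_height
  have hKH := h.mul_height_le
  have hd4 := h.halfBase_lt
  have ht0 : 0 < z.re := by nlinarith
  have ht1 : z.re < 1 := by nlinarith
  simp only [kochMap_one_re h, kochMap_one_im h]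
  refine ⟨?_, ?_, ?_⟩
  · have e1 : z.im > -(2 * height α * z.re) := by nlinarith
    have : 0 < height α * z.re := by positivity
    nlinarith
  · nlinarith
  · linear_combination z.im * hs

theorem kochMap_two_fiber {z : ℂ} (h1 : z.im ≤ 0) (h2 : 0 < K * z.re + z.im)
    (h3 : 0 < K * (1 - z.re) + z.im) : 0 < (kochMap α 2 z).im ∧ 1 / 2 < (kochMap α 2 z).re ∧
      halfBase α * (kochMap α 2 z).im - height α * (1 / 2 + halfBase α - (kochMap α 2 z).re) =
        (1 / 2 - halfBase α) ^ 2 * z.im := by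
  have hd := h.halfBase_pos
  have hH := h.height_pos
  have hs := h.height_sq
  have hK := h.pos
  have hK2 := h.le_two_height
  have hKH := h.mul_height_le
  have hd4 := h.halfBase_lt
  have ht0 : 0 < z.re := by nlinarith
  have ht1 : z.re < 1 := by nlinarith
  simp only [kochMap_two_re h, kochMap_two_im h]
  refine ⟨?_, ?_, ?_⟩
  · have e1 : z.im > -(2 * height α * (1 - z.re)) := by nlinarith
    have : 0 < height α * (1 - z.re) := mul_pos hH (by linarith)
    nlinarith
  · nlinarith
  · linear_combination z.im * hs

theorem kochMap_mem_openBump {i : Fin 4} (hi : i = 1 ∨ i = 2) {z : ℂ}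
    (hz : z ∈ lowerTriangle K) : kochMap α i z ∈ openBump α := by
  have hd := h.halfBase_pos
  have hH := h.height_pos
  have hd4 := h.halfBase_lt
  obtain ⟨h1, h2, h3⟩ := hz
  have hp : (1 / 2 - halfBase α) ^ 2 * z.im < 0 := mul_neg_of_pos_of_neg (by nlinarith) h1
  rcases hi with rfl | rfl
  · obtain ⟨a, b, c⟩ := kochMap_one_fiber h h1.le h2 h3
    refine ⟨a, by linarith, by nlinarith⟩
  · obtain ⟨a, b, c⟩ := kochMap_two_fiber h h1.le h2 h3
    refine ⟨a, by nlinarith, by linarith⟩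

theorem openBump_subset_upperTriangle : openBump α ⊆ upperTriangle α := by
  rintro z ⟨h1, h2, h3⟩
  have hd := h.halfBase_pos
  have hH := h.height_pos
  have hd4 := h.halfBase_lt
  have hs := h.height_sq
  refine ⟨h1, ?_, ?_⟩
  · have e : z.re > 1 / 2 - halfBase α := by nlinarith
    have : halfBase α * (2 * height α * z.re) > halfBase α * z.im := by nlinarith
    exact lt_of_mul_lt_mul_left this hd.le
  · have e : z.re < 1 / 2 + halfBase α := by nlinarith
    have : halfBase α * (2 * height α * (1 - z.re)) > halfBase α * z.im := by nlinarith
    exact lt_of_mul_lt_mul_left this hd.le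

/-- The copies over the slanted sides lie beyond these sides, and the other two copies lie beside
the base. -/
theorem kochMap_notMem_closedBump (i : Fin 4) {z : ℂ} (hz : z ∈ upperTriangle α) :
    kochMap α i z ∉ closedBump α := by
  obtain ⟨h1, h2, h3⟩ := hz
  have hd := h.halfBase_pos
  have hH := h.height_pos
  have hs := h.height_sq
  have hd4 := h.halfBase_lt
  have ht0 : 0 < z.re := by nlinarith
  have ht1 : z.re < 1 := by nlinarith
  rintro ⟨g1, g2, g3⟩
  fin_cases i
  · simp only [Fin.mk_zero, Fin.isValue, kochMap_zero_re h, kochMap_zero_im h] at g1 g2 g3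
    nlinarith [mul_pos hd h1]
  · simp only [Fin.mk_one, Fin.isValue, kochMap_one_re h, kochMap_one_im h] at g1 g2 g3
    have : 0 < (1 / 2 - halfBase α) ^ 2 * z.im := mul_pos (by nlinarith) h1
    nlinarith
  · simp only [Fin.reduceFinMk, Fin.isValue, kochMap_two_re h, kochMap_two_im h] at g1 g2 g3
    have : 0 < (1 / 2 - halfBase α) ^ 2 * z.im := mul_pos (by nlinarith) h1
    nlinarith
  · simp only [Fin.reduceFinMk, Fin.isValue, kochMap_three_re h, kochMap_three_im h] at g1 g2 g3
    nlinarith [mul_pos hd h1]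

/-- Copies 0 and 1 lie to the left of the midline, copies 2 and 3 to the right. Two copies on the
same half are separated by the line through the edge of copy 0 or copy 3 that faces the neighbour.
-/
theorem kochMap_ne_of_upperTriangle {i j : Fin 4} (hij : i < j) {z w : ℂ}
    (hz : z ∈ upperTriangle α) (hw : w ∈ upperTriangle α) : kochMap α i z ≠ kochMap α j w := by
  have hd := h.halfBase_pos
  have hH := h.height_pos
  have hs := h.height_sq
  have hd4 := h.halfBase_lt
  have bounds : ∀ {z}, z ∈ upperTriangle α → 0 < z.re ∧ z.re < 1 := by
    rintro z ⟨h1, h2, h3⟩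
    constructor <;> nlinarith
  obtain ⟨z0, z1⟩ := bounds hz
  obtain ⟨w0, w1⟩ := bounds hw
  obtain ⟨a1, a2, a3⟩ := hz
  obtain ⟨b1, b2, b3⟩ := hw
  have left : ∀ z : ℂ, 0 < z.im → z.re < 1 → (kochMap α 1 z).re < 1 / 2 := by
    intro z h1 h2
    rw [kochMap_one_re h]
    nlinarith
  have right : ∀ z : ℂ, 0 < z.im → 0 < z.re → 1 / 2 < (kochMap α 2 z).re := by
    intro z h1 h2
    rw [kochMap_two_re h]
    nlinarith
  have left0 : ∀ z : ℂ, z.re < 1 → (kochMap α 0 z).re < 1 / 2 := by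
    intro z h2
    rw [kochMap_zero_re h]
    nlinarith
  have right3 : ∀ z : ℂ, 0 < z.re → 1 / 2 < (kochMap α 3 z).re := by
    intro z h2
    rw [kochMap_three_re h]
    nlinarith
  intro e
  have er := congrArg Complex.re e
  have ei := congrArg Complex.im e
  fin_cases i <;> fin_cases j <;>
    simp only [Fin.reduceFinMk, Fin.mk_one, Fin.mk_zero, Fin.isValue, Fin.reduceLT,
      lt_self_iff_false] at hij er ei
  · simp only [kochMap_zero_re h, kochMap_zero_im h, kochMap_one_re h, kochMap_one_im h] at er ei
    have c1 : 2 * height α * (halfBase α * w.re - height α * w.im) +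
        (halfBase α * w.im + height α * w.re) ≤ 0 := by nlinarith
    have c2 : 0 < height α * w.re := by positivity
    -- The coefficient of the imaginary part in `c1` is d - 2H², of either sign. If it is negative,
    -- the bound im < 2H re is inserted, and H² = 1/4 - d leaves 8dH re > 0.
    rcases le_or_gt (2 * height α ^ 2) (halfBase α) with hc | hc
    · nlinarith [mul_nonneg (sub_nonneg.2 hc) b1.le, mul_pos hd c2]
    · nlinarith [mul_pos (sub_pos.2 hc) (sub_pos.2 b2), mul_pos hd c2]
  · linarith [left0 z z1, right w b1 w0]
  · linarith [left0 z z1, right3 w w0]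
  · linarith [left z a1 z1, right w b1 w0]
  · linarith [left z a1 z1, right3 w w0]
  · simp only [kochMap_two_re h, kochMap_two_im h, kochMap_three_re h, kochMap_three_im h] at er ei
    have c1 : 2 * height α * (halfBase α * (1 - z.re) - height α * z.im) +
        (halfBase α * z.im + height α * (1 - z.re)) ≤ 0 := by nlinarith
    have c2 : 0 < height α * (1 - z.re) := mul_pos hH (by linarith)
    rcases le_or_gt (2 * height α ^ 2) (halfBase α) with hc | hc
    · nlinarith [mul_nonneg (sub_nonneg.2 hc) a1.le, mul_pos hd c2]
    · nlinarith [mul_pos (sub_pos.2 hc) (sub_pos.2 a3), mul_pos hd c2]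

/-- Fibers 0 and 3 stay below the axis; fibers 1 and 2 are lifted into the bump, on different sides
of its midline. -/
theorem kochMap_ne_of_lowerTriangle {i j : Fin 4} (hij : i < j) {z w : ℂ}
    (hz : z ∈ lowerTriangle K) (hw : w ∈ lowerTriangle K) : kochMap α i z ≠ kochMap α j w := by
  have hd := h.halfBase_pos
  have hK := h.pos
  have hd4 := h.halfBase_lt
  obtain ⟨a1, a2, a3⟩ := hz
  obtain ⟨b1, b2, b3⟩ := hw
  have im0 : ∀ z : ℂ, z.im < 0 → (kochMap α 0 z).im < 0 := by
    intro z hz; rw [kochMap_zero_im h]; nlinarith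
  have im3 : ∀ z : ℂ, z.im < 0 → (kochMap α 3 z).im < 0 := by
    intro z hz; rw [kochMap_three_im h]; nlinarith
  intro e
  have er := congrArg Complex.re e
  have ei := congrArg Complex.im e
  fin_cases i <;> fin_cases j <;>
    simp only [Fin.reduceFinMk, Fin.mk_one, Fin.mk_zero, Fin.isValue, Fin.reduceLT,
      lt_self_iff_false] at hij er ei
  · linarith [im0 z a1, (kochMap_one_fiber h b1.le b2 b3).1]
  · linarith [im0 z a1, (kochMap_two_fiber h b1.le b2 b3).1]
  · simp only [kochMap_zero_re h, kochMap_three_re h] at er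
    nlinarith
  · linarith [(kochMap_one_fiber h a1.le a2 a3).2.1, (kochMap_two_fiber h b1.le b2 b3).2.1]
  · linarith [im3 w b1, (kochMap_one_fiber h a1.le a2 a3).1]
  · linarith [im3 w b1, (kochMap_two_fiber h a1.le a2 a3).1]

end cell

/-! ### Orientation preserving similitudes. -/

/-- The inverse of the similitude `S`. -/
def pull (S : ℂ → ℂ) (x : ℂ) : ℂ := (x - S 0) / (S 1 - S 0)

/-- Orientation preserving similitudes of the plane. -/
structure IsSim (S : ℂ → ℂ) : Prop where
  ne : S 1 ≠ S 0
  eq : ∀ z, S z = S 0 + (S 1 - S 0) * z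

namespace IsSim
variable {S T : ℂ → ℂ}

theorem of_eq {a b : ℂ} (hb : b ≠ 0) (h : ∀ z, S z = a + b * z) : IsSim S := by
  refine ⟨?_, fun z => ?_⟩
  · rw [h, h]; simpa using hb
  · rw [h z, h 0, h 1]; ring

theorem sub_ne (h : IsSim S) : S 1 - S 0 ≠ 0 := sub_ne_zero.2 h.ne

theorem pull_apply (h : IsSim S) (z : ℂ) : pull S (S z) = z := by
  rw [pull, h.eq z, add_sub_cancel_left, mul_div_cancel_left₀ _ h.sub_ne]

theorem apply_pull (h : IsSim S) (x : ℂ) : S (pull S x) = x := by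
  rw [h.eq, pull, mul_div_cancel₀ _ h.sub_ne, add_sub_cancel]

theorem injective (h : IsSim S) : Function.Injective S := fun z w e => by
  rw [← h.pull_apply z, e, h.pull_apply]

theorem comp (hS : IsSim S) (hT : IsSim T) : IsSim (S ∘ T) := by
  refine of_eq (a := S (T 0)) (b := (S 1 - S 0) * (T 1 - T 0))
    (mul_ne_zero hS.sub_ne hT.sub_ne) fun z => ?_
  rw [Function.comp, hS.eq (T z), hS.eq (T 0), hT.eq z]
  ring

theorem pull_comp (hS : IsSim S) (hT : IsSim T) (x : ℂ) :
    pull (S ∘ T) x = pull T (pull S x) := by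
  apply (hS.comp hT).injective
  rw [(hS.comp hT).apply_pull, Function.comp, hT.apply_pull, hS.apply_pull]

theorem comp_sub (hS : IsSim S) (z w : ℂ) : S z - S w = (S 1 - S 0) * (z - w) := by
  rw [hS.eq z, hS.eq w]; ring

theorem mem_image (h : IsSim S) {A : Set ℂ} {x : ℂ} : x ∈ S '' A ↔ pull S x ∈ A :=
  ⟨by rintro ⟨z, hz, rfl⟩; rwa [h.pull_apply], fun hx => ⟨_, hx, h.apply_pull x⟩⟩

theorem pull_eq_iff (h : IsSim S) {x z : ℂ} : pull S x = z ↔ x = S z :=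
  ⟨fun e => by rw [← e, h.apply_pull], fun e => by rw [e, h.pull_apply]⟩

end IsSim

theorem pull_eq_mul (S : ℂ → ℂ) (x : ℂ) : pull S x = (S 1 - S 0)⁻¹ * (x - S 0) := by
  rw [pull, div_eq_inv_mul]

theorem lipschitz_pull (S : ℂ → ℂ) : ∃ C, LipschitzWith C (pull S) := by
  refine ⟨‖(S 1 - S 0)⁻¹‖₊, LipschitzWith.of_dist_le_mul fun x y => ?_⟩
  rw [dist_eq_norm, pull_eq_mul, pull_eq_mul, ← mul_sub, norm_mul, dist_eq_norm,
    sub_sub_sub_cancel_right]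
  rfl

theorem hasFDerivAt_pull (S : ℂ → ℂ) (x : ℂ) :
    HasFDerivAt (pull S) ((S 1 - S 0)⁻¹ • ContinuousLinearMap.id ℝ ℂ) x := by
  have := ((hasFDerivAt_id (𝕜 := ℝ) x).sub_const (S 0)).const_smul ((S 1 - S 0)⁻¹)
  exact this.congr_of_eventuallyEq (.of_forall fun z => pull_eq_mul S z)

theorem continuous_pull (S : ℂ → ℂ) : Continuous (pull S) :=
  (lipschitz_pull S).choose_spec.continuous

theorem LocLipAt.comp_pull {f : ℂ → ℝ} {S : ℂ → ℂ} {x : ℂ} (hf : LocLipAt f (pull S x)) :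
    LocLipAt (fun z => f (pull S z)) x :=
  hf.comp (lipschitz_pull S).choose_spec

theorem isSim_kochMap {α K : ℝ} (h : Admissible α K) (i : Fin 4) : IsSim (kochMap α i) := by
  have hd := h.halfBase_pos
  have hd4 := h.halfBase_lt
  have hb : ((1 / 2 - halfBase α : ℝ) : ℂ) ≠ 0 := by
    rw [Complex.ofReal_ne_zero]; linarith
  fin_cases i
  · exact .of_eq (a := 0) hb fun z => (kochMap_zero h z).trans (zero_add _).symm
  · refine .of_eq (b := halfBase α + Complex.I * height α) (fun e => ?_)
      fun z => (kochMap_one h z).trans (add_comm _ _)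
    have := congrArg Complex.re e
    simp at this
    linarith
  · refine .of_eq (b := halfBase α - Complex.I * height α) (fun e => ?_)
      fun z => (kochMap_two h z).trans (add_comm _ _)
    have := congrArg Complex.re e
    simp at this
    linarith
  · exact .of_eq hb fun z => (kochMap_three h z).trans (add_comm _ _)

/-! The cell functions. -/

/-- The profile of `1 - λ` in an inner fiber. -/
def tip (K : ℝ) (z : ℂ) : ℝ :=
  max 0 (K * min z.re (1 - z.re) + z.im) / (K * min z.re (1 - z.re))

/-- The function `1 - λ` of the inner fiber below the unit segment, extended by zero. -/
def tooth (K : ℝ) (z : ℂ) : ℝ := if z.im ≤ 0 then tip K z else 0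

open Classical in
/-- The indicator function of the bump without its base. -/
def bumpFun (α : ℝ) (z : ℂ) : ℝ := if z ∈ closedBump α ∧ 0 < z.im then 1 else 0

/-- The change of the coefficient function over one cell in one refinement step. -/
def cellFun (α K : ℝ) (z : ℂ) : ℝ :=
  bumpFun α z + tooth K z - ∑ i : Fin 4, tooth K (pull (kochMap α i) z)

theorem tip_eq_zero {K : ℝ} {z : ℂ} (h : K * z.re + z.im ≤ 0 ∨ K * (1 - z.re) + z.im ≤ 0)
    (hK : 0 < K) : tip K z = 0 := by
  rw [tip, max_eq_left, zero_div]
  rcases h with h | h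
  · have : K * min z.re (1 - z.re) ≤ K * z.re := by gcongr; exact min_le_left _ _
    linarith
  · have : K * min z.re (1 - z.re) ≤ K * (1 - z.re) := by gcongr; exact min_le_right _ _
    linarith

theorem tooth_of_im_le {K : ℝ} {z : ℂ} (hz : z.im ≤ 0) : tooth K z = tip K z := if_pos hz

theorem tooth_of_im_pos {K : ℝ} {z : ℂ} (hz : 0 < z.im) : tooth K z = 0 := if_neg hz.not_ge

theorem exists_of_tooth_ne_zero {K : ℝ} (hK : 0 < K) {z : ℂ} (h : tooth K z ≠ 0) :
    z.im ≤ 0 ∧ 0 < K * z.re + z.im ∧ 0 < K * (1 - z.re) + z.im := by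
  by_cases hz : z.im ≤ 0
  · rw [tooth_of_im_le hz] at h
    by_contra hc
    simp only [not_and_or, not_lt] at hc
    exact h (tip_eq_zero (hc.resolve_left (not_not.2 hz)) hK)
  · exact absurd (tooth_of_im_pos (not_le.1 hz)) h

/-- The profile takes the constant value 1 on every open side; this makes teeth of consecutive
levels cancel along common sides. -/
theorem tip_of_im_eq_zero {K : ℝ} (hK : 0 < K) {z : ℂ} (hz : z.im = 0) :
    tip K z = if 0 < z.re ∧ z.re < 1 then 1 else 0 := by
  split_ifs with h
  · have : 0 < K * min z.re (1 - z.re) := mul_pos hK (lt_min h.1 (by linarith [h.2]))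
    rw [tip, hz, add_zero, max_eq_right this.le, div_self this.ne']
  · refine tip_eq_zero ?_ hK
    rw [hz]
    by_cases h0 : 0 < z.re
    · have : 1 ≤ z.re := not_lt.1 fun h1 => h ⟨h0, h1⟩
      right; nlinarith
    · left; nlinarith

theorem LocLipAt.comp_contDiffAt {f : ℂ → ℝ} {x : ℂ} {F : ℝ → ℝ} (hf : LocLipAt f x)
    (hF : ContDiffAt ℝ 1 F (f x)) : LocLipAt (fun z => F (f z)) x := by
  obtain ⟨C, s, hs, hC⟩ := ContDiffAt.exists_lipschitzOnWith hF
  have hc := hf.continuousAt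
  obtain ⟨K, t, ht, h⟩ := hf
  exact ⟨C * K, t ∩ f ⁻¹' s, inter_mem ht (hc hs),
    hC.comp (h.mono Set.inter_subset_left) fun z hz => hz.2⟩

theorem locLipAt_re (x : ℂ) : LocLipAt (fun z => z.re) x :=
  .of_contDiffAt Complex.reCLM.contDiff.contDiffAt

theorem locLipAt_im (x : ℂ) : LocLipAt (fun z => z.im) x :=
  .of_contDiffAt Complex.imCLM.contDiff.contDiffAt

/-- The profile is singular only at the ends of the side. At the other points below the ends the
denominator vanishes, but the numerator is 0 in a whole neighbourhood. -/
theorem locLipAt_tip {K : ℝ} (hK : 0 < K) {x : ℂ} (hx : x.im ≤ 0) (h0 : x ≠ 0) (h1 : x ≠ 1) :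
    LocLipAt (tip K) x := by
  have hmin : LocLipAt (fun z : ℂ => K * min z.re (1 - z.re)) x := by
    refine (LocLipAt.const K x).mul ((locLipAt_re x).comp_left (F := fun t => min t (1 - t))
      (C := max 1 1) ?_)
    exact LipschitzWith.id.min (by simpa using (LipschitzWith.const (1 : ℝ)).sub LipschitzWith.id)
  by_cases hμ : min x.re (1 - x.re) = 0
  · have him : x.im < 0 := by
      refine lt_of_le_of_ne hx fun e => ?_
      rcases min_choice x.re (1 - x.re) with h | h <;> rw [h] at hμ
      · exact h0 (Complex.ext hμ e)
      · exact h1 (Complex.ext (by simp; linarith) (by simpa using e))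
    refine (LocLipAt.const 0 x).congr ?_
    have hc : ContinuousAt (fun z : ℂ => K * min z.re (1 - z.re) + z.im) x :=
      (hmin.add (locLipAt_im x)).continuousAt
    have : ∀ᶠ z in 𝓝 x, K * min z.re (1 - z.re) + z.im < 0 :=
      hc.eventually_lt continuousAt_const (by simp [hμ, him])
    filter_upwards [this] with z hz
    rw [tip, max_eq_left hz.le, zero_div]
  · refine (LocLipAt.mul (f := fun z => max 0 (K * min z.re (1 - z.re) + z.im))
      (g := fun z => (K * min z.re (1 - z.re))⁻¹) ?_ ?_).congr
      (.of_forall fun z => by rw [tip, div_eq_mul_inv])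
    · exact (hmin.add (locLipAt_im x)).comp_left (F := fun t => max 0 t)
        (LipschitzWith.id.const_max 0)
    · exact hmin.comp_contDiffAt (F := fun t => t⁻¹)
        (contDiffAt_inv ℝ (mul_ne_zero hK.ne' hμ))

theorem isClosed_closedBump (α : ℝ) : IsClosed (closedBump α) :=
  (isClosed_le (f := fun _ : ℂ => (0 : ℝ)) (g := Complex.im) (by fun_prop) (by fun_prop)).inter
    ((isClosed_le (f := fun z : ℂ => halfBase α * z.im)
      (g := fun z : ℂ => height α * (z.re - (1 / 2 - halfBase α)))
      (by fun_prop) (by fun_prop)).inter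
    (isClosed_le (f := fun z : ℂ => halfBase α * z.im)
      (g := fun z : ℂ => height α * (1 / 2 + halfBase α - z.re)) (by fun_prop) (by fun_prop)))

section cell
variable {α K : ℝ} (h : Admissible α K)
include h

theorem tooth_pull_one_two_eq_zero {i : Fin 4} (hi : i = 1 ∨ i = 2) {z : ℂ}
    (hz : ¬(z ∈ closedBump α ∧ 0 < z.im)) : tooth K (pull (kochMap α i) z) = 0 := by
  by_contra hc
  obtain ⟨h1, h2, h3⟩ := exists_of_tooth_ne_zero h.pos hc
  apply hz
  have hd := h.halfBase_pos
  have hH := h.height_pos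
  set w := pull (kochMap α i) z with hw
  have ez : z = kochMap α i w := ((isSim_kochMap h i).apply_pull z).symm
  have hp : (1 / 2 - halfBase α) ^ 2 * w.im ≤ 0 := mul_nonpos_of_nonneg_of_nonpos (sq_nonneg _) h1
  rw [ez]
  rcases hi with rfl | rfl
  · obtain ⟨a, b, c⟩ := kochMap_one_fiber h h1 h2 h3
    exact ⟨⟨a.le, by linarith, by nlinarith⟩, a⟩
  · obtain ⟨a, b, c⟩ := kochMap_two_fiber h h1 h2 h3
    exact ⟨⟨a.le, by nlinarith, by linarith⟩, a⟩

theorem pull_zero_im (z : ℂ) : (1 / 2 - halfBase α) * (pull (kochMap α 0) z).im = z.im := by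
  rw [← kochMap_zero_im h, (isSim_kochMap h 0).apply_pull]

theorem pull_three_im (z : ℂ) : (1 / 2 - halfBase α) * (pull (kochMap α 3) z).im = z.im := by
  rw [← kochMap_three_im h, (isSim_kochMap h 3).apply_pull]

theorem pull_zero_re (z : ℂ) : (1 / 2 - halfBase α) * (pull (kochMap α 0) z).re = z.re := by
  rw [← kochMap_zero_re h, (isSim_kochMap h 0).apply_pull]

theorem pull_three_re (z : ℂ) : (1 / 2 - halfBase α) * (pull (kochMap α 3) z).re +
    (1 / 2 + halfBase α) = z.re := by
  rw [← kochMap_three_re h, (isSim_kochMap h 3).apply_pull]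

/-- In the coordinates of this piece the imaginary part is a positive multiple of the affine form
that defines the left slanted side of the bump, so its sign locates z relative to that side. -/
theorem pull_one_im (z : ℂ) : (1 / 2 - halfBase α) ^ 2 * (pull (kochMap α 1) z).im =
    halfBase α * z.im - height α * (z.re - (1 / 2 - halfBase α)) := by
  have e1 := kochMap_one_re h (pull (kochMap α 1) z)
  have e2 := kochMap_one_im h (pull (kochMap α 1) z)
  rw [(isSim_kochMap h 1).apply_pull] at e1 e2
  rw [e1, e2]
  linear_combination (-(pull (kochMap α 1) z).im) * h.height_sq

theorem pull_two_im (z : ℂ) : (1 / 2 - halfBase α) ^ 2 * (pull (kochMap α 2) z).im =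
    halfBase α * z.im - height α * (1 / 2 + halfBase α - z.re) := by
  have e1 := kochMap_two_re h (pull (kochMap α 2) z)
  have e2 := kochMap_two_im h (pull (kochMap α 2) z)
  rw [(isSim_kochMap h 2).apply_pull] at e1 e2
  rw [e1, e2]
  linear_combination (-(pull (kochMap α 2) z).im) * h.height_sq

/-- The plane is covered by three closed sets: the lower half plane, the bump, and the part above
the axis outside the open bump. On each of them `cellFun` is, vertices aside, a combination of
constants and unrestricted tips, without the jumps of `tooth` and `bumpFun`. This is the formula on
the first set. -/
theorem cellFun_of_im_nonpos {z : ℂ} (hz : z.im ≤ 0) : cellFun α K z =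
    tip K z - tip K (pull (kochMap α 0) z) - tip K (pull (kochMap α 3) z) := by
  have hβ : 0 < 1 / 2 - halfBase α := by linarith [h.halfBase_lt]
  have hb : ¬(z ∈ closedBump α ∧ 0 < z.im) := fun hc => absurd hc.2 hz.not_gt
  have h0 := pull_zero_im h z
  have h3 := pull_three_im h z
  rw [cellFun, Fin.sum_univ_four, tooth_pull_one_two_eq_zero h (.inl rfl) hb,
    tooth_pull_one_two_eq_zero h (.inr rfl) hb, bumpFun, if_neg hb, tooth_of_im_le hz,
    tooth_of_im_le (by nlinarith), tooth_of_im_le (by nlinarith)]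
  ring

theorem cellFun_of_mem_closedBump {z : ℂ} (hz : z ∈ closedBump α) (hz0 : z ≠ kochMap α 0 1)
    (hz3 : z ≠ kochMap α 3 0) : cellFun α K z =
      1 - tip K (pull (kochMap α 1) z) - tip K (pull (kochMap α 2) z) := by
  have hβ : 0 < 1 / 2 - halfBase α := by linarith [h.halfBase_lt]
  have hd := h.halfBase_pos
  have hH := h.height_pos
  have h1 := pull_one_im h z
  have h2 := pull_two_im h z
  have e0 := pull_zero_im h z
  have e3 := pull_three_im h z
  obtain ⟨g1, g2, g3⟩ := hz
  have i1 : (pull (kochMap α 1) z).im ≤ 0 := by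
    have : (1 / 2 - halfBase α) ^ 2 * (pull (kochMap α 1) z).im ≤ 0 := by linarith
    exact nonpos_of_mul_nonpos_right this (by positivity)
  have i2 : (pull (kochMap α 2) z).im ≤ 0 := by
    have : (1 / 2 - halfBase α) ^ 2 * (pull (kochMap α 2) z).im ≤ 0 := by linarith
    exact nonpos_of_mul_nonpos_right this (by positivity)
  rw [cellFun, Fin.sum_univ_four, ← tooth_of_im_le i1, ← tooth_of_im_le i2]
  -- On the base of the bump `bumpFun` is 0 by convention, and the constant 1 comes from the tooth
  -- of the large cell instead.
  rcases g1.eq_or_lt with him | him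
  · have hb : ¬(z ∈ closedBump α ∧ 0 < z.im) := fun hc => absurd hc.2 him.not_lt
    have r0 := pull_zero_re h z
    have r3 := pull_three_re h z
    have im0 : (pull (kochMap α 0) z).im = 0 := by
      rw [← him] at e0; exact (mul_eq_zero.1 e0).resolve_left hβ.ne'
    have im3 : (pull (kochMap α 3) z).im = 0 := by
      rw [← him] at e3; exact (mul_eq_zero.1 e3).resolve_left hβ.ne'
    have n0 : (pull (kochMap α 0) z).re ≠ 1 := fun hc =>
      hz0 ((isSim_kochMap h 0).pull_eq_iff.1 (Complex.ext (by simpa using hc) (by simpa using im0)))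
    have n3 : (pull (kochMap α 3) z).re ≠ 0 := fun hc =>
      hz3 ((isSim_kochMap h 3).pull_eq_iff.1 (Complex.ext (by simpa using hc) (by simpa using im3)))
    have l1 : 1 / 2 - halfBase α ≤ z.re := by
      rw [← him] at g2; nlinarith
    have l2 : z.re ≤ 1 / 2 + halfBase α := by
      rw [← him] at g3; nlinarith
    have p0 : 1 ≤ (pull (kochMap α 0) z).re := by
      by_contra hc; nlinarith
    have p3 : (pull (kochMap α 3) z).re ≤ 0 := by
      by_contra hc; nlinarith
    rw [tooth_pull_one_two_eq_zero h (.inl rfl) hb,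
      tooth_pull_one_two_eq_zero h (.inr rfl) hb, bumpFun, if_neg hb, tooth_of_im_le him.ge,
      tooth_of_im_le im0.le, tooth_of_im_le im3.le, tip_of_im_eq_zero h.pos him.symm,
      tip_of_im_eq_zero h.pos im0, tip_of_im_eq_zero h.pos im3, if_pos (by constructor <;> linarith),
      if_neg (by intro hc; linarith [hc.2]), if_neg (by intro hc; linarith [hc.1])]
    norm_num
  · rw [bumpFun, if_pos ⟨⟨g1, g2, g3⟩, him⟩, tooth_of_im_pos him,
      tooth_of_im_pos (z := pull (kochMap α 0) z) (by by_contra hc; nlinarith),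
      tooth_of_im_pos (z := pull (kochMap α 3) z) (by by_contra hc; nlinarith)]
    ring

/-- Everything cancels. On the axis beside the base, the tooth of the cell meets the equal tooth of
piece 0 or 3; on a slanted side, the 1 of the bump meets the tooth of piece 1 or 2. At the ends of
the pieces a tooth is 0, so cancellation can fail there. -/
theorem cellFun_outside {z : ℂ} (hz : 0 ≤ z.im)
    (hz' : height α * (z.re - (1 / 2 - halfBase α)) ≤ halfBase α * z.im ∨
      height α * (1 / 2 + halfBase α - z.re) ≤ halfBase α * z.im)
    (hV : ∀ i, z ≠ kochMap α i 0 ∧ z ≠ kochMap α i 1) : cellFun α K z = 0 := by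
  have hβ : 0 < 1 / 2 - halfBase α := by linarith [h.halfBase_lt]
  have hd := h.halfBase_pos
  have hH := h.height_pos
  have h1 := pull_one_im h z
  have h2 := pull_two_im h z
  have e0 := pull_zero_im h z
  have e3 := pull_three_im h z
  rcases hz.eq_or_lt with him | him
  · have r0 := pull_zero_re h z
    have r3 := pull_three_re h z
    have im0 : (pull (kochMap α 0) z).im = 0 := by
      rw [← him] at e0; exact (mul_eq_zero.1 e0).resolve_left hβ.ne'
    have im3 : (pull (kochMap α 3) z).im = 0 := by
      rw [← him] at e3; exact (mul_eq_zero.1 e3).resolve_left hβ.ne'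
    have n0 : (pull (kochMap α 0) z).re ≠ 1 := fun hc => (hV 0).2
      ((isSim_kochMap h 0).pull_eq_iff.1 (Complex.ext (by simpa using hc) (by simpa using im0)))
    have n3 : (pull (kochMap α 3) z).re ≠ 0 := fun hc => (hV 3).1
      ((isSim_kochMap h 3).pull_eq_iff.1 (Complex.ext (by simpa using hc) (by simpa using im3)))
    rw [cellFun_of_im_nonpos h him.ge, tip_of_im_eq_zero h.pos him.symm,
      tip_of_im_eq_zero h.pos im0, tip_of_im_eq_zero h.pos im3]
    rw [← him] at hz'
    have hcase : z.re < 1 / 2 - halfBase α ∨ 1 / 2 + halfBase α < z.re := by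
      rcases hz' with hc | hc
      · left
        refine lt_of_le_of_ne (by nlinarith) fun e => n0 ?_
        rw [e] at r0
        exact mul_left_cancel₀ hβ.ne' (r0.trans (mul_one _).symm)
      · right
        refine lt_of_le_of_ne (by nlinarith) fun e => n3 ?_
        rw [← e] at r3
        have : (1 / 2 - halfBase α) * (pull (kochMap α 3) z).re = 0 := by linarith
        exact (mul_eq_zero.1 this).resolve_left hβ.ne'
    have q0 : 0 < z.re ↔ 0 < (pull (kochMap α 0) z).re := by
      rw [← r0]; exact mul_pos_iff_of_pos_left hβ
    have q3 : z.re < 1 ↔ (pull (kochMap α 3) z).re < 1 := by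
      rw [← r3]
      constructor <;> intro hc <;> nlinarith
    rcases hcase with hc | hc
    · have t0 : (pull (kochMap α 0) z).re < 1 := by by_contra hc'; nlinarith
      have t3 : ¬ 0 < (pull (kochMap α 3) z).re := by intro hc'; nlinarith
      have t1 : z.re < 1 := by linarith
      simp only [← q0, t0, t3, t1, and_true, false_and, if_false]
      split_ifs <;> norm_num
    · have t0 : ¬ (pull (kochMap α 0) z).re < 1 := by intro hc'; nlinarith
      have t3 : 0 < (pull (kochMap α 3) z).re := by by_contra hc'; nlinarith
      have t1 : 0 < z.re := by linarith
      simp only [← q3, t0, t3, t1, true_and, and_false, if_false]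
      split_ifs <;> norm_num
  · rw [cellFun, Fin.sum_univ_four, tooth_of_im_pos him,
      tooth_of_im_pos (z := pull (kochMap α 0) z) (by by_contra hc; nlinarith),
      tooth_of_im_pos (z := pull (kochMap α 3) z) (by by_contra hc; nlinarith)]
    by_cases hb : z ∈ closedBump α ∧ 0 < z.im
    · rw [bumpFun, if_pos hb]
      obtain ⟨⟨-, g2, g3⟩, -⟩ := hb
      rcases hz' with hc | hc
      · have hre : z.re ≤ 1 / 2 := by nlinarith
        have im1 : (pull (kochMap α 1) z).im = 0 := by
          have : (1 / 2 - halfBase α) ^ 2 * (pull (kochMap α 1) z).im = 0 := by linarith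
          exact (mul_eq_zero.1 this).resolve_left (by positivity)
        have n0 : (pull (kochMap α 1) z).re ≠ 1 := fun hc => (hV 1).2
          ((isSim_kochMap h 1).pull_eq_iff.1
            (Complex.ext (by simpa using hc) (by simpa using im1)))
        have hr := kochMap_one_re h (pull (kochMap α 1) z)
        have hi := kochMap_one_im h (pull (kochMap α 1) z)
        rw [(isSim_kochMap h 1).apply_pull, im1] at hr hi
        have p1 : 0 < (pull (kochMap α 1) z).re := by by_contra hc'; nlinarith
        have p2 : (pull (kochMap α 1) z).re < 1 := lt_of_le_of_ne (by by_contra hc'; nlinarith) n0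
        have t2 : tooth K (pull (kochMap α 2) z) = 0 := by
          by_contra hc'
          obtain ⟨a1, a2, a3⟩ := exists_of_tooth_ne_zero h.pos hc'
          have := (kochMap_two_fiber h a1 a2 a3).2.1
          rw [(isSim_kochMap h 2).apply_pull] at this
          linarith
        rw [t2, tooth_of_im_le im1.le, tip_of_im_eq_zero h.pos im1, if_pos ⟨p1, p2⟩]
        norm_num
      · have hre : 1 / 2 ≤ z.re := by nlinarith
        have im2 : (pull (kochMap α 2) z).im = 0 := by
          have : (1 / 2 - halfBase α) ^ 2 * (pull (kochMap α 2) z).im = 0 := by linarith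
          exact (mul_eq_zero.1 this).resolve_left (by positivity)
        have n0 : (pull (kochMap α 2) z).re ≠ 0 := fun hc => (hV 2).1
          ((isSim_kochMap h 2).pull_eq_iff.1
            (Complex.ext (by simpa using hc) (by simpa using im2)))
        have hr := kochMap_two_re h (pull (kochMap α 2) z)
        have hi := kochMap_two_im h (pull (kochMap α 2) z)
        rw [(isSim_kochMap h 2).apply_pull, im2] at hr hi
        have p1 : 0 < (pull (kochMap α 2) z).re :=
          lt_of_le_of_ne (by by_contra hc'; nlinarith) n0.symm
        have p2 : (pull (kochMap α 2) z).re < 1 := by by_contra hc'; nlinarith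
        have t2 : tooth K (pull (kochMap α 1) z) = 0 := by
          by_contra hc'
          obtain ⟨a1, a2, a3⟩ := exists_of_tooth_ne_zero h.pos hc'
          have := (kochMap_one_fiber h a1 a2 a3).2.1
          rw [(isSim_kochMap h 1).apply_pull] at this
          linarith
        rw [t2, tooth_of_im_le im2.le, tip_of_im_eq_zero h.pos im2, if_pos ⟨p1, p2⟩]
        norm_num
    · rw [bumpFun, if_neg hb, tooth_pull_one_two_eq_zero h (.inl rfl) hb,
        tooth_pull_one_two_eq_zero h (.inr rfl) hb]
      norm_num

/-- The three formulas are glued along the closed cover; their tips are singular only at ends of the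
cell and of its four pieces. -/
theorem locLipAt_cellFun {x : ℂ} (hV : ∀ i, x ≠ kochMap α i 0 ∧ x ≠ kochMap α i 1) :
    LocLipAt (cellFun α K) x := by
  have hd := h.halfBase_pos
  have hH := h.height_pos
  have hβ : 0 < 1 / 2 - halfBase α := by linarith [h.halfBase_lt]
  have hVev : ∀ᶠ z in 𝓝 x, ∀ i, z ≠ kochMap α i 0 ∧ z ≠ kochMap α i 1 :=
    eventually_all.2 fun i => (eventually_ne_nhds (hV i).1).and (eventually_ne_nhds (hV i).2)
  have htip : ∀ i, (pull (kochMap α i) x).im ≤ 0 →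
      LocLipAt (fun z => tip K (pull (kochMap α i) z)) x := fun i hi =>
    (locLipAt_tip h.pos hi (fun e => (hV i).1 ((isSim_kochMap h i).pull_eq_iff.1 e))
      (fun e => (hV i).2 ((isSim_kochMap h i).pull_eq_iff.1 e))).comp_pull
  have hx0 : x ≠ 0 := by
    have := (hV 0).1
    rwa [kochMap_zero h, mul_zero] at this
  have hx1 : x ≠ 1 := by
    have := (hV 3).2
    rw [kochMap_three h, mul_one, ← Complex.ofReal_add] at this
    convert this using 1
    norm_num
  refine LocLipAt.of_closed_cover (ι := Fin 3)
    (A := ![{z | z.im ≤ 0}, closedBump α, {z | 0 ≤ z.im} ∩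
      ({z | height α * (z.re - (1 / 2 - halfBase α)) ≤ halfBase α * z.im} ∪
      {z | height α * (1 / 2 + halfBase α - z.re) ≤ halfBase α * z.im})])
    (F := ![fun z => tip K z - tip K (pull (kochMap α 0) z) - tip K (pull (kochMap α 3) z),
      fun z => 1 - tip K (pull (kochMap α 1) z) - tip K (pull (kochMap α 2) z), fun _ => 0])
    ?_ (.of_forall fun z => ?_) ?_
  · intro i
    fin_cases i
    · exact isClosed_le (by fun_prop) (by fun_prop)
    · exact isClosed_closedBump α
    · exact (isClosed_le (f := fun _ : ℂ => (0 : ℝ)) (g := Complex.im) (by fun_prop)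
        (by fun_prop)).inter
        ((isClosed_le (f := fun z : ℂ => height α * (z.re - (1 / 2 - halfBase α)))
          (g := fun z : ℂ => halfBase α * z.im) (by fun_prop) (by fun_prop)).union
        (isClosed_le (f := fun z : ℂ => height α * (1 / 2 + halfBase α - z.re))
          (g := fun z : ℂ => halfBase α * z.im) (by fun_prop) (by fun_prop)))
  · by_cases h1 : z.im ≤ 0
    · exact ⟨0, h1⟩
    by_cases h2 : z ∈ closedBump α
    · exact ⟨1, h2⟩
    refine ⟨2, (not_le.1 h1).le, ?_⟩
    by_contra hc
    simp only [Set.mem_union, Set.mem_ofPred_eq, not_or, not_le] at hc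
    exact h2 ⟨(not_le.1 h1).le, hc.1.le, hc.2.le⟩
  · intro i
    fin_cases i <;> intro hx
    · have hx : x.im ≤ 0 := hx
      refine ⟨((locLipAt_tip h.pos hx hx0 hx1).sub (htip 0 ?_)).sub (htip 3 ?_),
        .of_forall fun z hz => cellFun_of_im_nonpos h hz⟩
      · have := pull_zero_im h x; by_contra hc; nlinarith
      · have := pull_three_im h x; by_contra hc; nlinarith
    · have hx : x ∈ closedBump α := hx
      refine ⟨((LocLipAt.const 1 x).sub (htip 1 ?_)).sub (htip 2 ?_), ?_⟩
      · have h1 := pull_one_im h x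
        have : (1 / 2 - halfBase α) ^ 2 * (pull (kochMap α 1) x).im ≤ 0 := by linarith [hx.2.1]
        exact nonpos_of_mul_nonpos_right this (by positivity)
      · have h1 := pull_two_im h x
        have : (1 / 2 - halfBase α) ^ 2 * (pull (kochMap α 2) x).im ≤ 0 := by linarith [hx.2.2]
        exact nonpos_of_mul_nonpos_right this (by positivity)
      · filter_upwards [hVev] with z hz hz'
        exact cellFun_of_mem_closedBump h hz' (hz 0).2 (hz 3).1
    · refine ⟨LocLipAt.const 0 x, ?_⟩
      filter_upwards [hVev] with z hz hz'
      exact cellFun_outside h hz'.1 hz'.2 hz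

end cell

/-! Half-planes and triangles. -/

/-- An interior point can be moved slightly against the normal (a, b) within A; from a point of the
boundary line this would make the form negative. -/
theorem interior_subset_of_subset_halfPlane {A : Set ℂ} {a b c : ℝ} (hab : a ≠ 0 ∨ b ≠ 0)
    (hA : ∀ z ∈ A, 0 ≤ a * z.re + b * z.im + c) {z : ℂ} (hz : z ∈ interior A) :
    0 < a * z.re + b * z.im + c := by
  refine lt_of_le_of_ne (hA z (interior_subset hz)) fun e => ?_
  have hcont : ContinuousAt (fun t : ℝ => z - t * (⟨a, b⟩ : ℂ)) 0 := by fun_prop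
  have hev : ∀ᶠ t : ℝ in 𝓝[>] 0, z - t * (⟨a, b⟩ : ℂ) ∈ A := by
    refine nhdsWithin_le_nhds (hcont.eventually ?_)
    have : A ∈ 𝓝 z := mem_interior_iff_mem_nhds.1 hz
    simpa using this
  obtain ⟨t, ht, ht0⟩ := (hev.and self_mem_nhdsWithin).exists
  have h := hA _ ht
  have ht0 : 0 < t := ht0
  simp only [Complex.sub_re, Complex.sub_im, Complex.re_ofReal_mul, Complex.im_ofReal_mul] at h
  have h2 : 0 < t * (a * a + b * b) := by
    refine mul_pos ht0 ?_
    rcases hab with h | h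
    · nlinarith [mul_self_pos.2 h, mul_self_nonneg b]
    · nlinarith [mul_self_pos.2 h, mul_self_nonneg a]
  linarith

theorem convex_halfPlane (a b c : ℝ) : Convex ℝ {z : ℂ | 0 ≤ a * z.re + b * z.im + c} := by
  intro z hz w hw s t hs ht hst
  simp only [Set.mem_ofPred_eq, Complex.add_re, Complex.add_im, Complex.smul_re,
    Complex.smul_im, smul_eq_mul] at hz hw ⊢
  have : c = s * c + t * c := by rw [← add_mul, hst, one_mul]
  rw [this]
  nlinarith [mul_nonneg hs hz, mul_nonneg ht hw]

/-- The line lies in the frontier of a half plane, and frontiers of convex sets are null. -/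
theorem volume_line_eq_zero {a b : ℝ} (hab : a ≠ 0 ∨ b ≠ 0) (c : ℝ) :
    volume {z : ℂ | a * z.re + b * z.im + c = 0} = 0 := by
  have hcl : IsClosed {z : ℂ | 0 ≤ a * z.re + b * z.im + c} :=
    isClosed_le (by fun_prop) (by fun_prop)
  refine measure_mono_null (fun z hz => ?_) ((convex_halfPlane a b c).addHaar_frontier volume)
  rw [hcl.frontier_eq]
  have hz : a * z.re + b * z.im + c = 0 := hz
  exact ⟨hz.ge, fun hi => (interior_subset_of_subset_halfPlane hab (fun _ h => h) hi).ne' hz⟩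

theorem combo_mem_convexHull {p q r : ℂ} {a b c : ℝ} (ha : 0 ≤ a) (hb : 0 ≤ b) (hc : 0 ≤ c)
    (h : a + b + c = 1) : a * p + b * q + c * r ∈ convexHull ℝ {p, q, r} := by
  have := (convex_convexHull ℝ ({p, q, r} : Set ℂ)).sum_mem (t := Finset.univ)
    (w := ![a, b, c]) (z := ![p, q, r]) (by intro i _; fin_cases i <;> assumption)
    (by simpa [Fin.sum_univ_three] using h)
    (by intro i _; fin_cases i <;> exact subset_convexHull ℝ _ (by simp))
  simpa [Fin.sum_univ_three] using this

theorem convexHull_subset_halfPlane {p q r : ℂ} {a b c : ℝ}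
    (hp : 0 ≤ a * p.re + b * p.im + c) (hq : 0 ≤ a * q.re + b * q.im + c)
    (hr : 0 ≤ a * r.re + b * r.im + c) {z : ℂ} (hz : z ∈ convexHull ℝ {p, q, r}) :
    0 ≤ a * z.re + b * z.im + c := by
  refine convexHull_min ?_ (convex_halfPlane a b c) hz
  rintro w (rfl | rfl | rfl) <;> assumption

theorem lowVertex_re (ϑ : ℝ) : (lowVertex ϑ).re = 1 / 2 := by
  simp [lowVertex]

theorem lowVertex_im (ϑ : ℝ) : (lowVertex ϑ).im = -(Real.tan ϑ / 2) := by
  simp only [lowVertex, Complex.sub_im, Complex.mul_im, Complex.I_re, Complex.I_im,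
    Complex.ofReal_re, Complex.ofReal_im]
  norm_num

theorem isOpen_lowerTriangle (K : ℝ) : IsOpen (lowerTriangle K) :=
  (isOpen_lt (f := Complex.im) (g := fun _ => (0 : ℝ)) (by fun_prop) (by fun_prop)).inter
    ((isOpen_lt (f := fun _ => (0 : ℝ)) (g := fun z : ℂ => K * z.re + z.im)
      (by fun_prop) (by fun_prop)).inter
    (isOpen_lt (f := fun _ => (0 : ℝ)) (g := fun z : ℂ => K * (1 - z.re) + z.im)
      (by fun_prop) (by fun_prop)))

theorem isOpen_openBump (α : ℝ) : IsOpen (openBump α) :=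
  (isOpen_lt (f := fun _ => (0 : ℝ)) (g := Complex.im) (by fun_prop) (by fun_prop)).inter
    ((isOpen_lt (f := fun z : ℂ => halfBase α * z.im)
      (g := fun z : ℂ => height α * (z.re - (1 / 2 - halfBase α)))
      (by fun_prop) (by fun_prop)).inter
    (isOpen_lt (f := fun z : ℂ => halfBase α * z.im)
      (g := fun z : ℂ => height α * (1 / 2 + halfBase α - z.re))
      (by fun_prop) (by fun_prop)))

theorem innerTriangle_eq {ϑ : ℝ} (hK : 0 < Real.tan ϑ) :
    innerTriangle ϑ = lowerTriangle (Real.tan ϑ) := by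
  set K := Real.tan ϑ with hKdef
  have hre := lowVertex_re ϑ
  have him := lowVertex_im ϑ
  rw [← hKdef] at him
  apply Set.Subset.antisymm
  · intro z hz
    have h1 := interior_subset_of_subset_halfPlane (a := 0) (b := -1) (c := 0) (.inr (by norm_num))
      (fun w hw => convexHull_subset_halfPlane (by simp) (by simp)
        (by rw [him]; linarith) hw) hz
    have h2 := interior_subset_of_subset_halfPlane (a := K) (b := 1) (c := 0) (.inr (by norm_num))
      (fun w hw => convexHull_subset_halfPlane (by simp) (by simp [hK.le])
        (by rw [him, hre]; linarith) hw) hz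
    have h3 := interior_subset_of_subset_halfPlane (a := -K) (b := 1) (c := K)
      (.inr (by norm_num)) (fun w hw => convexHull_subset_halfPlane (by simp [hK.le]) (by simp)
        (by rw [him, hre]; linarith) hw) hz
    exact ⟨by linarith, by linarith, by linarith⟩
  · refine interior_maximal ?_ (isOpen_lowerTriangle K)
    rintro z ⟨h1, h2, h3⟩
    -- Barycentric coordinates; the weight of the lower vertex is read off from the imaginary part.
    have hz : z = ((1 - z.re + z.im / K : ℝ) : ℂ) * 0 + ((z.re + z.im / K : ℝ) : ℂ) * 1 +
        ((-(2 * z.im / K) : ℝ) : ℂ) * lowVertex ϑ := by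
      apply Complex.ext
      · rw [Complex.add_re, Complex.add_re, Complex.re_ofReal_mul, Complex.re_ofReal_mul,
          Complex.re_ofReal_mul, hre]
        simp; ring
      · rw [Complex.add_im, Complex.add_im, Complex.im_ofReal_mul, Complex.im_ofReal_mul,
          Complex.im_ofReal_mul, him]
        simp; field_simp
    rw [hz]
    refine combo_mem_convexHull ?_ ?_ ?_ (by ring)
    · have : 1 - z.re + z.im / K = (K * (1 - z.re) + z.im) / K := by field_simp
      rw [this]; positivity
    · have : z.re + z.im / K = (K * z.re + z.im) / K := by field_simp
      rw [this]; positivity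
    · rw [← neg_div]
      exact div_nonneg (by linarith) hK.le

theorem bump_eq {α K : ℝ} (h : Admissible α K) : bump α = closedBump α := by
  have hd := h.halfBase_pos
  have hH := h.height_pos
  have e1 : (1 / (α : ℂ)) = ((1 / 2 - halfBase α : ℝ) : ℂ) := by
    rw [← one_div_eq α]; push_cast; rfl
  have e2 : (1 - 1 / (α : ℂ)) = ((1 / 2 + halfBase α : ℝ) : ℂ) := by
    rw [e1]; push_cast; ring
  rw [bump, e2, e1]
  set q : ℂ := 1 / 2 + Complex.I * (√(1 / α - 1 / 4) : ℝ) with hq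
  have qre : q.re = 1 / 2 := by simp [hq]
  have qim : q.im = height α := by
    simp only [hq, Complex.add_im, Complex.mul_im, Complex.I_re, Complex.I_im,
      Complex.ofReal_re, Complex.ofReal_im, height]
    norm_num
  apply Set.Subset.antisymm
  · intro z hz
    have h1 := convexHull_subset_halfPlane (a := 0) (b := 1) (c := 0) (by simp)
      (by rw [qim]; linarith) (by simp) hz
    have h2 := convexHull_subset_halfPlane (a := height α) (b := -halfBase α)
      (c := -(height α * (1 / 2 - halfBase α))) (by
        rw [Complex.ofReal_re, Complex.ofReal_im]; linarith)
      (by rw [qim, qre]; linarith) (by rw [Complex.ofReal_re, Complex.ofReal_im]; nlinarith) hz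
    have h3 := convexHull_subset_halfPlane (a := -height α) (b := -halfBase α)
      (c := height α * (1 / 2 + halfBase α)) (by
        rw [Complex.ofReal_re, Complex.ofReal_im]; nlinarith)
      (by rw [qim, qre]; linarith) (by rw [Complex.ofReal_re, Complex.ofReal_im]; linarith) hz
    exact ⟨by linarith, by linarith, by linarith⟩
  · rintro z ⟨h1, h2, h3⟩
    set d := halfBase α
    set H := height α
    -- Barycentric coordinates again: the weight of the apex is im / H, and the other two are the
    -- slacks of the slanted sides, normalized.
    have hz : z = (((H * (1 / 2 + d - z.re) - d * z.im) / (2 * d * H) : ℝ) : ℂ) *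
        ((1 / 2 - d : ℝ) : ℂ) + ((z.im / H : ℝ) : ℂ) * q +
        (((H * (z.re - (1 / 2 - d)) - d * z.im) / (2 * d * H) : ℝ) : ℂ) *
        ((1 / 2 + d : ℝ) : ℂ) := by
      apply Complex.ext
      · rw [Complex.add_re, Complex.add_re, Complex.re_ofReal_mul, Complex.re_ofReal_mul,
          Complex.re_ofReal_mul, qre, Complex.ofReal_re, Complex.ofReal_re]
        field_simp; ring
      · rw [Complex.add_im, Complex.add_im, Complex.im_ofReal_mul, Complex.im_ofReal_mul,
          Complex.im_ofReal_mul, qim, Complex.ofReal_im, Complex.ofReal_im]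
        field_simp; ring
    rw [hz]
    refine combo_mem_convexHull ?_ (by positivity) ?_ (by field_simp; ring)
    · exact div_nonneg (by linarith) (by positivity)
    · exact div_nonneg (by linarith) (by positivity)

theorem interior_bump {α K : ℝ} (h : Admissible α K) : interior (bump α) = openBump α := by
  have hd := h.halfBase_pos
  have hH := h.height_pos
  rw [bump_eq h]
  apply Set.Subset.antisymm
  · intro z hz
    have h1 := interior_subset_of_subset_halfPlane (a := 0) (b := 1) (c := 0) (.inr (by norm_num))
      (fun w hw => by linarith [hw.1]) hz
    have h2 := interior_subset_of_subset_halfPlane (a := height α) (b := -halfBase α)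
      (c := -(height α * (1 / 2 - halfBase α))) (.inl hH.ne')
      (fun w hw => by linarith [hw.2.1]) hz
    have h3 := interior_subset_of_subset_halfPlane (a := -height α) (b := -halfBase α)
      (c := height α * (1 / 2 + halfBase α)) (.inl (by linarith))
      (fun w hw => by linarith [hw.2.2]) hz
    exact ⟨by linarith, by linarith, by linarith⟩
  · exact interior_maximal (fun z hz => ⟨hz.1.le, hz.2.1.le, hz.2.2.le⟩) (isOpen_openBump α)

/-! Similitudes and measure. -/

/-- Multiplication by b, as a real linear map of the plane, has determinant |b|². -/
theorem IsSim.volume_image {S : ℂ → ℂ} (h : IsSim S) (A : Set ℂ) :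
    volume (S '' A) = ENNReal.ofReal (‖S 1 - S 0‖ ^ 2) * volume A := by
  have e : S '' A = (fun z => S 0 + z) '' (Algebra.lmul ℝ ℂ (S 1 - S 0) '' A) := by
    rw [Set.image_image]
    exact Set.image_congr fun z _ => h.eq z
  rw [e, Set.image_add_left, measure_preimage_add, Measure.addHaar_image_linearMap]
  congr 2
  have : LinearMap.det (Algebra.lmul ℝ ℂ (S 1 - S 0)) = Complex.normSq (S 1 - S 0) := by
    rw [← Algebra.norm_complex_apply, Algebra.norm_apply]
  rw [this, abs_of_nonneg (Complex.normSq_nonneg _), Complex.normSq_eq_norm_sq]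

theorem IsSim.volume_preimage_pull {S : ℂ → ℂ} (h : IsSim S) {A : Set ℂ} (hA : volume A = 0) :
    volume (pull S ⁻¹' A) = 0 := by
  have : pull S ⁻¹' A = S '' A := Set.ext fun x => h.mem_image.symm
  rw [this, h.volume_image, hA, mul_zero]

theorem IsSim.continuous {S : ℂ → ℂ} (h : IsSim S) : Continuous S := by
  have : S = fun z => S 0 + (S 1 - S 0) * z := funext h.eq
  rw [this]
  fun_prop

theorem IsSim.isOpen_image {S : ℂ → ℂ} (h : IsSim S) {A : Set ℂ} (hA : IsOpen A) :
    IsOpen (S '' A) := by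
  have : S '' A = pull S ⁻¹' A := Set.ext fun x => h.mem_image
  rw [this]
  exact hA.preimage (continuous_pull S)

/-! The derivative of the tooth function. -/

/-- The lines off which the tooth function is differentiable. -/
def toothLines (K : ℝ) : Set ℂ :=
  {z | z.im = 0 ∨ K * z.re + z.im = 0 ∨ K * (1 - z.re) + z.im = 0 ∨ z.re = 1 / 2}

theorem volume_toothLines (K : ℝ) : volume (toothLines K) = 0 := by
  have h1 := volume_line_eq_zero (a := 0) (b := 1) (.inr one_ne_zero) 0
  have h2 := volume_line_eq_zero (a := K) (b := 1) (.inr one_ne_zero) 0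
  have h3 := volume_line_eq_zero (a := -K) (b := 1) (.inr one_ne_zero) K
  have h4 := volume_line_eq_zero (a := 1) (b := 0) (.inl one_ne_zero) (-(1 / 2))
  refine measure_mono_null ?_ (measure_union_null h1 (measure_union_null h2
    (measure_union_null h3 h4)))
  rintro z (h | h | h | h)
  · exact .inl (by simpa using h)
  · exact .inr (.inl (by simpa using h))
  · exact .inr (.inr (.inl (by simp only [Set.mem_ofPred_eq]; linarith)))
  · exact .inr (.inr (.inr (by simp only [Set.mem_ofPred_eq]; linarith)))

/-- Here |im z| < K re z, so im z / (K re z) is bounded by 1 and |z| is comparable to re z. Both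
partial derivatives are then of order 1/|z|. -/
theorem hasFDerivAt_slope {K : ℝ} (hK : 0 < K) {z : ℂ} (hz : 0 < z.re) (hi : z.im < 0)
    (h : 0 < K * z.re + z.im) : ∃ L : ℂ →L[ℝ] ℝ,
      HasFDerivAt (fun w : ℂ => 1 + w.im / (K * w.re)) L z ∧ ‖L‖ ≤ (1 + 1 / K) * (1 + K) / ‖z‖ := by
  have hre : HasFDerivAt (fun w : ℂ => w.re) Complex.reCLM z := Complex.reCLM.hasFDerivAt
  have him : HasFDerivAt (fun w : ℂ => w.im) Complex.imCLM z := Complex.imCLM.hasFDerivAt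
  have hne : K * z.re ≠ 0 := (mul_pos hK hz).ne'
  have hinv : HasFDerivAt (fun w : ℂ => (K * w.re)⁻¹)
      (-((K * z.re) ^ 2)⁻¹ • (K • Complex.reCLM)) z :=
    (hasDerivAt_inv hne).comp_hasFDerivAt z (hre.const_mul K)
  have hmul := (him.mul hinv).const_add 1
  refine ⟨_, hmul.congr_of_eventuallyEq (.of_forall fun w => by
    simp only [Pi.mul_apply, div_eq_mul_inv]), ?_⟩
  have hznorm : ‖z‖ ≤ (1 + K) * z.re := by
    refine (Complex.norm_le_abs_re_add_abs_im z).trans ?_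
    rw [abs_of_pos hz, abs_of_neg hi]
    linarith
  have hzpos : 0 < ‖z‖ := norm_pos_iff.2 fun e => by rw [e] at hz; simp at hz
  have hle : ∀ v : ℂ, ‖(z.im • (-((K * z.re) ^ 2)⁻¹ • (K • Complex.reCLM)) +
      (K * z.re)⁻¹ • Complex.imCLM) v‖ ≤ ((1 + 1 / K) * (1 + K) / ‖z‖) * ‖v‖ := by
    intro v
    have hv1 := Complex.abs_re_le_norm v
    have hv2 := Complex.abs_im_le_norm v
    have b1 : |z.im * (-((K * z.re) ^ 2)⁻¹ * (K * v.re))| ≤ 1 / z.re * ‖v‖ := by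
      have : z.im * (-((K * z.re) ^ 2)⁻¹ * (K * v.re)) = (-z.im / (K * z.re)) * (1 / z.re) * v.re := by
        field_simp
      rw [this, abs_mul, abs_mul, abs_of_nonneg (by positivity : 0 ≤ 1 / z.re),
        abs_of_nonneg (div_nonneg (by linarith) (by positivity) : 0 ≤ -z.im / (K * z.re))]
      have : -z.im / (K * z.re) ≤ 1 := (div_le_one (by positivity)).2 (by linarith)
      calc -z.im / (K * z.re) * (1 / z.re) * |v.re| ≤ 1 * (1 / z.re) * ‖v‖ := by gcongr
        _ = _ := by ring
    have b2 : |(K * z.re)⁻¹ * v.im| ≤ 1 / K * (1 / z.re) * ‖v‖ := by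
      rw [abs_mul, abs_of_pos (by positivity : 0 < (K * z.re)⁻¹)]
      calc (K * z.re)⁻¹ * |v.im| ≤ (K * z.re)⁻¹ * ‖v‖ := by gcongr
        _ = _ := by field_simp
    have b3 : 1 / z.re ≤ (1 + K) / ‖z‖ := by
      rw [div_le_div_iff₀ hz hzpos]; linarith
    have e : (z.im • (-((K * z.re) ^ 2)⁻¹ • (K • Complex.reCLM)) +
      (K * z.re)⁻¹ • Complex.imCLM) v = z.im * (-((K * z.re) ^ 2)⁻¹ * (K * v.re)) +
        (K * z.re)⁻¹ * v.im := rfl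
    rw [e]
    calc _ ≤ 1 / z.re * ‖v‖ + 1 / K * (1 / z.re) * ‖v‖ :=
          (norm_add_le _ _).trans (add_le_add b1 b2)
      _ = (1 + 1 / K) * (1 / z.re) * ‖v‖ := by ring
      _ ≤ (1 + 1 / K) * ((1 + K) / ‖z‖) * ‖v‖ := by gcongr
      _ = _ := by ring
  exact ContinuousLinearMap.opNorm_le_bound _ (by positivity) hle

theorem tooth_of_mem {K : ℝ} {z : ℂ} (hz : z ∈ lowerTriangle K) :
    tooth K z = 1 + z.im / (K * min z.re (1 - z.re)) := by
  obtain ⟨h1, h2, h3⟩ := hz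
  have hμ : 0 < K * min z.re (1 - z.re) + z.im := by
    rcases min_choice z.re (1 - z.re) with h | h <;> rw [h] <;> assumption
  have hμ' : 0 < K * min z.re (1 - z.re) := by linarith
  rw [tooth_of_im_le h1.le, tip, max_eq_right hμ.le, add_div, div_self hμ'.ne']

theorem exists_hasFDerivAt_tooth {K : ℝ} (hK : 0 < K) {z : ℂ} (hz : z ∉ toothLines K) :
    ∃ L : ℂ →L[ℝ] ℝ, HasFDerivAt (tooth K) L z ∧ (z ∉ lowerTriangle K → L = 0) ∧
      ‖L‖ ≤ (1 + 1 / K) * (1 + K) * (1 / ‖z‖ + 1 / ‖z - 1‖) := by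
  simp only [toothLines, Set.mem_ofPred_eq, not_or] at hz
  obtain ⟨n1, n2, n3, n4⟩ := hz
  have hzero : (∀ᶠ w in 𝓝 z, tooth K w = 0) → ∃ L : ℂ →L[ℝ] ℝ, HasFDerivAt (tooth K) L z ∧
      (z ∉ lowerTriangle K → L = 0) ∧
      ‖L‖ ≤ (1 + 1 / K) * (1 + K) * (1 / ‖z‖ + 1 / ‖z - 1‖) := fun hev =>
    ⟨0, (hasFDerivAt_const (0 : ℝ) z).congr_of_eventuallyEq hev, fun _ => rfl,
      by rw [norm_zero]; positivity⟩
  by_cases hT : z ∈ lowerTriangle K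
  · have hopen := (isOpen_lowerTriangle K).mem_nhds hT
    obtain ⟨h1, h2, h3⟩ := hT
    have hC : 0 ≤ (1 + 1 / K) * (1 + K) := by positivity
    rcases lt_or_gt_of_ne n4 with h4 | h4
    · obtain ⟨L, hL, hLn⟩ := hasFDerivAt_slope hK (by nlinarith) h1 h2
      have hev : ∀ᶠ w : ℂ in 𝓝 z, w.re < 1 / 2 :=
        Complex.continuous_re.continuousAt.eventually_lt continuousAt_const h4
      refine ⟨L, hL.congr_of_eventuallyEq ?_, fun hn => absurd ⟨h1, h2, h3⟩ hn, hLn.trans ?_⟩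
      · filter_upwards [hopen, hev] with w hw hw'
        rw [tooth_of_mem hw, min_eq_left (by linarith)]
      · rw [div_eq_mul_one_div]
        exact mul_le_mul_of_nonneg_left (le_add_of_nonneg_right (by positivity)) hC
    · obtain ⟨L, hL, hLn⟩ := hasFDerivAt_slope (z := ⟨1 - z.re, z.im⟩) hK
        (by simp only; nlinarith) h1 h3
      have hev : ∀ᶠ w : ℂ in 𝓝 z, 1 / 2 < w.re :=
        continuousAt_const.eventually_lt Complex.continuous_re.continuousAt h4
      -- The right half is the mirror image of the left one under z ↦ 1 - conj z, an isometry
      -- exchanging the ends 0 and 1.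
      have hrefl : HasFDerivAt (fun w : ℂ => 1 - starRingEnd ℂ w)
          (-(Complex.conjCLE : ℂ →L[ℝ] ℂ)) z := by
        simpa using (Complex.conjCLE.hasFDerivAt (x := z)).const_sub 1
      have ez : (1 - starRingEnd ℂ z) = ⟨1 - z.re, z.im⟩ := by
        apply Complex.ext <;> simp
      rw [← ez] at hL
      have hcomp := hL.comp z hrefl
      refine ⟨_, hcomp.congr_of_eventuallyEq ?_, fun hn => absurd ⟨h1, h2, h3⟩ hn, ?_⟩
      · filter_upwards [hopen, hev] with w hw hw'
        rw [tooth_of_mem hw, min_eq_right (by linarith)]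
        simp
      · have hn : ‖(⟨1 - z.re, z.im⟩ : ℂ)‖ = ‖z - 1‖ := by
          rw [← ez, ← Complex.norm_conj, map_sub, Complex.conj_conj, map_one, norm_sub_rev]
        have h5 : ‖L.comp (-(Complex.conjCLE : ℂ →L[ℝ] ℂ))‖ ≤ ‖L‖ := by
          refine (ContinuousLinearMap.opNorm_comp_le _ _).trans ?_
          rw [norm_neg]
          refine mul_le_of_le_one_right (norm_nonneg _) ?_
          exact ContinuousLinearMap.opNorm_le_bound _ zero_le_one fun v => by simp
        refine h5.trans (hLn.trans ?_)
        rw [hn, div_eq_mul_one_div]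
        exact mul_le_mul_of_nonneg_left (le_add_of_nonneg_left (by positivity)) hC
  · apply hzero
    by_cases h1 : z.im < 0
    · by_cases h2 : 0 < K * z.re + z.im
      · have h3 : K * (1 - z.re) + z.im < 0 :=
          lt_of_le_of_ne (not_lt.1 fun h3 => hT ⟨h1, h2, h3⟩) n3
        have hev : ∀ᶠ w : ℂ in 𝓝 z, K * (1 - w.re) + w.im < 0 :=
          ContinuousAt.eventually_lt (by fun_prop) continuousAt_const h3
        filter_upwards [hev] with w hw
        by_contra hc
        exact absurd (exists_of_tooth_ne_zero hK hc).2.2 hw.not_gt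
      · have h2 : K * z.re + z.im < 0 := lt_of_le_of_ne (not_lt.1 h2) n2
        have hev : ∀ᶠ w : ℂ in 𝓝 z, K * w.re + w.im < 0 :=
          ContinuousAt.eventually_lt (by fun_prop) continuousAt_const h2
        filter_upwards [hev] with w hw
        by_contra hc
        exact absurd (exists_of_tooth_ne_zero hK hc).2.1 hw.not_gt
    · have h1 : 0 < z.im := lt_of_le_of_ne (not_lt.1 h1) (Ne.symm n1)
      have hev : ∀ᶠ w : ℂ in 𝓝 z, 0 < w.im :=
        continuousAt_const.eventually_lt Complex.continuous_im.continuousAt h1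
      filter_upwards [hev] with w hw
      exact tooth_of_im_pos hw

/-- The derivative of the tooth function attached to the side `S([0, 1])`. -/
theorem IsSim.exists_hasFDerivAt_tooth {S : ℂ → ℂ} (h : IsSim S) {K : ℝ} (hK : 0 < K) {x : ℂ}
    (hx : pull S x ∉ toothLines K) :
    ∃ L : ℂ →L[ℝ] ℝ, HasFDerivAt (fun z => tooth K (pull S z)) L x ∧
      (x ∉ S '' lowerTriangle K → L = 0) ∧
      ‖L‖ ≤ (1 + 1 / K) * (1 + K) * (1 / ‖x - S 0‖ + 1 / ‖x - S 1‖) := by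
  obtain ⟨L, hL, hL0, hLn⟩ := Snowflake.exists_hasFDerivAt_tooth hK hx
  refine ⟨_, hL.comp x (hasFDerivAt_pull S x), fun hn => ?_, ?_⟩
  · rw [hL0 fun hm => hn (h.mem_image.2 hm), ContinuousLinearMap.zero_comp]
  · have hb : 0 < ‖S 1 - S 0‖ := norm_pos_iff.2 h.sub_ne
    have e0 : ‖x - S 0‖ = ‖S 1 - S 0‖ * ‖pull S x‖ := by
      rw [← norm_mul, pull, mul_div_cancel₀ _ h.sub_ne]
    have e1 : ‖x - S 1‖ = ‖S 1 - S 0‖ * ‖pull S x - 1‖ := by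
      rw [← norm_mul, ← h.comp_sub, h.apply_pull]
    -- The chain rule contributes 1/|S 1 - S 0|, which is exactly the factor between reciprocal
    -- distances in the cell and in the plane. Hence the constant is the same for every S.
    have h2 : ‖(S 1 - S 0)⁻¹ • ContinuousLinearMap.id ℝ ℂ‖ ≤ ‖S 1 - S 0‖⁻¹ := by
      refine ContinuousLinearMap.opNorm_le_bound _ (by positivity) fun v => ?_
      simp
    calc _ ≤ ‖L‖ * ‖S 1 - S 0‖⁻¹ := (ContinuousLinearMap.opNorm_comp_le _ _).trans (by gcongr)
      _ ≤ ((1 + 1 / K) * (1 + K) * (1 / ‖pull S x‖ + 1 / ‖pull S x - 1‖)) * ‖S 1 - S 0‖⁻¹ := by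
          gcongr
      _ = _ := by
          rw [e0, e1]
          simp only [one_div, mul_inv]
          ring

/-- The triangle is convex with corners 0 and 1; the ends of the side are the two centers about
which Hardy's inequality is used. -/
theorem IsSim.starShaped {S : ℂ → ℂ} (h : IsSim S) {K : ℝ} {w : ℂ} (hw : w = 0 ∨ w = 1) :
    ∀ x ∈ S '' lowerTriangle K, ∀ t ∈ Set.Ioo (0 : ℝ) 1,
      S w + t • (x - S w) ∈ S '' lowerTriangle K := by
  rintro _ ⟨z, ⟨h1, h2, h3⟩, rfl⟩ t ⟨ht0, ht1⟩
  refine ⟨w + t • (z - w), ?_, ?_⟩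
  · have i1 : t * z.im < 0 := mul_neg_of_pos_of_neg ht0 h1
    have i2 : 0 < t * (K * z.re + z.im) := mul_pos ht0 h2
    have i3 : 0 < t * (K * (1 - z.re) + z.im) := mul_pos ht0 h3
    have hK : 0 < K := by
      by_contra hc
      nlinarith
    have i4 : 0 < (1 - t) * K := mul_pos (by linarith) hK
    rcases hw with rfl | rfl <;> refine ⟨?_, ?_, ?_⟩ <;> simp <;> nlinarith
  · rw [h.comp_sub, h.eq (w + _), h.eq w, Complex.real_smul, Complex.real_smul]
    ring

/-! The regular polygon. -/

/-- Half of the angle under which a side of the regular `m`-gon is seen from its center. -/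
def halfAngle (m : ℕ) : ℝ := Real.pi / m

/-- The center of the polygon in the coordinates of a side. -/
def polyCenter (m : ℕ) : ℂ :=
  1 / 2 - Complex.I * (Real.cos (halfAngle m) / (2 * Real.sin (halfAngle m)) : ℝ)

/-- The ratio of consecutive sides. -/
def turn (m : ℕ) : ℂ := Complex.exp (-(2 * Real.pi * Complex.I / m))

/-- The polygon. -/
def polygon (m : ℕ) (a c : ℂ) : Set ℂ := convexHull ℝ {z | ∃ j < m, z = vertex m a c j}

/-- The open sector of a side, in the coordinates of the side. -/
def openSector (m : ℕ) : Set ℂ :=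
  {z | |z.re - 1 / 2| * Real.cos (halfAngle m) <
    z.im * Real.sin (halfAngle m) + Real.cos (halfAngle m) / 2}

section polygon
variable {m : ℕ} (hm : 3 ≤ m)
include hm

theorem halfAngle_pos : 0 < halfAngle m := by
  have : (0 : ℝ) < m := by exact_mod_cast (by omega : 0 < m)
  exact div_pos Real.pi_pos this

theorem halfAngle_le : halfAngle m ≤ Real.pi / 3 := by
  have : (3 : ℝ) ≤ m := by exact_mod_cast hm
  exact div_le_div_of_nonneg_left Real.pi_pos.le (by norm_num) this

theorem sin_halfAngle_pos : 0 < Real.sin (halfAngle m) :=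
  Real.sin_pos_of_pos_of_lt_pi (halfAngle_pos hm) (by linarith [halfAngle_le hm, Real.pi_pos])

theorem half_le_cos_halfAngle : 1 / 2 ≤ Real.cos (halfAngle m) := by
  rw [← Real.cos_pi_div_three]
  exact Real.cos_le_cos_of_nonneg_of_le_pi (halfAngle_pos hm).le (by linarith [Real.pi_pos])
    (halfAngle_le hm)

theorem mul_halfAngle_eq : m * halfAngle m = Real.pi := by
  have : (m : ℝ) ≠ 0 := by exact_mod_cast (by omega : m ≠ 0)
  rw [halfAngle]; field_simp

/-- The angle kπ/m lies between π/m and π - π/m. -/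
theorem sin_mul_halfAngle_ge {k : ℕ} (hk : 1 ≤ k) (hkm : k < m) :
    Real.sin (halfAngle m) ≤ Real.sin (k * halfAngle m) ∧
      |Real.cos (k * halfAngle m)| ≤ Real.cos (halfAngle m) := by
  have hp := halfAngle_pos hm
  have h1 : halfAngle m ≤ k * halfAngle m := by
    have : (1 : ℝ) ≤ k := by exact_mod_cast hk
    nlinarith
  have h2 : k * halfAngle m ≤ Real.pi - halfAngle m := by
    have : (k : ℝ) + 1 ≤ m := by exact_mod_cast hkm
    rw [← mul_halfAngle_eq hm]; nlinarith
  have hc : |Real.cos (k * halfAngle m)| ≤ Real.cos (halfAngle m) := by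
    rw [abs_le]
    constructor
    · rw [← Real.cos_pi_sub]
      exact Real.cos_le_cos_of_nonneg_of_le_pi (by linarith) (by linarith) h2
    · exact Real.cos_le_cos_of_nonneg_of_le_pi hp.le (by linarith) h1
  refine ⟨?_, hc⟩
  have hs : 0 ≤ Real.sin (k * halfAngle m) :=
    Real.sin_nonneg_of_nonneg_of_le_pi (by linarith) (by linarith)
  have hsq : Real.cos (k * halfAngle m) ^ 2 ≤ Real.cos (halfAngle m) ^ 2 := sq_le_sq' (by
    linarith [(abs_le.1 hc).1]) (abs_le.1 hc).2
  refine abs_le_of_sq_le_sq' ?_ hs |>.2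
  nlinarith [Real.sin_sq_add_cos_sq (halfAngle m), Real.sin_sq_add_cos_sq (k * halfAngle m)]

theorem turn_pow_inv (k : ℕ) : (turn m ^ k)⁻¹ =
    Real.cos (2 * (k * halfAngle m)) + Real.sin (2 * (k * halfAngle m)) * Complex.I := by
  rw [turn, ← Complex.exp_nat_mul, ← Complex.exp_neg, Complex.ofReal_cos, Complex.ofReal_sin,
    ← Complex.exp_mul_I]
  congr 1
  rw [halfAngle]
  push_cast
  ring

theorem turn_ne_zero : turn m ≠ 0 := Complex.exp_ne_zero _

theorem turn_pow_card : turn m ^ m = 1 := by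
  have h := turn_pow_inv hm m
  rw [mul_halfAngle_eq hm, Real.cos_two_pi, Real.sin_two_pi] at h
  simpa using h

theorem turn_eq : turn m = (2 * (Real.cos (halfAngle m) : ℂ) ^ 2 - 1) -
    2 * (Real.sin (halfAngle m) : ℂ) * (Real.cos (halfAngle m) : ℂ) * Complex.I := by
  have h := turn_pow_inv hm 1
  have hone : (Real.sin (halfAngle m) : ℂ) ^ 2 + (Real.cos (halfAngle m) : ℂ) ^ 2 = 1 := by
    exact_mod_cast Real.sin_sq_add_cos_sq (halfAngle m)
  rw [pow_one, Nat.cast_one, one_mul, Real.cos_two_mul, Real.sin_two_mul] at h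
  rw [← inv_inv (turn m), h]
  refine inv_eq_of_mul_eq_one_left ?_
  generalize Real.sin (halfAngle m) = s at *
  generalize Real.cos (halfAngle m) = t at *
  push_cast
  linear_combination (-4 * (t : ℂ) ^ 2 * s ^ 2) * Complex.I_sq + (4 * (t : ℂ) ^ 2) * hone

/-- The center is the fixed point of z ↦ 1 + `turn m` * z, the passage from one side to the next in
the coordinates of a side. -/
theorem one_sub_turn_mul : (1 - turn m) * polyCenter m = 1 := by
  have hs : (Real.sin (halfAngle m) : ℂ) ≠ 0 := by exact_mod_cast (sin_halfAngle_pos hm).ne'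
  have hone : (Real.sin (halfAngle m) : ℂ) ^ 2 + (Real.cos (halfAngle m) : ℂ) ^ 2 = 1 := by
    exact_mod_cast Real.sin_sq_add_cos_sq (halfAngle m)
  rw [turn_eq hm, polyCenter]
  generalize Real.sin (halfAngle m) = s at *
  generalize Real.cos (halfAngle m) = t at *
  push_cast
  field_simp
  linear_combination (-2 * (s : ℂ) * (t : ℂ) ^ 2) * Complex.I_sq +
    (2 * Complex.I * t) * hone

theorem one_sub_turn_ne_zero : 1 - turn m ≠ 0 := fun e => by
  have := one_sub_turn_mul hm
  rw [e, zero_mul] at this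
  exact zero_ne_one this

variable {a c : ℂ}

theorem vertex_eq (j : ℕ) : vertex m a c j =
    a + c * polyCenter m - c * turn m ^ j * polyCenter m := by
  have h := mul_neg_geom_sum (turn m) j
  have h1 := one_sub_turn_mul hm
  have : ∑ k ∈ Finset.range j, turn m ^ k = (1 - turn m ^ j) * polyCenter m := by
    apply mul_left_cancel₀ (one_sub_turn_ne_zero hm)
    rw [h]
    linear_combination (-(1 - turn m ^ j)) * h1
  rw [vertex, show Complex.exp (-(2 * Real.pi * Complex.I / m)) = turn m from rfl, this]
  ring

theorem sideMap_eq (j : ℕ) (z : ℂ) : sideMap m a c j z =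
    a + c * polyCenter m + c * turn m ^ j * (z - polyCenter m) := by
  rw [sideMap, vertex_eq hm, vertex_eq hm, pow_succ]
  linear_combination (c * turn m ^ j * z) * one_sub_turn_mul hm

theorem sideMap_zero (j : ℕ) : sideMap m a c j 0 = vertex m a c j := by simp [sideMap]

theorem sideMap_one (j : ℕ) : sideMap m a c j 1 = vertex m a c (j + 1) := by simp [sideMap]

theorem vertex_card : vertex m a c m = vertex m a c 0 := by
  rw [vertex_eq hm, vertex_eq hm, turn_pow_card hm, pow_zero]

theorem sideMap_add_card (j : ℕ) : sideMap m a c (j + m) = sideMap m a c j := by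
  funext z
  rw [sideMap_eq hm, sideMap_eq hm, pow_add, turn_pow_card hm, mul_one]

theorem exists_vertex_succ {j : ℕ} (hj : j < m) :
    ∃ i < m, vertex m a c (j + 1) = vertex m a c i := by
  rcases (Nat.succ_le_of_lt hj).lt_or_eq with h | h
  · exact ⟨j + 1, h, rfl⟩
  · exact ⟨0, by omega, by rw [← vertex_card hm, ← h]⟩

theorem isSim_sideMap (hc : c ≠ 0) (j : ℕ) : IsSim (sideMap m a c j) := by
  refine IsSim.of_eq (a := a + c * polyCenter m - c * turn m ^ j * polyCenter m)
    (mul_ne_zero hc (pow_ne_zero j (turn_ne_zero hm))) fun z => ?_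
  rw [sideMap_eq hm]
  ring

theorem sideMap_sub (j : ℕ) : sideMap m a c j 1 - sideMap m a c j 0 = c * turn m ^ j := by
  rw [sideMap_eq hm, sideMap_eq hm]
  ring

theorem norm_turn : ‖turn m‖ = 1 := by
  rw [turn, show -(2 * Real.pi * Complex.I / m) = ((-(2 * Real.pi / m) : ℝ) : ℂ) * Complex.I by
    push_cast; ring]
  exact Complex.norm_exp_ofReal_mul_I _

/-- Changing from one side to another is a rotation about the center. -/
theorem pull_sideMap_add (hc : c ≠ 0) (j k : ℕ) (x : ℂ) : pull (sideMap m a c (j + k)) x =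
    polyCenter m + (turn m ^ k)⁻¹ * (pull (sideMap m a c j) x - polyCenter m) := by
  have ht := turn_ne_zero hm
  rw [(isSim_sideMap hm hc _).pull_eq_iff, sideMap_eq hm, add_sub_cancel_left, pow_add]
  have := (isSim_sideMap hm hc (a := a) j).apply_pull x
  rw [sideMap_eq hm] at this
  field_simp
  exact this.symm

/-- The position with respect to another side, relative to the center. -/
theorem pull_sideMap_add_im (hc : c ≠ 0) (j k : ℕ) (x : ℂ) :
    (pull (sideMap m a c (j + k)) x).im * Real.sin (halfAngle m) =
      (pull (sideMap m a c j) x).im * Real.sin (halfAngle m) - 2 * Real.sin (k * halfAngle m) *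
      (((pull (sideMap m a c j) x).im * Real.sin (halfAngle m) + Real.cos (halfAngle m) / 2) *
        Real.sin (k * halfAngle m) - ((pull (sideMap m a c j) x).re - 1 / 2) *
        Real.sin (halfAngle m) * Real.cos (k * halfAngle m)) := by
  have hs := (sin_halfAngle_pos hm).ne'
  rw [pull_sideMap_add hm hc, turn_pow_inv hm, Real.cos_two_mul, Real.sin_two_mul, polyCenter]
  have h2 := Real.sin_sq_add_cos_sq (k * halfAngle m)
  generalize Real.sin (k * halfAngle m) = σ at *
  generalize Real.cos (k * halfAngle m) = τ at *
  generalize Real.sin (halfAngle m) = s at *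
  generalize Real.cos (halfAngle m) = t at *
  generalize pull (sideMap m a c j) x = z
  have e : ∀ u v : ℝ, ((u : ℂ) + (v : ℂ) * Complex.I).re = u ∧
    ((u : ℂ) + (v : ℂ) * Complex.I).im = v := fun u v => by simp
  have f : ∀ u : ℝ, (1 / 2 - Complex.I * (u : ℂ)).re = 1 / 2 ∧
    (1 / 2 - Complex.I * (u : ℂ)).im = -u := fun u => by
      constructor
      · have : ((1 / 2 : ℂ)).re = 1 / 2 := by norm_num
        simp
      · have : ((1 / 2 : ℂ)).im = 0 := by norm_num
        simp
  simp only [Complex.add_im, Complex.mul_im, Complex.sub_re, Complex.sub_im, (e _ _).1, (e _ _).2,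
    (f _).1, (f _).2]
  field_simp
  linear_combination (2 * (t + 2 * z.im * s)) * h2

/-- In the closed sector of a side, the signed distance to that side is the largest one. -/
theorem pull_sideMap_add_im_le (hc : c ≠ 0) {j k : ℕ} (hk : k < m) {x : ℂ}
    (hx : |(pull (sideMap m a c j) x).re - 1 / 2| * Real.cos (halfAngle m) ≤
      (pull (sideMap m a c j) x).im * Real.sin (halfAngle m) + Real.cos (halfAngle m) / 2) :
    (pull (sideMap m a c (j + k)) x).im ≤ (pull (sideMap m a c j) x).im := by
  rcases Nat.eq_zero_or_pos k with rfl | h1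
  · exact le_rfl
  have h := pull_sideMap_add_im hm hc (a := a) j k x
  obtain ⟨hs, ht⟩ := sin_mul_halfAngle_ge hm h1 hk
  have hs0 := sin_halfAngle_pos hm
  generalize pull (sideMap m a c j) x = z at *
  set q := z.im * Real.sin (halfAngle m) + Real.cos (halfAngle m) / 2
  have hq : 0 ≤ q := le_trans (mul_nonneg (abs_nonneg _) (by linarith [half_le_cos_halfAngle hm])) hx
  have h2 : (z.re - 1 / 2) * Real.cos (k * halfAngle m) ≤ q := by
    refine (le_abs_self _).trans (le_trans ?_ hx)
    rw [abs_mul]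
    gcongr
  have h3 : (z.re - 1 / 2) * Real.sin (halfAngle m) * Real.cos (k * halfAngle m) ≤
      q * Real.sin (k * halfAngle m) := by
    calc _ = ((z.re - 1 / 2) * Real.cos (k * halfAngle m)) * Real.sin (halfAngle m) := by ring
      _ ≤ q * Real.sin (halfAngle m) := by gcongr
      _ ≤ _ := by gcongr
  have h4 : 0 ≤ 2 * Real.sin (k * halfAngle m) * (q * Real.sin (k * halfAngle m) -
      (z.re - 1 / 2) * Real.sin (halfAngle m) * Real.cos (k * halfAngle m)) :=
    mul_nonneg (by linarith) (by linarith)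
  exact le_of_mul_le_mul_right (by linarith) hs0

theorem pull_sideMap_add_im_lt (hc : c ≠ 0) {j k : ℕ} (h1 : 1 ≤ k) (hk : k < m) {x : ℂ}
    (hx : pull (sideMap m a c j) x ∈ openSector m) :
    (pull (sideMap m a c (j + k)) x).im < (pull (sideMap m a c j) x).im := by
  have h := pull_sideMap_add_im hm hc (a := a) j k x
  obtain ⟨hs, ht⟩ := sin_mul_halfAngle_ge hm h1 hk
  have hs0 := sin_halfAngle_pos hm
  generalize pull (sideMap m a c j) x = z at *
  rw [openSector, Set.mem_ofPred_eq] at hx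
  set q := z.im * Real.sin (halfAngle m) + Real.cos (halfAngle m) / 2
  have hq : 0 < q := lt_of_le_of_lt (mul_nonneg (abs_nonneg _)
    (by linarith [half_le_cos_halfAngle hm])) hx
  have h2 : (z.re - 1 / 2) * Real.cos (k * halfAngle m) < q := by
    refine (le_abs_self _).trans_lt (lt_of_le_of_lt ?_ hx)
    rw [abs_mul]
    gcongr
  have h3 : (z.re - 1 / 2) * Real.sin (halfAngle m) * Real.cos (k * halfAngle m) <
      q * Real.sin (k * halfAngle m) := by
    calc _ = ((z.re - 1 / 2) * Real.cos (k * halfAngle m)) * Real.sin (halfAngle m) := by ring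
      _ < q * Real.sin (halfAngle m) := by gcongr
      _ ≤ _ := by gcongr
  have h4 : 0 < 2 * Real.sin (k * halfAngle m) * (q * Real.sin (k * halfAngle m) -
      (z.re - 1 / 2) * Real.sin (halfAngle m) * Real.cos (k * halfAngle m)) :=
    mul_pos (by linarith) (by linarith)
  exact lt_of_mul_lt_mul_right (by linarith) hs0.le

theorem exists_sideMap_eq_add {i j : ℕ} (hi : i < m) (hj : j < m) :
    ∃ k < m, (i ≠ j → 1 ≤ k) ∧ sideMap m a c j = sideMap m a c (i + k) := by
  rcases le_or_gt i j with h | h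
  · exact ⟨j - i, by omega, by omega, by rw [Nat.add_sub_cancel' h]⟩
  · refine ⟨j + m - i, by omega, by omega, ?_⟩
    rw [show i + (j + m - i) = j + m by omega, sideMap_add_card hm]

theorem pull_sideMap_im_lt (hc : c ≠ 0) {i j : ℕ} (hi : i < m) (hj : j < m) (hij : i ≠ j) {x : ℂ}
    (hx : pull (sideMap m a c i) x ∈ openSector m) :
    (pull (sideMap m a c j) x).im < (pull (sideMap m a c i) x).im := by
  obtain ⟨k, hk, h1, e⟩ := exists_sideMap_eq_add hm (a := a) (c := c) hi hj
  rw [e]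
  exact pull_sideMap_add_im_lt hm hc (h1 hij) hk hx

theorem eq_of_mem_openSector (hc : c ≠ 0) {i j : ℕ} (hi : i < m) (hj : j < m) {x : ℂ}
    (hx : pull (sideMap m a c i) x ∈ openSector m)
    (hx' : pull (sideMap m a c j) x ∈ openSector m) : i = j := by
  by_contra hij
  exact lt_asymm (pull_sideMap_im_lt hm hc hi hj hij hx)
    (pull_sideMap_im_lt hm hc hj hi (Ne.symm hij) hx')

/-- By convexity only the vertices matter. The first vertex of side i lies in the closed sector of
that side at height 0, and this height is the largest with respect to all sides. -/
theorem im_nonpos_of_mem_polygon (hc : c ≠ 0) {j : ℕ} (hj : j < m) {x : ℂ}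
    (hx : x ∈ polygon m a c) : (pull (sideMap m a c j) x).im ≤ 0 := by
  have hconv : Convex ℝ {x : ℂ | (pull (sideMap m a c j) x).im ≤ 0} := by
    intro x hx y hy s t hs ht hst
    have e : pull (sideMap m a c j) (s • x + t • y) =
        s • pull (sideMap m a c j) x + t • pull (sideMap m a c j) y := by
      rw [pull_eq_mul, pull_eq_mul, pull_eq_mul]
      have : (s : ℂ) + t = 1 := by exact_mod_cast hst
      simp only [Complex.real_smul]
      linear_combination
        (-(sideMap m a c j 1 - sideMap m a c j 0)⁻¹ * (- sideMap m a c j 0)) * this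
    simp only [Set.mem_ofPred_eq] at hx hy ⊢
    rw [e]
    simp only [Complex.add_im, Complex.real_smul, Complex.im_ofReal_mul]
    nlinarith
  refine convexHull_min ?_ hconv hx
  rintro _ ⟨i, hi, rfl⟩
  obtain ⟨k, hk, -, e⟩ := exists_sideMap_eq_add hm (a := a) (c := c) hi hj
  have h0 : pull (sideMap m a c i) (vertex m a c i) = 0 := by
    rw [← sideMap_zero hm]
    exact (isSim_sideMap hm hc i).pull_apply 0
  have := pull_sideMap_add_im_le hm hc (a := a) (j := i) hk (x := vertex m a c i) (by
    rw [h0, Complex.zero_re, Complex.zero_im, zero_sub, abs_neg, abs_of_pos (by norm_num)]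
    linarith)
  rw [h0, Complex.zero_im] at this
  rw [Set.mem_ofPred_eq, e]
  exact this

/-- The center is the mean of the vertices, because the powers of an m-th root of unity other than 1
sum to 0. -/
theorem center_mem_polygon : a + c * polyCenter m ∈ polygon m a c := by
  have hm0 : (m : ℝ) ≠ 0 := by exact_mod_cast (by omega : m ≠ 0)
  have h : ∑ j ∈ Finset.range m, (1 / m : ℝ) • vertex m a c j ∈ polygon m a c := by
    refine (convex_convexHull ℝ _).sum_mem (fun _ _ => by positivity) ?_ fun j hj =>
      subset_convexHull ℝ _ ⟨j, Finset.mem_range.1 hj, rfl⟩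
    rw [Finset.sum_const, Finset.card_range, nsmul_eq_mul]
    field_simp
  convert h using 1
  rw [← Finset.smul_sum]
  have hs : ∑ j ∈ Finset.range m, turn m ^ j = 0 := by
    apply mul_left_cancel₀ (one_sub_turn_ne_zero hm)
    rw [mul_neg_geom_sum, turn_pow_card hm, sub_self, mul_zero]
  have e : ∑ j ∈ Finset.range m, vertex m a c j = m * (a + c * polyCenter m) := by
    simp only [vertex_eq hm, Finset.sum_sub_distrib, Finset.sum_const, Finset.card_range,
      nsmul_eq_mul]
    rw [← Finset.sum_mul, ← Finset.mul_sum, hs]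
    ring
  have hm0' : (m : ℂ) ≠ 0 := by exact_mod_cast hm0
  rw [e, Complex.real_smul]
  push_cast
  field_simp

theorem vertex_mem_polygon {j : ℕ} (hj : j < m) :
    vertex m a c j ∈ polygon m a c ∧ vertex m a c (j + 1) ∈ polygon m a c := by
  refine ⟨subset_convexHull ℝ _ ⟨j, hj, rfl⟩, ?_⟩
  obtain ⟨i, hi, e⟩ := exists_vertex_succ hm (a := a) (c := c) hj
  exact subset_convexHull ℝ _ ⟨i, hi, e⟩

theorem mem_polygon_of_abs_le (hc : c ≠ 0) {j : ℕ} (hj : j < m) {x : ℂ}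
    (h0 : (pull (sideMap m a c j) x).im ≤ 0)
    (hx : |(pull (sideMap m a c j) x).re - 1 / 2| * Real.cos (halfAngle m) ≤
      (pull (sideMap m a c j) x).im * Real.sin (halfAngle m) + Real.cos (halfAngle m) / 2) :
    x ∈ polygon m a c := by
  have hs := sin_halfAngle_pos hm
  have ht : 0 < Real.cos (halfAngle m) := by linarith [half_le_cos_halfAngle hm]
  have e := (isSim_sideMap hm hc (a := a) j).apply_pull x
  rw [(isSim_sideMap hm hc (a := a) j).eq, sideMap_zero hm, sideMap_one hm] at e
  obtain ⟨hv, hv'⟩ := vertex_mem_polygon hm (a := a) (c := c) hj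
  have hce := center_mem_polygon hm (a := a) (c := c)
  have hcv : a + c * polyCenter m = vertex m a c j +
      (vertex m a c (j + 1) - vertex m a c j) * polyCenter m := by
    rw [vertex_eq hm, vertex_eq hm, pow_succ]
    linear_combination (- c * turn m ^ j * polyCenter m) * one_sub_turn_mul hm
  rw [hcv, polyCenter] at hce
  generalize pull (sideMap m a c j) x = z at *
  generalize Real.sin (halfAngle m) = s at *
  generalize Real.cos (halfAngle m) = t at *
  -- The barycentric weight of the center in the triangle spanned by the side and the center: the
  -- center has imaginary part -t/(2s).
  set τ : ℝ := -(2 * s / t) * z.im with hτ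
  have hτt : τ * t = -(2 * s * z.im) := by rw [hτ]; field_simp
  obtain ⟨l1, l2⟩ := abs_le.1 ((le_div_iff₀ ht).2 hx)
  have q1 : (z.im * s + t / 2) / t = (1 - τ) / 2 := by
    rw [div_eq_iff ht.ne']; linarith
  rw [q1] at l1 l2
  have hτ0 : 0 ≤ τ := by
    rw [hτ]; have : 0 ≤ 2 * s / t := by positivity
    nlinarith
  have key := (convex_convexHull ℝ {z | ∃ j < m, z = vertex m a c j}).sum_mem
    (t := Finset.univ) (w := ![(1 - τ) / 2 - (z.re - 1 / 2), (1 - τ) / 2 + (z.re - 1 / 2), τ])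
    (z := ![vertex m a c j, vertex m a c (j + 1), vertex m a c j +
      (vertex m a c (j + 1) - vertex m a c j) * (1 / 2 - Complex.I * (t / (2 * s) : ℝ))])
    (by intro i _; fin_cases i <;> simp <;> linarith)
    (by simp [Fin.sum_univ_three])
    (by intro i _; fin_cases i <;> assumption)
  change x ∈ convexHull ℝ _
  convert key using 1
  simp only [Fin.sum_univ_three, Matrix.cons_val_zero, Matrix.cons_val_one, Matrix.cons_val,
    Complex.real_smul]
  rw [← e]
  have hz : (z : ℂ) = z.re + z.im * Complex.I := (Complex.re_add_im z).symm
  have hzi : (z.im : ℂ) = -((τ : ℂ) * (t / (2 * s) : ℝ)) := by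
    rw [← Complex.ofReal_mul, ← Complex.ofReal_neg]
    congr 1
    field_simp
    linarith
  generalize ((t / (2 * s) : ℝ) : ℂ) = h at *
  rw [hzi] at hz
  push_cast
  linear_combination (vertex m a c (j + 1) - vertex m a c j) * hz

theorem exists_max_side (x : ℂ) : ∃ j < m,
    (∀ i < m, (pull (sideMap m a c i) x).im ≤ (pull (sideMap m a c j) x).im) := by
  obtain ⟨j, hj, h⟩ := (Finset.range m).exists_max_image
    (fun i => (pull (sideMap m a c i) x).im) ⟨0, Finset.mem_range.2 (by omega)⟩
  exact ⟨j, Finset.mem_range.1 hj, fun i hi => h i (Finset.mem_range.2 hi)⟩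

/-- Only the two neighbouring sides are needed: comparison with side j + 1 and with side j + (m - 1)
bounds the real part from either direction. -/
theorem abs_le_of_max (hc : c ≠ 0) {x : ℂ} {j : ℕ}
    (h : ∀ i < m, (pull (sideMap m a c i) x).im ≤ (pull (sideMap m a c j) x).im) :
    |(pull (sideMap m a c j) x).re - 1 / 2| * Real.cos (halfAngle m) ≤
      (pull (sideMap m a c j) x).im * Real.sin (halfAngle m) + Real.cos (halfAngle m) / 2 := by
  have hs := sin_halfAngle_pos hm
  have hall : ∀ k, (pull (sideMap m a c (j + k)) x).im ≤ (pull (sideMap m a c j) x).im := by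
    have hp : ∀ i, sideMap m a c i = sideMap m a c (i % m) := by
      intro i
      conv_lhs => rw [← Nat.mod_add_div i m]
      generalize i / m = q
      induction q with
      | zero => simp
      | succ q ih => rw [Nat.mul_succ, ← add_assoc, sideMap_add_card hm, ih]
    intro k
    rw [hp (j + k)]
    exact h _ (Nat.mod_lt _ (by omega))
  have g1 := pull_sideMap_add_im hm hc (a := a) j 1 x
  have g2 := pull_sideMap_add_im hm hc (a := a) j (m - 1) x
  have hang : ((m - 1 : ℕ) : ℝ) * halfAngle m = Real.pi - halfAngle m := by
    rw [Nat.cast_sub (by omega), ← mul_halfAngle_eq hm]; push_cast; ring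
  rw [hang, Real.sin_pi_sub, Real.cos_pi_sub] at g2
  rw [Nat.cast_one, one_mul] at g1
  have h1 := hall 1
  have h2 := hall (m - 1)
  generalize pull (sideMap m a c (j + 1)) x = z1 at *
  generalize pull (sideMap m a c (j + (m - 1))) x = z2 at *
  generalize pull (sideMap m a c j) x = z at *
  generalize Real.sin (halfAngle m) = s at *
  have ht : 0 < Real.cos (halfAngle m) := by linarith [half_le_cos_halfAngle hm]
  generalize Real.cos (halfAngle m) = t at *
  have k1 : 0 ≤ 2 * s * s * ((z.im * s + t / 2) - (z.re - 1 / 2) * t) := by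
    nlinarith [mul_le_mul_of_nonneg_right h1 hs.le]
  have k2 : 0 ≤ 2 * s * s * ((z.im * s + t / 2) + (z.re - 1 / 2) * t) := by
    nlinarith [mul_le_mul_of_nonneg_right h2 hs.le]
  have l1 := nonneg_of_mul_nonneg_right k1 (by positivity)
  have l2 := nonneg_of_mul_nonneg_right k2 (by positivity)
  rw [← abs_of_pos ht, ← abs_mul, abs_of_pos ht]
  exact abs_le.2 ⟨by linarith, by linarith⟩

theorem mem_polygon_iff (hc : c ≠ 0) {x : ℂ} :
    x ∈ polygon m a c ↔ ∀ j < m, (pull (sideMap m a c j) x).im ≤ 0 := by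
  refine ⟨fun h j hj => im_nonpos_of_mem_polygon hm hc hj h, fun h => ?_⟩
  obtain ⟨j, hj, hmax⟩ := exists_max_side hm (a := a) (c := c) x
  exact mem_polygon_of_abs_le hm hc hj (h j hj) (abs_le_of_max hm hc hmax)

end polygon

theorem isCompact_polygon (m : ℕ) (a c : ℂ) : IsCompact (polygon m a c) := by
  refine Set.Finite.isCompact_convexHull ℝ ?_
  refine ((Finset.range m).finite_toSet.image (vertex m a c)).subset ?_
  rintro _ ⟨j, hj, rfl⟩
  exact ⟨j, by simpa using hj, rfl⟩

section polygonCells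
variable {α K : ℝ} (h : Admissible α K) {m : ℕ} (hm : 3 ≤ m) {a c : ℂ} (hc : c ≠ 0)

/-- The two conditions on K combine to K² ≤ 1/3, so fibers have base angle at most π/6. The sector
of a side has base angle π/2 - π/m, which is at least π/6 for m ≥ 3. Hence fibers of different sides
of the polygon cannot meet. -/
theorem Admissible.mul_sin_le (h : Admissible α K) (hm : 3 ≤ m) :
    K * Real.sin (halfAngle m) ≤ Real.cos (halfAngle m) := by
  have h1 := h.le_two_height
  have h2 := h.mul_height_le
  have h3 := h.height_sq
  have hK := h.pos
  have hH := h.height_pos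
  have hK3 : 3 * K ^ 2 ≤ 1 := by nlinarith
  have ht := half_le_cos_halfAngle hm
  have hst := Real.sin_sq_add_cos_sq (halfAngle m)
  have hs := sin_halfAngle_pos hm
  refine le_of_sq_le_sq ?_ (by linarith)
  have h4 : Real.sin (halfAngle m) ^ 2 ≤ 3 / 4 := by nlinarith
  calc (K * Real.sin (halfAngle m)) ^ 2 = K ^ 2 * Real.sin (halfAngle m) ^ 2 := by ring
    _ ≤ 1 / 3 * (3 / 4) := by gcongr; linarith
    _ ≤ _ := by nlinarith

theorem Admissible.mem_openSector (h : Admissible α K) (hm : 3 ≤ m) {z : ℂ} (h1 : z.im ≤ 0)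
    (h2 : 0 < K * z.re + z.im) (h3 : 0 < K * (1 - z.re) + z.im) : z ∈ openSector m := by
  have hK := h.pos
  have hs := h.mul_sin_le hm
  have ht : 0 < Real.cos (halfAngle m) := by linarith [half_le_cos_halfAngle hm]
  have hp : |z.re - 1 / 2| * K < z.im + K / 2 := by
    rw [← abs_of_pos hK, ← abs_mul, abs_of_pos hK, abs_lt]
    constructor <;> nlinarith
  rw [openSector, Set.mem_ofPred_eq]
  refine lt_of_mul_lt_mul_right ?_ hK.le
  calc |z.re - 1 / 2| * Real.cos (halfAngle m) * K
      = (|z.re - 1 / 2| * K) * Real.cos (halfAngle m) := by ring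
    _ < (z.im + K / 2) * Real.cos (halfAngle m) := by gcongr
    _ ≤ _ := by nlinarith

theorem Admissible.upperTriangle_subset_openSector (h : Admissible α K) (hm : 3 ≤ m) :
    upperTriangle α ⊆ openSector m := by
  rintro z ⟨h1, h2, h3⟩
  have ht : 0 < Real.cos (halfAngle m) := by linarith [half_le_cos_halfAngle hm]
  have hH := h.height_pos
  have hs := sin_halfAngle_pos hm
  have hp : |z.re - 1 / 2| < 1 / 2 := by
    rw [abs_lt]
    constructor <;> nlinarith
  rw [openSector, Set.mem_ofPred_eq]
  calc |z.re - 1 / 2| * Real.cos (halfAngle m) < 1 / 2 * Real.cos (halfAngle m) := by gcongr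
    _ ≤ _ := by nlinarith [mul_pos h1 hs]

include h hm hc

theorem sideMap_lowerTriangle_subset_polygon {j : ℕ} (hj : j < m) :
    sideMap m a c j '' lowerTriangle K ⊆ polygon m a c := fun x hx => by
  obtain ⟨h1, h2, h3⟩ := (isSim_sideMap hm hc (a := a) j).mem_image.1 hx
  have := h.mem_openSector hm h1.le h2 h3
  exact mem_polygon_of_abs_le hm hc hj h1.le (le_of_lt this)

theorem notMem_polygon_of_upperTriangle {j : ℕ} (hj : j < m) {x : ℂ}
    (hx : x ∈ sideMap m a c j '' upperTriangle α) : x ∉ polygon m a c := fun hp => by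
  have := im_nonpos_of_mem_polygon hm hc hj hp
  have h1 := ((isSim_sideMap hm hc (a := a) j).mem_image.1 hx).1
  linarith

/-- The coefficient function of the polygon. -/
theorem locLipAt_polygon {x : ℂ} (hx : ∀ j < m, x ≠ vertex m a c j) :
    LocLipAt (fun z => (polygon m a c).indicator 1 z -
      ∑ j ∈ Finset.range m, tooth K (pull (sideMap m a c j) z)) x := by
  have hsim := isSim_sideMap hm hc (a := a)
  have hcl : IsClosed (polygon m a c) := (isCompact_polygon m a c).isClosed
  have hne : ∀ y : ℂ, (∀ j < m, y ≠ vertex m a c j) → ∀ j < m,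
      pull (sideMap m a c j) y ≠ 0 ∧ pull (sideMap m a c j) y ≠ 1 := by
    intro y hy j hj
    refine ⟨fun e => ?_, fun e => ?_⟩
    · rw [(hsim j).pull_eq_iff, sideMap_zero hm] at e
      exact hy j hj e
    · rw [(hsim j).pull_eq_iff, sideMap_one hm] at e
      obtain ⟨i, hi, e'⟩ := exists_vertex_succ hm (a := a) (c := c) hj
      exact hy i hi (e.trans e')
  have hev : ∀ᶠ z in 𝓝 x, ∀ j < m, z ≠ vertex m a c j := by
    have : ∀ᶠ z in 𝓝 x, ∀ j ∈ Finset.range m, z ≠ vertex m a c j :=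
      (Finset.eventually_all _).2 fun j hj => eventually_ne_nhds (hx j (Finset.mem_range.1 hj))
    filter_upwards [this] with z hz j hj using hz j (Finset.mem_range.2 hj)
  have hclosed : IsClosed {z : ℂ | ∃ j < m, 0 ≤ (pull (sideMap m a c j) z).im} := by
    have e : {z : ℂ | ∃ j < m, 0 ≤ (pull (sideMap m a c j) z).im} =
        ⋃ j ∈ Finset.range m, {z : ℂ | 0 ≤ (pull (sideMap m a c j) z).im} := by
      ext z; simp
    rw [e]
    exact isClosed_biUnion_finset fun j _ => isClosed_le continuous_const
      (Complex.continuous_im.comp (continuous_pull _))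
  -- On the polygon every tooth is a tip. On the complement of its interior the function is 0 away
  -- from the vertices: outside the polygon all terms vanish, and on an open side the indicator
  -- cancels against one tooth.
  refine LocLipAt.of_closed_cover (ι := Fin 2)
    (A := ![polygon m a c, {z | ∃ j < m, 0 ≤ (pull (sideMap m a c j) z).im}])
    (F := ![fun z => 1 - ∑ j ∈ Finset.range m, tip K (pull (sideMap m a c j) z), fun _ => 0])
    ?_ (.of_forall fun z => ?_) ?_
  · intro i
    fin_cases i
    · exact hcl
    · exact hclosed
  · by_cases hz : z ∈ polygon m a c
    · exact ⟨0, hz⟩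
    · rw [mem_polygon_iff hm hc] at hz
      push Not at hz
      obtain ⟨j, hj, hz⟩ := hz
      exact ⟨1, j, hj, hz.le⟩
  · intro i
    fin_cases i <;> intro hi
    · have hi : x ∈ polygon m a c := hi
      refine ⟨(LocLipAt.const 1 x).sub (LocLipAt.sum _ fun j hj => ?_), .of_forall fun z hz => ?_⟩
      · obtain ⟨n0, n1⟩ := hne x hx j (Finset.mem_range.1 hj)
        exact (locLipAt_tip h.pos (im_nonpos_of_mem_polygon hm hc (Finset.mem_range.1 hj) hi)
          n0 n1).comp_pull
      · have hz : z ∈ polygon m a c := hz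
        rw [Set.indicator_of_mem hz]
        simp only [Pi.one_apply]
        refine congrArg (1 - ·) (Finset.sum_congr rfl fun j hj => ?_)
        exact tooth_of_im_le (im_nonpos_of_mem_polygon hm hc (Finset.mem_range.1 hj) hz)
    · refine ⟨LocLipAt.const 0 x, ?_⟩
      filter_upwards [hev] with z hz hz'
      obtain ⟨j, hj, hj0⟩ := hz'
      change _ = (0 : ℝ)
      by_cases hp : z ∈ polygon m a c
      · have hmax : ∀ i < m, (pull (sideMap m a c i) z).im ≤ (pull (sideMap m a c j) z).im :=
          fun i hi => (im_nonpos_of_mem_polygon hm hc hi hp).trans hj0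
        have him : (pull (sideMap m a c j) z).im = 0 :=
          le_antisymm (im_nonpos_of_mem_polygon hm hc hj hp) hj0
        have habs := abs_le_of_max hm hc hmax
        have ht : 0 < Real.cos (halfAngle m) := by linarith [half_le_cos_halfAngle hm]
        rw [him, zero_mul, zero_add] at habs
        have habs : |(pull (sideMap m a c j) z).re - 1 / 2| ≤ 1 / 2 :=
          le_of_mul_le_mul_right (by linarith) ht
        obtain ⟨l1, l2⟩ := abs_le.1 habs
        obtain ⟨n0, n1⟩ := hne z hz j hj
        rw [Set.indicator_of_mem hp, Finset.sum_eq_single_of_mem j (Finset.mem_range.2 hj),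
          tooth_of_im_le him.le, tip_of_im_eq_zero h.pos him, if_pos]
        · simp
        · constructor
          · refine lt_of_le_of_ne (by linarith) fun e => n0 (Complex.ext e.symm him)
          · refine lt_of_le_of_ne (by linarith) fun e => n1 (Complex.ext e him)
        · intro i hi hij
          by_contra hcon
          obtain ⟨a1, a2, a3⟩ := exists_of_tooth_ne_zero h.pos hcon
          have := pull_sideMap_im_lt hm hc (Finset.mem_range.1 hi) hj hij
            (h.mem_openSector hm a1 a2 a3)
          linarith
      · rw [Set.indicator_of_notMem hp, zero_sub, neg_eq_zero]
        refine Finset.sum_eq_zero fun i hi => ?_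
        by_contra hcon
        obtain ⟨a1, a2, a3⟩ := exists_of_tooth_ne_zero h.pos hcon
        exact hp (mem_polygon_of_abs_le hm hc (Finset.mem_range.1 hi) a1
          (le_of_lt (h.mem_openSector hm a1 a2 a3)))

end polygonCells

/-! Words and pieces. -/

/-- Appending a letter to a word. -/
def concatEmb : List (Fin 4) × Fin 4 ↪ List (Fin 4) :=
  ⟨fun p => p.1 ++ [p.2], fun p q e => by
    obtain ⟨h1, h2⟩ := List.append_inj' (show p.1 ++ [p.2] = q.1 ++ [q.2] from e) rfl
    exact Prod.ext h1 (by simpa using h2)⟩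

theorem concatEmb_apply (w : List (Fin 4)) (i : Fin 4) : concatEmb (w, i) = w ++ [i] := rfl

/-- The words of length `n`. -/
def words : ℕ → Finset (List (Fin 4))
  | 0 => {[]}
  | n + 1 => (words n ×ˢ Finset.univ).map concatEmb

theorem mem_words {n : ℕ} {w : List (Fin 4)} : w ∈ words n ↔ w.length = n := by
  induction n generalizing w with
  | zero => simp [words]
  | succ n ih =>
    simp only [words, Finset.mem_map, Finset.mem_product, Finset.mem_univ, and_true,
      concatEmb_apply, Prod.exists, ih]
    constructor
    · rintro ⟨v, i, rfl, rfl⟩; simp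
    · intro h
      rcases List.eq_nil_or_concat w with rfl | ⟨v, i, rfl⟩
      · simp at h
      · exact ⟨v, i, by simpa using h, List.concat_eq_append.symm⟩

theorem sum_words_succ (n : ℕ) (f : List (Fin 4) → ℝ) :
    ∑ w ∈ words (n + 1), f w = ∑ w ∈ words n, ∑ i, f (w ++ [i]) := by
  rw [words, Finset.sum_map, Finset.sum_product]
  rfl

theorem card_words (n : ℕ) : (words n).card = 4 ^ n := by
  induction n with
  | zero => rfl
  | succ n ih => rw [words, Finset.card_map, Finset.card_product, ih]; simp [pow_succ]

theorem kochWord_append (α : ℝ) (v w : List (Fin 4)) :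
    kochWord α (v ++ w) = kochWord α v ∘ kochWord α w := by
  induction v with
  | nil => rfl
  | cons i v ih => rw [List.cons_append, kochWord, ih]; rfl

theorem pieceMap_append (α : ℝ) (m : ℕ) (a c : ℂ) (j : ℕ) (v w : List (Fin 4)) :
    pieceMap α m a c j (v ++ w) = pieceMap α m a c j v ∘ kochWord α w := by
  rw [pieceMap, kochWord_append]; rfl

theorem pieceMap_concat (α : ℝ) (m : ℕ) (a c : ℂ) (j : ℕ) (v : List (Fin 4)) (i : Fin 4) :
    pieceMap α m a c j (v ++ [i]) = pieceMap α m a c j v ∘ kochMap α i :=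
  pieceMap_append α m a c j v [i]

section
variable {α K : ℝ} (h : Admissible α K)
include h

theorem isSim_kochWord (w : List (Fin 4)) : IsSim (kochWord α w) := by
  induction w with
  | nil => exact ⟨one_ne_zero, fun z => by simp [kochWord]⟩
  | cons i w ih => exact (isSim_kochMap h i).comp ih

theorem isSim_pieceMap {m : ℕ} (hm : 3 ≤ m) {a c : ℂ} (hc : c ≠ 0) (j : ℕ) (w : List (Fin 4)) :
    IsSim (pieceMap α m a c j w) :=
  (isSim_sideMap hm hc j).comp (isSim_kochWord h w)

/-! Positions of the pieces in the unit cell. -/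

theorem kochMap_mem_union (i : Fin 4) {z : ℂ} (hz : z ∈ lowerTriangle K ∪ upperTriangle α) :
    kochMap α i z ∈ lowerTriangle K ∪ upperTriangle α := by
  rcases hz with hz | hz
  · have : (i = 0 ∨ i = 3) ∨ (i = 1 ∨ i = 2) := by fin_cases i <;> simp
    rcases this with hi | hi
    · exact .inl (kochMap_mem_lowerTriangle h hi hz)
    · exact .inr (openBump_subset_upperTriangle h (kochMap_mem_openBump h hi hz))
  · exact .inr (kochMap_mem_upperTriangle h i hz)

theorem openBump_subset_closedBump : openBump α ⊆ closedBump α :=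
  fun _ ⟨h1, h2, h3⟩ => ⟨h1.le, h2.le, h3.le⟩

theorem kochMap_lower_ne_upper (i j : Fin 4) {z w : ℂ} (hz : z ∈ lowerTriangle K)
    (hw : w ∈ upperTriangle α) : kochMap α i z ≠ kochMap α j w := by
  intro e
  have : (i = 0 ∨ i = 3) ∨ (i = 1 ∨ i = 2) := by fin_cases i <;> simp
  rcases this with hi | hi
  · have h1 := (kochMap_mem_lowerTriangle h hi hz).1
    have h2 := (kochMap_mem_upperTriangle h j hw).1
    rw [e] at h1
    linarith
  · refine kochMap_notMem_closedBump h j hw ?_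
    rw [← e]
    exact openBump_subset_closedBump h (kochMap_mem_openBump h hi hz)

/-- The disjointness that allows the letters of a word to be read off from a point. -/
theorem eq_of_kochMap_eq {i j : Fin 4} {z w : ℂ} (hz : z ∈ lowerTriangle K ∪ upperTriangle α)
    (hw : w ∈ lowerTriangle K ∪ upperTriangle α) (e : kochMap α i z = kochMap α j w) : i = j := by
  by_contra hij
  rcases hz with hz | hz <;> rcases hw with hw | hw
  · rcases lt_or_gt_of_ne hij with hij | hij
    · exact kochMap_ne_of_lowerTriangle h hij hz hw e
    · exact kochMap_ne_of_lowerTriangle h hij hw hz e.symm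
  · exact kochMap_lower_ne_upper h i j hz hw e
  · exact kochMap_lower_ne_upper h j i hw hz e.symm
  · rcases lt_or_gt_of_ne hij with hij | hij
    · exact kochMap_ne_of_upperTriangle h hij hz hw e
    · exact kochMap_ne_of_upperTriangle h hij hw hz e.symm

theorem kochWord_mem_union (w : List (Fin 4)) {z : ℂ}
    (hz : z ∈ lowerTriangle K ∪ upperTriangle α) :
    kochWord α w z ∈ lowerTriangle K ∪ upperTriangle α := by
  induction w with
  | nil => exact hz
  | cons i w ih => exact kochMap_mem_union h i ih

theorem kochWord_mem_upperTriangle (w : List (Fin 4)) {z : ℂ} (hz : z ∈ upperTriangle α) :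
    kochWord α w z ∈ upperTriangle α := by
  induction w with
  | nil => exact hz
  | cons i w ih => exact kochMap_mem_upperTriangle h i ih

/-- The outermost letters agree by disjointness of the four copies; injectivity strips them off. -/
theorem eq_of_kochWord_eq {v w : List (Fin 4)} (hl : v.length = w.length) {y z : ℂ}
    (hy : y ∈ lowerTriangle K ∪ upperTriangle α) (hz : z ∈ lowerTriangle K ∪ upperTriangle α)
    (e : kochWord α v y = kochWord α w z) : v = w := by
  induction v generalizing w with
  | nil => exact (List.length_eq_zero_iff.1 hl.symm).symm
  | cons i v ih =>
    cases w with
    | nil => simp at hl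
    | cons j w =>
      have hij := eq_of_kochMap_eq h (kochWord_mem_union h v hy) (kochWord_mem_union h w hz) e
      subst hij
      rw [ih (by simpa using hl) ((isSim_kochMap h i).injective e)]

/-- Points that belong to the refinement step of a single cell determine the cell. -/
theorem eq_of_kochWord_eq_of_notMem {Y Z : Set ℂ} (hYU : Y ⊆ upperTriangle α)
    (hZU : Z ⊆ upperTriangle α) (hY : ∀ i, ∀ z ∈ upperTriangle α, kochMap α i z ∉ Y)
    (hZ : ∀ i, ∀ z ∈ upperTriangle α, kochMap α i z ∉ Z) {v w : List (Fin 4)} {y z : ℂ}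
    (hy : y ∈ Y) (hz : z ∈ Z) (e : kochWord α v y = kochWord α w z) : v = w := by
  induction v generalizing w with
  | nil =>
    cases w with
    | nil => rfl
    | cons j w =>
      refine absurd hy ?_
      rw [show y = kochMap α j (kochWord α w z) from e]
      exact hY j _ (kochWord_mem_upperTriangle h w (hZU hz))
  | cons i v ih =>
    cases w with
    | nil =>
      refine absurd hz ?_
      rw [show z = kochMap α i (kochWord α v y) from e.symm]
      exact hZ i _ (kochWord_mem_upperTriangle h v (hYU hy))
    | cons j w =>
      have hij := eq_of_kochMap_eq h (.inr (kochWord_mem_upperTriangle h v (hYU hy)))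
        (.inr (kochWord_mem_upperTriangle h w (hZU hz))) e
      subst hij
      rw [ih ((isSim_kochMap h i).injective e)]

theorem kochMap_notMem_openBump (i : Fin 4) (z : ℂ) (hz : z ∈ upperTriangle α) :
    kochMap α i z ∉ openBump α := fun hb =>
  kochMap_notMem_closedBump h i hz (openBump_subset_closedBump h hb)

omit h in
/-- The gap between the first and the second subcell above the unit segment. -/
def gap (α : ℝ) : Set ℂ :=
  {z | 0 < z.im ∧ z.im < 2 * height α * z.re ∧ z.re < 1 / 2 - halfBase α ∧
    2 * height α * (1 / 2 - halfBase α - z.re) < z.im ∧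
    height α * (1 + 2 * halfBase α) * (z.re - (1 / 2 - halfBase α)) <
      (3 * halfBase α - 1 / 2) * z.im}

theorem gap_subset_upperTriangle : gap α ⊆ upperTriangle α := by
  rintro z ⟨h1, h2, h3, h4, h5⟩
  have hd := h.halfBase_pos
  have hH := h.height_pos
  exact ⟨h1, h2, by nlinarith⟩

theorem isOpen_gap : IsOpen (gap α) := by
  simp only [gap, Set.ofPred_and]
  refine IsOpen.inter ?_ (IsOpen.inter ?_ (IsOpen.inter ?_ (IsOpen.inter ?_ ?_))) <;>
    exact isOpen_lt (by fun_prop) (by fun_prop)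

theorem gap_nonempty : (gap α).Nonempty := by
  have hd := h.halfBase_pos
  have hd4 := h.halfBase_lt
  have hH := h.height_pos
  have hs := h.height_sq
  obtain ⟨β, hβ⟩ : ∃ β, β = 1 / 2 - halfBase α := ⟨_, rfl⟩
  have hβ0 : 0 < β := by linarith
  have hp := mul_pos hH hβ0
  have e : height α * β * height α ^ 2 = height α * β * (1 / 4 - halfBase α) := by rw [hs]
  have p1 : 0 < height α * β * (1 / 4 + halfBase α) := mul_pos hp (by linarith)
  have p2 : 0 < height α * β * halfBase α := mul_pos hp hd
  have p3 : 0 < height α * β * (halfBase α - 2 * halfBase α ^ 2) := mul_pos hp (by nlinarith)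
  have p4 : 0 < height α ^ 2 * β := by positivity
  -- The witness is the corner (β, 0) moved by Hβ times (-H, 1/2). This direction is normal to the
  -- left edge of the upper triangle and bisects the angle at the corner between copies 0 and 1.
  refine ⟨⟨β - height α * β * height α, height α * β / 2⟩, ?_, ?_, ?_, ?_, ?_⟩ <;> dsimp only
  · linarith
  · nlinarith
  · nlinarith
  · rw [← hβ]
    nlinarith
  · rw [← hβ]
    have e' : height α * β * height α ^ 2 * halfBase α =
      height α * β * (1 / 4 - halfBase α) * halfBase α := by rw [hs]
    nlinarith

theorem disjoint_gap_openBump {z : ℂ} (hz : z ∈ gap α) : z ∉ openBump α := by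
  obtain ⟨h1, h2, h3, h4, h5⟩ := hz
  rintro ⟨g1, g2, g3⟩
  have hd := h.halfBase_pos
  have hH := h.height_pos
  nlinarith

theorem kochMap_notMem_gap (i : Fin 4) (z : ℂ) (hz : z ∈ upperTriangle α) :
    kochMap α i z ∉ gap α := by
  obtain ⟨h1, h2, h3⟩ := hz
  have hd := h.halfBase_pos
  have hH := h.height_pos
  have hs := h.height_sq
  have hd4 := h.halfBase_lt
  have ht0 : 0 < z.re := by nlinarith
  have ht1 : z.re < 1 := by nlinarith
  rintro ⟨g1, g2, g3, g4, g5⟩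
  fin_cases i
  · simp only [Fin.mk_zero, Fin.isValue, kochMap_zero_re h, kochMap_zero_im h] at g1 g2 g3 g4 g5
    nlinarith
  · simp only [Fin.mk_one, Fin.isValue, kochMap_one_re h, kochMap_one_im h] at g1 g2 g3 g4 g5
    have hp : 0 < (1 / 2 - halfBase α) ^ 2 * (2 * height α * z.re - z.im) :=
      mul_pos (pow_pos (by linarith) 2) (by linarith)
    -- The last inequality of `gap` describes the left edge of copy 1: in the coordinates of that
    -- copy it says 2H re < im, against `h2`.
    have e : height α * (1 + 2 * halfBase α) * (halfBase α * z.re - height α * z.im) -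
        (3 * halfBase α - 1 / 2) * (halfBase α * z.im + height α * z.re) =
        (1 / 2 - halfBase α) ^ 2 * (2 * height α * z.re - z.im) := by
      linear_combination (-(1 + 2 * halfBase α) * z.im) * hs
    rw [add_sub_cancel_right] at g5
    linarith
  · simp only [Fin.reduceFinMk, Fin.isValue, kochMap_two_re h, kochMap_two_im h] at g1 g2 g3 g4
    nlinarith
  · simp only [Fin.reduceFinMk, Fin.isValue, kochMap_three_re h, kochMap_three_im h] at g1 g2 g3 g4
    nlinarith

end

/-! Positions of the pieces in the plane. -/

/-- The closed polygonal region whose interior is the pre-fractal domain. -/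
def region (α : ℝ) (m : ℕ) (a c : ℂ) (n : ℕ) : Set ℂ :=
  polygon m a c ∪ {z | ∃ j < m, ∃ w : List (Fin 4), w.length < n ∧
    z ∈ pieceMap α m a c j w '' bump α}

theorem region_mono (α : ℝ) (m : ℕ) (a c : ℂ) : Monotone (region α m a c) := by
  intro n k hnk x hx
  rcases hx with hx | ⟨j, hj, w, hw, hx⟩
  · exact .inl hx
  · exact .inr ⟨j, hj, w, hw.trans_le hnk, hx⟩

theorem prefractal_mono (α : ℝ) (m : ℕ) (a c : ℂ) : Monotone (prefractal α m a c) :=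
  fun _ _ hnk => interior_mono (region_mono α m a c hnk)

theorem isOpen_prefractal (α : ℝ) (m : ℕ) (a c : ℂ) (n : ℕ) : IsOpen (prefractal α m a c n) :=
  isOpen_interior

theorem isOpen_domain (α : ℝ) (m : ℕ) (a c : ℂ) : IsOpen (domain α m a c) :=
  isOpen_iUnion fun n => isOpen_prefractal α m a c n

/-- The points on the boundaries of the polygon and of the bumps. -/
def edges (α : ℝ) (m : ℕ) (a c : ℂ) : Set ℂ :=
  frontier (polygon m a c) ∪
    ⋃ (j : ℕ) (w : List (Fin 4)), pieceMap α m a c j w '' (closedBump α \ openBump α)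

section
variable {α K : ℝ} (h : Admissible α K) {m : ℕ} (hm : 3 ≤ m) {a c : ℂ} (hc : c ≠ 0)
include h

theorem volume_closedBump_diff : volume (closedBump α \ openBump α) = 0 := by
  have := (convex_convexHull ℝ {1 / (α : ℂ), 1 / 2 + Complex.I * (√(1 / α - 1 / 4) : ℝ),
    1 - 1 / (α : ℂ)}).addHaar_frontier volume
  change volume (frontier (bump α)) = 0 at this
  rwa [frontier, interior_bump h, bump_eq h, (isClosed_closedBump α).closure_eq] at this

/-- An inner fiber lies in the lower triangle or in the bump of a larger cell. -/
theorem kochWord_lowerTriangle (w : List (Fin 4)) {z : ℂ} (hz : z ∈ lowerTriangle K) :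
    kochWord α w z ∈ lowerTriangle K ∨
      ∃ v : List (Fin 4), v.length < w.length ∧ ∃ y ∈ openBump α,
        kochWord α w z = kochWord α v y := by
  induction w with
  | nil => exact .inl hz
  | cons i w ih =>
    rcases ih with hz | ⟨v, hv, y, hy, e⟩
    · have : (i = 0 ∨ i = 3) ∨ (i = 1 ∨ i = 2) := by fin_cases i <;> simp
      rcases this with hi | hi
      · exact .inl (kochMap_mem_lowerTriangle h hi hz)
      · exact .inr ⟨[], by simp, _, kochMap_mem_openBump h hi hz, rfl⟩
    · exact .inr ⟨i :: v, by simpa using hv, y, hy, congrArg (kochMap α i) e⟩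

include hm

theorem mem_openSector_of_mem_union {z : ℂ} (hz : z ∈ lowerTriangle K ∪ upperTriangle α) :
    z ∈ openSector m := by
  rcases hz with ⟨h1, h2, h3⟩ | hz
  · exact h.mem_openSector hm h1.le h2 h3
  · exact h.upperTriangle_subset_openSector hm hz

include hc

theorem volume_edges : volume (edges α m a c) = 0 := by
  refine measure_union_null ((convex_convexHull ℝ _).addHaar_frontier volume)
    (measure_iUnion_null fun j => measure_iUnion_null fun w => ?_)
  rw [(isSim_pieceMap h hm hc j w).volume_image, volume_closedBump_diff h, mul_zero]

/-- Cells over different sides of the polygon lie in disjoint open sectors, so a common point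
determines the side. -/
theorem side_eq {i j : ℕ} (hi : i < m) (hj : j < m) {v w : List (Fin 4)} {y z : ℂ}
    (hy : y ∈ lowerTriangle K ∪ upperTriangle α) (hz : z ∈ lowerTriangle K ∪ upperTriangle α)
    (e : pieceMap α m a c i v y = pieceMap α m a c j w z) :
    i = j ∧ kochWord α v y = kochWord α w z := by
  have hs := isSim_sideMap hm hc (a := a)
  have h1 : pull (sideMap m a c i) (pieceMap α m a c i v y) ∈ openSector m := by
    rw [pieceMap, Function.comp, (hs i).pull_apply]
    exact mem_openSector_of_mem_union h hm (kochWord_mem_union h v hy)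
  have h2 : pull (sideMap m a c j) (pieceMap α m a c i v y) ∈ openSector m := by
    rw [e, pieceMap, Function.comp, (hs j).pull_apply]
    exact mem_openSector_of_mem_union h hm (kochWord_mem_union h w hz)
  have hij := eq_of_mem_openSector hm hc hi hj h1 h2
  subst hij
  exact ⟨rfl, (hs i).injective e⟩

theorem fiber_eq {i j : ℕ} (hi : i < m) (hj : j < m) {v w : List (Fin 4)}
    (hl : v.length = w.length) {x : ℂ} (hx : x ∈ pieceMap α m a c i v '' lowerTriangle K)
    (hx' : x ∈ pieceMap α m a c j w '' lowerTriangle K) : i = j ∧ v = w := by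
  obtain ⟨y, hy, rfl⟩ := hx
  obtain ⟨z, hz, e⟩ := hx'
  obtain ⟨h1, h2⟩ := side_eq h hm hc hi hj (.inl hy) (.inl hz) e.symm
  exact ⟨h1, eq_of_kochWord_eq h hl (.inl hy) (.inl hz) h2⟩

theorem bump_piece_eq {i j : ℕ} (hi : i < m) (hj : j < m) {v w : List (Fin 4)} {x : ℂ}
    (hx : x ∈ pieceMap α m a c i v '' openBump α)
    (hx' : x ∈ pieceMap α m a c j w '' openBump α) : i = j ∧ v = w := by
  obtain ⟨y, hy, rfl⟩ := hx
  obtain ⟨z, hz, e⟩ := hx'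
  have hU := openBump_subset_upperTriangle h
  obtain ⟨h1, h2⟩ := side_eq h hm hc hi hj (.inr (hU hy)) (.inr (hU hz)) e.symm
  exact ⟨h1, eq_of_kochWord_eq_of_notMem h hU hU (kochMap_notMem_openBump h)
    (kochMap_notMem_openBump h) hy hz h2⟩

theorem gap_notMem_openBump {i j : ℕ} (hi : i < m) (hj : j < m) {v w : List (Fin 4)} {x : ℂ}
    (hx : x ∈ pieceMap α m a c i v '' gap α) : x ∉ pieceMap α m a c j w '' openBump α := by
  rintro ⟨z, hz, e⟩
  obtain ⟨y, hy, rfl⟩ := hx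
  have hU := openBump_subset_upperTriangle h
  have hG := gap_subset_upperTriangle h
  obtain ⟨h1, h2⟩ := side_eq h hm hc hi hj (.inr (hG hy)) (.inr (hU hz)) e.symm
  have h3 := eq_of_kochWord_eq_of_notMem h hG hU (kochMap_notMem_gap h)
    (kochMap_notMem_openBump h) hy hz h2
  subst h3
  have := (isSim_kochWord h v).injective h2
  subst this
  exact disjoint_gap_openBump h hy hz

theorem piece_upper_notMem_polygon {j : ℕ} (hj : j < m) {w : List (Fin 4)} {x : ℂ}
    (hx : x ∈ pieceMap α m a c j w '' upperTriangle α) : x ∉ polygon m a c := by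
  obtain ⟨z, hz, rfl⟩ := hx
  exact notMem_polygon_of_upperTriangle h hm hc hj
    ⟨_, kochWord_mem_upperTriangle h w hz, rfl⟩

/-- Off the null set `edges` the closed pieces may be replaced with their interiors, which are
pairwise disjoint. -/
theorem interior_or_bump_of_mem_region {n : ℕ} {x : ℂ} (hx : x ∈ region α m a c n)
    (he : x ∉ edges α m a c) : x ∈ interior (polygon m a c) ∨
      ∃ j < m, ∃ w : List (Fin 4), w.length < n ∧ x ∈ pieceMap α m a c j w '' openBump α := by
  rcases hx with hx | ⟨j, hj, w, hw, hx⟩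
  · left
    by_contra hn
    exact he (.inl ⟨subset_closure hx, hn⟩)
  · right
    refine ⟨j, hj, w, hw, ?_⟩
    rw [bump_eq h] at hx
    rw [(isSim_pieceMap h hm hc j w).mem_image] at hx ⊢
    by_contra hn
    exact he (.inr (Set.mem_iUnion₂.2 ⟨j, w,
      (isSim_pieceMap h hm hc j w).mem_image.2 ⟨hx, hn⟩⟩))

theorem bump_subset_prefractal {n j : ℕ} (hj : j < m) {w : List (Fin 4)} (hw : w.length < n) :
    pieceMap α m a c j w '' openBump α ⊆ prefractal α m a c n := by
  refine interior_maximal (fun x hx => .inr ⟨j, hj, w, hw, ?_⟩)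
    ((isSim_pieceMap h hm hc j w).isOpen_image (isOpen_openBump α))
  rw [bump_eq h]
  exact Set.image_mono (openBump_subset_closedBump h) hx

theorem fiber_subset_prefractal {j : ℕ} (hj : j < m) (w : List (Fin 4)) :
    pieceMap α m a c j w '' lowerTriangle K ⊆ prefractal α m a c w.length := by
  refine interior_maximal ?_
    ((isSim_pieceMap h hm hc j w).isOpen_image (isOpen_lowerTriangle K))
  rintro _ ⟨z, hz, rfl⟩
  rcases kochWord_lowerTriangle h w hz with hz | ⟨v, hv, y, hy, e⟩
  · exact .inl (sideMap_lowerTriangle_subset_polygon h hm hc hj ⟨_, hz, rfl⟩)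
  · refine .inr ⟨j, hj, v, hv, y, ?_, ?_⟩
    · rw [bump_eq h]; exact openBump_subset_closedBump h hy
    · rw [pieceMap, pieceMap, Function.comp, Function.comp, e]

/-- Up to a null set the bumps of all levels over one side of the polygon stay in the upper triangle
of that side. -/
theorem volume_domain_ne_top : volume (domain α m a c) ≠ ∞ := by
  have hU : volume (upperTriangle α) ≠ ∞ := by
    refine ((measure_mono fun z hz => ?_).trans_lt
      (measure_ball_lt_top (μ := volume) (x := (0 : ℂ)) (r := 3))).ne
    obtain ⟨h1, h2, h3⟩ := hz
    have hH := h.height_pos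
    have hs := h.height_sq
    have hd := h.halfBase_pos
    have hH2 : height α < 1 / 2 := by nlinarith
    have ht0 : 0 < z.re := by nlinarith
    have ht1 : z.re < 1 := by nlinarith
    rw [mem_ball_zero_iff]
    refine (Complex.norm_le_abs_re_add_abs_im z).trans_lt ?_
    rw [abs_of_pos ht0, abs_of_pos h1]
    nlinarith
  have hsub : domain α m a c ⊆ edges α m a c ∪ (polygon m a c ∪
      ⋃ j ∈ Finset.range m, sideMap m a c j '' upperTriangle α) := by
    intro x hx
    obtain ⟨n, hx⟩ := Set.mem_iUnion.1 hx
    by_cases he : x ∈ edges α m a c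
    · exact .inl he
    right
    rcases interior_or_bump_of_mem_region h hm hc (interior_subset hx) he with
      hx | ⟨j, hj, w, -, z, hz, rfl⟩
    · exact .inl (interior_subset hx)
    · refine .inr (Set.mem_biUnion (Finset.mem_coe.2 (Finset.mem_range.2 hj)) ⟨_, ?_, rfl⟩)
      exact kochWord_mem_upperTriangle h w (openBump_subset_upperTriangle h hz)
  refine ((measure_mono hsub).trans_lt ?_).ne
  refine (measure_union_le _ _).trans_lt ?_
  rw [volume_edges h hm hc, zero_add]
  refine (measure_union_le _ _).trans_lt (ENNReal.add_lt_top.2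
    ⟨(isCompact_polygon m a c).measure_lt_top, ?_⟩)
  refine (measure_biUnion_finset_le _ _).trans_lt (ENNReal.sum_lt_top.2 fun j _ => ?_)
  rw [(isSim_sideMap hm hc j).volume_image]
  exact ENNReal.mul_lt_top ENNReal.ofReal_lt_top hU.lt_top

omit hm hc in
-- Repeating the letter 0 or 3 gives homotheties about the end 0 or 1 of the cell.
theorem kochWord_replicate {i : Fin 4} {q : ℂ} (hi : i = 0 ∧ q = 0 ∨ i = 3 ∧ q = 1) (k : ℕ)
    (z : ℂ) : kochWord α (List.replicate k i) z =
      q + ((1 / 2 - halfBase α : ℝ) : ℂ) ^ k * (z - q) := by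
  induction k with
  | zero => simp [kochWord]
  | succ k ih =>
    rw [List.replicate_succ, kochWord, Function.comp, ih]
    rcases hi with ⟨rfl, rfl⟩ | ⟨rfl, rfl⟩
    · rw [kochMap_zero h]; ring
    · rw [kochMap_three h]; push_cast; ring

/-- An open prefractal domain containing this point would meet the gaps of the ever smaller cells at
it, which accumulate there. The intersection with such a gap would be open and nonempty, hence of
positive measure. But a gap avoids the polygon and all open bumps, so the intersection lies in the
null set `edges`. Consequently test functions vanish at the ends of every side. -/
theorem vertex_notMem_domain {j : ℕ} (hj : j < m) (w : List (Fin 4)) {q : ℂ}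
    (hq : q = 0 ∨ q = 1) : pieceMap α m a c j w q ∉ domain α m a c := by
  intro hx
  obtain ⟨n, hx⟩ := Set.mem_iUnion.1 hx
  obtain ⟨i, hi⟩ : ∃ i : Fin 4, i = 0 ∧ q = 0 ∨ i = 3 ∧ q = 1 := by
    rcases hq with hq | hq
    · exact ⟨0, .inl ⟨rfl, hq⟩⟩
    · exact ⟨3, .inr ⟨rfl, hq⟩⟩
  obtain ⟨g, hg⟩ := gap_nonempty h
  have hlim : Tendsto (fun k => kochWord α (List.replicate k i) g) atTop (𝓝 q) := by
    have hb : ‖((1 / 2 - halfBase α : ℝ) : ℂ)‖ < 1 := by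
      have hd := h.halfBase_pos
      have hd4 := h.halfBase_lt
      rw [Complex.norm_real, Real.norm_eq_abs, abs_lt]
      constructor <;> linarith
    have := ((tendsto_pow_atTop_nhds_zero_of_norm_lt_one hb).mul_const (g - q)).const_add q
    rw [zero_mul, add_zero] at this
    exact this.congr fun k => (kochWord_replicate h hi k g).symm
  have hlim' := ((isSim_pieceMap h hm hc (a := a) j w).continuous.tendsto q).comp hlim
  obtain ⟨k, hk⟩ : ∃ k, pieceMap α m a c j w (kochWord α (List.replicate k i) g) ∈
      prefractal α m a c n :=
    (hlim'.eventually ((isOpen_prefractal α m a c n).mem_nhds hx)).exists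
  have hS := isSim_pieceMap h hm hc (a := a) j (w ++ List.replicate k i)
  have ho := (hS.isOpen_image (isOpen_gap h)).inter (isOpen_prefractal α m a c n)
  have hne : (pieceMap α m a c j (w ++ List.replicate k i) '' gap α ∩
      prefractal α m a c n).Nonempty := by
    refine ⟨_, ⟨g, hg, rfl⟩, ?_⟩
    rw [pieceMap_append]
    exact hk
  refine (ho.measure_pos volume hne).ne' (measure_mono_null ?_ (volume_edges h hm hc (a := a)))
  rintro x ⟨hx, hx'⟩
  by_contra he
  rcases interior_or_bump_of_mem_region h hm hc (interior_subset hx') he with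
    hx' | ⟨l, hl, v, -, hx'⟩
  · exact piece_upper_notMem_polygon h hm hc hj
      (Set.image_mono (gap_subset_upperTriangle h) hx) (interior_subset hx')
  · exact gap_notMem_openBump h hm hc hj hl hx hx'

end

/-! The coefficient functions as sums over the cells. -/

/-- The part of `cutoff` that is constant on the polygon and on each bump. -/
def plateau (α : ℝ) (m : ℕ) (a c : ℂ) (n : ℕ) (x : ℂ) : ℝ :=
  (polygon m a c).indicator 1 x + ∑ j ∈ Finset.range m, ∑ k ∈ Finset.range n, ∑ w ∈ words k,
    bumpFun α (pull (pieceMap α m a c j w) x)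

/-- The sum of the tooth functions of the sides of the `n`-th polygon. -/
def teeth (α K : ℝ) (m : ℕ) (a c : ℂ) (n : ℕ) (x : ℂ) : ℝ :=
  ∑ j ∈ Finset.range m, ∑ w ∈ words n, tooth K (pull (pieceMap α m a c j w) x)

/-- A version of the coefficient function that is locally Lipschitz in the domain. -/
def cutoff (α K : ℝ) (m : ℕ) (a c : ℂ) (n : ℕ) (x : ℂ) : ℝ :=
  plateau α m a c n x - teeth α K m a c n x

/-- The union of the inner fibers. -/
def fibers (α K : ℝ) (m : ℕ) (a c : ℂ) (n : ℕ) : Set ℂ :=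
  ⋃ p ∈ Finset.range m ×ˢ words n, pieceMap α m a c p.1 p.2 '' lowerTriangle K

/-- A null set off which the cutoff functions are differentiable. -/
def creases (α K : ℝ) (m : ℕ) (a c : ℂ) : Set ℂ :=
  edges α m a c ∪
    ⋃ (j : ℕ) (w : List (Fin 4)), pull (pieceMap α m a c j w) ⁻¹' toothLines K

theorem mem_fibers {α K : ℝ} {m : ℕ} {a c : ℂ} {n : ℕ} {x : ℂ} : x ∈ fibers α K m a c n ↔
    ∃ j < m, ∃ w : List (Fin 4), w.length = n ∧
      x ∈ pieceMap α m a c j w '' lowerTriangle K := by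
  simp only [fibers, Set.mem_iUnion, Finset.mem_product, Finset.mem_range, mem_words, Prod.exists]
  constructor
  · rintro ⟨j, w, ⟨hj, hw⟩, hx⟩; exact ⟨j, hj, w, hw, hx⟩
  · rintro ⟨j, hj, w, hw, hx⟩; exact ⟨j, w, ⟨hj, hw⟩, hx⟩

section
variable {α K : ℝ} (h : Admissible α K) {m : ℕ} (hm : 3 ≤ m) {a c : ℂ} (hc : c ≠ 0)
include h hm hc

theorem volume_creases : volume (creases α K m a c) = 0 :=
  measure_union_null (volume_edges h hm hc) <| measure_iUnion_null fun j =>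
    measure_iUnion_null fun w =>
      (isSim_pieceMap h hm hc j w).volume_preimage_pull (volume_toothLines K)

/-- The step adds the bumps of the sides of level n and replaces each tooth with the teeth of the
four subsides. Collecting terms per side gives `cellFun`. -/
theorem cutoff_succ (n : ℕ) (x : ℂ) : cutoff α K m a c (n + 1) x = cutoff α K m a c n x +
    ∑ j ∈ Finset.range m, ∑ w ∈ words n, cellFun α K (pull (pieceMap α m a c j w) x) := by
  have hp : ∀ j w i, pull (pieceMap α m a c j (w ++ [i])) x =
      pull (kochMap α i) (pull (pieceMap α m a c j w) x) := fun j w i => by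
    rw [pieceMap_concat, (isSim_pieceMap h hm hc j w).pull_comp (isSim_kochMap h i)]
  simp only [cutoff, plateau, teeth, sum_words_succ, Finset.sum_range_succ, hp, cellFun,
    Finset.sum_add_distrib, Finset.sum_sub_distrib]
  ring

/-- Induction on n: the polygon is the base case, and a refinement step adds finitely many copies of
`cellFun`, singular at vertices only. -/
theorem locLipAt_cutoff (n : ℕ) {x : ℂ}
    (hx : ∀ j < m, ∀ w : List (Fin 4), x ≠ pieceMap α m a c j w 0 ∧ x ≠ pieceMap α m a c j w 1) :
    LocLipAt (cutoff α K m a c n) x := by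
  induction n with
  | zero =>
    have := locLipAt_polygon h hm hc (a := a) (x := x) fun j hj => by
      have := (hx j hj []).1
      rwa [pieceMap, Function.comp, kochWord, id, sideMap_zero hm] at this
    refine this.congr (.of_forall fun z => ?_)
    simp [cutoff, plateau, teeth, words, pieceMap, kochWord]
  | succ n ih =>
    refine (ih.add (LocLipAt.sum (Finset.range m) fun j hj =>
      LocLipAt.sum (words n) fun w hw => ?_)).congr (.of_forall fun z => cutoff_succ h hm hc n z)
    refine LocLipAt.comp_pull (f := cellFun α K) (locLipAt_cellFun h fun i => ?_)
    have hS := isSim_pieceMap h hm hc (a := a) j w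
    have := hx j (Finset.mem_range.1 hj) (w ++ [i])
    rw [pieceMap_concat] at this
    exact ⟨fun e => this.1 (hS.pull_eq_iff.1 e), fun e => this.2 (hS.pull_eq_iff.1 e)⟩

theorem bumpFun_pull {j : ℕ} {w : List (Fin 4)} {x : ℂ} (he : x ∉ edges α m a c) :
    bumpFun α (pull (pieceMap α m a c j w) x) =
      (pieceMap α m a c j w '' openBump α).indicator 1 x := by
  have hS := isSim_pieceMap h hm hc (a := a) j w
  by_cases hx : x ∈ pieceMap α m a c j w '' openBump α
  · rw [Set.indicator_of_mem hx, bumpFun, if_pos]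
    · rfl
    · have := hS.mem_image.1 hx
      exact ⟨openBump_subset_closedBump h this, this.1⟩
  · rw [Set.indicator_of_notMem hx, bumpFun, if_neg]
    rintro ⟨hb, -⟩
    exact he (.inr (Set.mem_iUnion₂.2 ⟨j, w, hS.mem_image.2
      ⟨hb, fun hb' => hx (hS.mem_image.2 hb')⟩⟩))

theorem hasFDerivAt_plateau (n : ℕ) {x : ℂ} (he : x ∉ edges α m a c) :
    HasFDerivAt (plateau α m a c n) (0 : ℂ →L[ℝ] ℝ) x := by
  have h1 : HasFDerivAt ((polygon m a c).indicator (1 : ℂ → ℝ)) (0 : ℂ →L[ℝ] ℝ) x := by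
    have hf : x ∉ frontier (polygon m a c) := fun hf => he (.inl hf)
    by_cases hi : x ∈ interior (polygon m a c)
    · refine (hasFDerivAt_const (1 : ℝ) x).congr_of_eventuallyEq ?_
      filter_upwards [isOpen_interior.mem_nhds hi] with z hz
      rw [Set.indicator_of_mem (interior_subset hz), Pi.one_apply]
    · have hx : x ∉ polygon m a c := fun hx => hf ⟨subset_closure hx, hi⟩
      refine (hasFDerivAt_const (0 : ℝ) x).congr_of_eventuallyEq ?_
      filter_upwards [(isCompact_polygon m a c).isClosed.isOpen_compl.mem_nhds hx] with z hz
      rw [Set.indicator_of_notMem hz]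
  have h2 : ∀ j w, HasFDerivAt (fun z => bumpFun α (pull (pieceMap α m a c j w) z))
      (0 : ℂ →L[ℝ] ℝ) x := by
    intro j w
    have hS := isSim_pieceMap h hm hc (a := a) j w
    have hcont := (continuous_pull (pieceMap α m a c j w)).continuousAt (x := x)
    by_cases hx : pull (pieceMap α m a c j w) x ∈ openBump α
    · refine (hasFDerivAt_const (1 : ℝ) x).congr_of_eventuallyEq ?_
      filter_upwards [hcont ((isOpen_openBump α).mem_nhds hx)] with z hz
      exact if_pos ⟨openBump_subset_closedBump h hz, hz.1⟩
    · have hx' : pull (pieceMap α m a c j w) x ∉ closedBump α := fun hb =>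
        he (.inr (Set.mem_iUnion₂.2 ⟨j, w, hS.mem_image.2 ⟨hb, hx⟩⟩))
      refine (hasFDerivAt_const (0 : ℝ) x).congr_of_eventuallyEq ?_
      filter_upwards [hcont ((isClosed_closedBump α).isOpen_compl.mem_nhds hx')] with z hz
      exact if_neg fun hb => hz hb.1
  have h3 := h1.add (HasFDerivAt.fun_sum (u := Finset.range m) fun j _ =>
    HasFDerivAt.fun_sum (u := Finset.range n) fun k _ =>
      HasFDerivAt.fun_sum (u := words k) fun w _ => h2 j w)
  simp only [Finset.sum_const_zero, add_zero] at h3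
  exact h3

open Classical in
-- Off `edges` the prefractal domain is exhausted by the interior of the polygon and the open bumps.
-- These are pairwise disjoint, so at most one term of the sum is nonzero.
theorem plateau_eq (n : ℕ) {x : ℂ} (he : x ∉ edges α m a c) :
    plateau α m a c n x = if x ∈ prefractal α m a c n then 1 else 0 := by
  rw [plateau]
  simp only [bumpFun_pull h hm hc he]
  by_cases hx : x ∈ prefractal α m a c n
  · rw [if_pos hx]
    rcases interior_or_bump_of_mem_region h hm hc (interior_subset hx) he with
      hx | ⟨j, hj, w, hw, hx⟩
    · rw [Set.indicator_of_mem (interior_subset hx), Pi.one_apply, add_eq_left]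
      refine Finset.sum_eq_zero fun i hi => Finset.sum_eq_zero fun k _ =>
        Finset.sum_eq_zero fun v _ => Set.indicator_of_notMem (fun hx' => ?_) _
      exact piece_upper_notMem_polygon h hm hc (Finset.mem_range.1 hi)
        (Set.image_mono (openBump_subset_upperTriangle h) hx') (interior_subset hx)
    · have hp : x ∉ polygon m a c := piece_upper_notMem_polygon h hm hc hj
        (Set.image_mono (openBump_subset_upperTriangle h) hx)
      rw [Set.indicator_of_notMem hp, zero_add,
        Finset.sum_eq_single_of_mem j (Finset.mem_range.2 hj),
        Finset.sum_eq_single_of_mem w.length (Finset.mem_range.2 hw),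
        Finset.sum_eq_single_of_mem w (mem_words.2 rfl), Set.indicator_of_mem hx, Pi.one_apply]
      · intro v _ hvw
        exact Set.indicator_of_notMem (fun hx' =>
          hvw (bump_piece_eq h hm hc hj hj hx' hx).2) _
      · intro k _ hk
        refine Finset.sum_eq_zero fun v hv => Set.indicator_of_notMem (fun hx' => hk ?_) _
        rw [← mem_words.1 hv, (bump_piece_eq h hm hc hj hj hx' hx).2]
      · intro i hi hij
        exact Finset.sum_eq_zero fun k _ => Finset.sum_eq_zero fun v _ =>
          Set.indicator_of_notMem (fun hx' => hij
            (bump_piece_eq h hm hc (Finset.mem_range.1 hi) hj hx' hx).1) _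
  · rw [if_neg hx, Set.indicator_of_notMem, zero_add]
    · refine Finset.sum_eq_zero fun i hi => Finset.sum_eq_zero fun k hk =>
        Finset.sum_eq_zero fun v hv => Set.indicator_of_notMem (fun hx' => hx ?_) _
      refine bump_subset_prefractal h hm hc (Finset.mem_range.1 hi) ?_ hx'
      rw [mem_words.1 hv]
      exact Finset.mem_range.1 hk
    · intro hp
      have : x ∈ interior (polygon m a c) := by
        by_contra hi
        exact he (.inl ⟨subset_closure hp, hi⟩)
      exact hx (interior_mono (fun z hz => .inl hz) this)

theorem mem_fiber_of_tooth_ne_zero {j : ℕ} {w : List (Fin 4)} {x : ℂ}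
    (hx : x ∉ creases α K m a c) (ht : tooth K (pull (pieceMap α m a c j w) x) ≠ 0) :
    x ∈ pieceMap α m a c j w '' lowerTriangle K := by
  obtain ⟨h1, h2, h3⟩ := exists_of_tooth_ne_zero h.pos ht
  refine (isSim_pieceMap h hm hc j w).mem_image.2 ⟨lt_of_le_of_ne h1 fun e => ?_, h2, h3⟩
  exact hx (.inr (Set.mem_iUnion₂.2 ⟨j, w, .inl e⟩))

theorem teeth_eq_tooth {n j : ℕ} (hj : j < m) {w : List (Fin 4)} (hw : w.length = n) {x : ℂ}
    (hx : x ∉ creases α K m a c) (hxw : x ∈ pieceMap α m a c j w '' lowerTriangle K) :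
    teeth α K m a c n x = tooth K (pull (pieceMap α m a c j w) x) := by
  rw [teeth, Finset.sum_eq_single_of_mem j (Finset.mem_range.2 hj),
    Finset.sum_eq_single_of_mem w (mem_words.2 hw)]
  · intro v hv hvw
    by_contra ht
    exact hvw (fiber_eq h hm hc hj hj ((mem_words.1 hv).trans hw.symm)
      (mem_fiber_of_tooth_ne_zero h hm hc hx ht) hxw).2
  · intro i hi hij
    refine Finset.sum_eq_zero fun v hv => ?_
    by_contra ht
    exact hij (fiber_eq h hm hc (Finset.mem_range.1 hi) hj ((mem_words.1 hv).trans hw.symm)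
      (mem_fiber_of_tooth_ne_zero h hm hc hx ht) hxw).1

theorem teeth_eq_zero {n : ℕ} {x : ℂ} (hx : x ∉ creases α K m a c)
    (hf : x ∉ fibers α K m a c n) : teeth α K m a c n x = 0 := by
  refine Finset.sum_eq_zero fun j hj => Finset.sum_eq_zero fun w hw => ?_
  by_contra ht
  exact hf (mem_fibers.2 ⟨j, Finset.mem_range.1 hj, w, mem_words.1 hw,
    mem_fiber_of_tooth_ne_zero h hm hc hx ht⟩)

theorem fibers_subset_prefractal (n : ℕ) : fibers α K m a c n ⊆ prefractal α m a c n := by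
  intro x hx
  obtain ⟨j, hj, w, rfl, hxw⟩ := mem_fibers.1 hx
  exact fiber_subset_prefractal h hm hc hj w hxw

theorem isOpen_fibers (n : ℕ) : IsOpen (fibers α K m a c n) :=
  isOpen_biUnion fun p _ => (isSim_pieceMap h hm hc p.1 p.2).isOpen_image (isOpen_lowerTriangle K)

theorem cutoff_of_mem_fiber {n j : ℕ} (hj : j < m) {w : List (Fin 4)} (hw : w.length = n) {x : ℂ}
    (hx : x ∉ creases α K m a c) (hxw : x ∈ pieceMap α m a c j w '' lowerTriangle K) :
    cutoff α K m a c n x = 1 - tooth K (pull (pieceMap α m a c j w) x) := by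
  rw [cutoff, teeth_eq_tooth h hm hc hj hw hx hxw,
    plateau_eq h hm hc n (fun he => hx (.inl he)), if_pos]
  exact fibers_subset_prefractal h hm hc n (mem_fibers.2 ⟨j, hj, w, hw, hxw⟩)

open Classical in
theorem cutoff_of_notMem_fibers {n : ℕ} {x : ℂ} (hx : x ∉ creases α K m a c)
    (hf : x ∉ fibers α K m a c n) :
    cutoff α K m a c n x = if x ∈ prefractal α m a c n then 1 else 0 := by
  rw [cutoff, teeth_eq_zero h hm hc hx hf, sub_zero,
    plateau_eq h hm hc n (fun he => hx (.inl he))]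

theorem cutoff_mem_Icc {n : ℕ} {x : ℂ} (hx : x ∉ creases α K m a c) :
    cutoff α K m a c n x ∈ Set.Icc (0 : ℝ) 1 := by
  classical
  by_cases hf : x ∈ fibers α K m a c n
  · obtain ⟨j, hj, w, hw, hxw⟩ := mem_fibers.1 hf
    rw [cutoff_of_mem_fiber h hm hc hj hw hx hxw]
    have hz := (isSim_pieceMap h hm hc j w).mem_image.1 hxw
    rw [tooth_of_mem hz]
    obtain ⟨h1, h2, h3⟩ := hz
    generalize pull (pieceMap α m a c j w) x = z at *
    have hμ : 0 < K * min z.re (1 - z.re) + z.im := by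
      rcases min_choice z.re (1 - z.re) with h | h <;> rw [h] <;> assumption
    have hμ' : 0 < K * min z.re (1 - z.re) := by linarith
    have l1 : z.im / (K * min z.re (1 - z.re)) ≤ 0 := div_nonpos_of_nonpos_of_nonneg h1.le hμ'.le
    have l2 : -1 ≤ z.im / (K * min z.re (1 - z.re)) := by rw [le_div_iff₀ hμ']; linarith
    constructor <;> linarith
  · rw [cutoff_of_notMem_fibers h hm hc hx hf]
    split_ifs <;> simp

/-- The derivative of a cutoff function. -/
theorem exists_hasFDerivAt_cutoff (n : ℕ) {x : ℂ} (hx : x ∉ creases α K m a c) :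
    ∃ L : ℂ →L[ℝ] ℝ, HasFDerivAt (cutoff α K m a c n) L x ∧
      (x ∉ fibers α K m a c n → L = 0) ∧
      ∀ j < m, ∀ w : List (Fin 4), w.length = n →
        x ∈ pieceMap α m a c j w '' lowerTriangle K →
        ‖L‖ ≤ (1 + 1 / K) * (1 + K) *
          (1 / ‖x - pieceMap α m a c j w 0‖ + 1 / ‖x - pieceMap α m a c j w 1‖) := by
  have hex : ∀ j w, ∃ L : ℂ →L[ℝ] ℝ,
      HasFDerivAt (fun z => tooth K (pull (pieceMap α m a c j w) z)) L x ∧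
      (x ∉ pieceMap α m a c j w '' lowerTriangle K → L = 0) ∧
      ‖L‖ ≤ (1 + 1 / K) * (1 + K) *
        (1 / ‖x - pieceMap α m a c j w 0‖ + 1 / ‖x - pieceMap α m a c j w 1‖) :=
    fun j w => (isSim_pieceMap h hm hc j w).exists_hasFDerivAt_tooth h.pos
      fun ht => hx (.inr (Set.mem_iUnion₂.2 ⟨j, w, ht⟩))
  choose L hL hL0 hLn using hex
  refine ⟨0 - ∑ j ∈ Finset.range m, ∑ w ∈ words n, L j w,
    (hasFDerivAt_plateau h hm hc n fun he => hx (.inl he)).sub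
      (HasFDerivAt.fun_sum fun j _ => HasFDerivAt.fun_sum fun w _ => hL j w), fun hf => ?_, ?_⟩
  · rw [Finset.sum_eq_zero, sub_zero]
    refine fun j hj => Finset.sum_eq_zero fun w hw => hL0 j w fun hxw => hf ?_
    exact mem_fibers.2 ⟨j, Finset.mem_range.1 hj, w, mem_words.1 hw, hxw⟩
  · intro j hj w hw hxw
    rw [zero_sub, norm_neg, Finset.sum_eq_single_of_mem j (Finset.mem_range.2 hj),
      Finset.sum_eq_single_of_mem w (mem_words.2 hw)]
    · exact hLn j w
    · exact fun v hv hvw => hL0 j v fun hxv => hvw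
        (fiber_eq h hm hc hj hj ((mem_words.1 hv).trans hw.symm) hxv hxw).2
    · exact fun i hi hij => Finset.sum_eq_zero fun v hv => hL0 i v fun hxv => hij
        (fiber_eq h hm hc (Finset.mem_range.1 hi) hj ((mem_words.1 hv).trans hw.symm) hxv hxw).1

end

/-! The coefficient functions are almost everywhere equal to the cutoff functions. -/

theorem IsSim.exists_of_mem_segment {S : ℂ → ℂ} (hS : IsSim S) {u v p : ℂ}
    (hp : p ∈ segment ℝ (S u) (S v)) :
    ∃ t : ℝ, 0 ≤ t ∧ t ≤ 1 ∧ p = S (u + t * (v - u)) := by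
  obtain ⟨s, t, hs, ht, hst, rfl⟩ := hp
  refine ⟨t, ht, by linarith, ?_⟩
  have : (s : ℂ) = 1 - t := by rw [← Complex.ofReal_one, ← Complex.ofReal_sub]; congr 1; linarith
  rw [hS.eq u, hS.eq v, hS.eq (u + _), Complex.real_smul, Complex.real_smul, this]
  ring

theorem IsSim.mem_segment {S : ℂ → ℂ} (hS : IsSim S) {u v : ℂ} {t : ℝ} (h0 : 0 ≤ t) (h1 : t ≤ 1) :
    S (u + t * (v - u)) ∈ segment ℝ (S u) (S v) := by
  refine ⟨1 - t, t, by linarith, h0, by ring, ?_⟩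
  rw [hS.eq u, hS.eq v, hS.eq (u + _), Complex.real_smul, Complex.real_smul]
  push_cast
  ring

theorem IsSim.inner_eq {S : ℂ → ℂ} (hS : IsSim S) (z ζ : ℂ) :
    inner ℝ (S z - S ζ) (S 1 - S 0) = Complex.normSq (S 1 - S 0) * (z.re - ζ.re) := by
  rw [hS.comp_sub, Complex.inner, Complex.normSq_apply]
  simp only [Complex.mul_re, Complex.conj_re, Complex.conj_im, Complex.mul_im, Complex.sub_re,
    Complex.sub_im]
  ring

/-- The intersection of the vertical line through `z` with the lower sides of the fiber. -/
def footPoint (K : ℝ) (z : ℂ) : ℂ := ⟨z.re, -(K * min z.re (1 - z.re))⟩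

section
variable {S : ℂ → ℂ} (hS : IsSim S) {ϑ : ℝ} (hK : 0 < Real.tan ϑ) {z : ℂ}
  (hz : z ∈ lowerTriangle (Real.tan ϑ))
include hS hK hz

/-- In the coordinates of S the projection is onto the real axis and the line is vertical, so the
second point is where that line meets the two lower edges. Uniqueness is what makes the choice in
`projPair` computable. -/
theorem projection_unique {p q : ℂ} (hp : p ∈ segment ℝ (S 0) (S 1))
    (hin : inner ℝ (S z - p) (S 1 - S 0) = 0) (hq : q ∈ affineSpan ℝ {S z, p})
    (hq' : q ∈ segment ℝ (S 0) (S (lowVertex ϑ)) ∪ segment ℝ (S (lowVertex ϑ)) (S 1)) :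
    p = S z.re ∧ q = S (footPoint (Real.tan ϑ) z) := by
  have hb : Complex.normSq (S 1 - S 0) ≠ 0 := by
    rw [Ne, Complex.normSq_eq_zero]; exact hS.sub_ne
  have e1 : p = S z.re := by
    obtain ⟨t, -, -, rfl⟩ := hS.exists_of_mem_segment hp
    rw [hS.inner_eq] at hin
    have := (mul_eq_zero.1 hin).resolve_left hb
    have e : z.re = t := by simpa [sub_eq_zero] using this
    rw [e]; simp
  refine ⟨e1, ?_⟩
  obtain ⟨t, rfl⟩ := mem_affineSpan_pair_iff_exists_lineMap_eq.1 hq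
  have e2 : AffineMap.lineMap (S z) p t = S (z + t * (z.re - z)) := by
    rw [e1, AffineMap.lineMap_apply, vsub_eq_sub, vadd_eq_add, hS.comp_sub, Complex.real_smul,
      hS.eq z, hS.eq (z + _)]
    ring
  rw [e2] at hq' ⊢
  congr 1
  have hre : (z + t * (z.re - z)).re = z.re := by simp
  have key : (z + t * (z.re - z)).im = -(Real.tan ϑ * min z.re (1 - z.re)) := by
    rcases hq' with hq' | hq'
    · obtain ⟨s, h0, h1, e⟩ := hS.exists_of_mem_segment hq'
      have e := hS.injective e
      rw [e] at hre ⊢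
      simp only [zero_add, sub_zero, Complex.re_ofReal_mul, Complex.im_ofReal_mul, lowVertex_re,
        lowVertex_im] at hre ⊢
      rw [min_eq_left (by linarith), ← hre]
      ring
    · obtain ⟨s, h0, h1, e⟩ := hS.exists_of_mem_segment hq'
      have e := hS.injective e
      rw [e] at hre ⊢
      simp only [Complex.add_re, Complex.add_im, Complex.re_ofReal_mul, Complex.im_ofReal_mul,
        Complex.sub_re, Complex.sub_im, Complex.one_re, Complex.one_im, lowVertex_re,
        lowVertex_im] at hre ⊢
      rw [min_eq_right (by linarith), ← hre]
      ring
  exact Complex.ext hre key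

theorem projection_exists : S z.re ∈ segment ℝ (S 0) (S 1) ∧
    inner ℝ (S z - S z.re) (S 1 - S 0) = 0 ∧
    S (footPoint (Real.tan ϑ) z) ∈ affineSpan ℝ {S z, S z.re} ∧
    S (footPoint (Real.tan ϑ) z) ∈
      segment ℝ (S 0) (S (lowVertex ϑ)) ∪ segment ℝ (S (lowVertex ϑ)) (S 1) := by
  obtain ⟨h1, h2, h3⟩ := hz
  have ht0 : 0 < z.re := by nlinarith
  have ht1 : z.re < 1 := by nlinarith
  refine ⟨?_, ?_, ?_, ?_⟩
  · have := hS.mem_segment (u := 0) (v := 1) ht0.le ht1.le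
    simpa using this
  · rw [hS.inner_eq]; simp
  · rw [mem_affineSpan_pair_iff_exists_lineMap_eq]
    -- At the parameter t the height on the line is (1 - t) im z, which has to equal -K min(re z, 1
    -- - re z).
    refine ⟨1 + Real.tan ϑ * min z.re (1 - z.re) / z.im, ?_⟩
    rw [AffineMap.lineMap_apply, vsub_eq_sub, vadd_eq_add, hS.comp_sub, Complex.real_smul,
      hS.eq z, hS.eq (footPoint _ _)]
    have e : footPoint (Real.tan ϑ) z = z +
        ((1 + Real.tan ϑ * min z.re (1 - z.re) / z.im : ℝ) : ℂ) * (z.re - z) := by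
      refine Complex.ext ?_ ?_
      · simp only [footPoint, Complex.add_re, Complex.re_ofReal_mul, Complex.sub_re,
          Complex.ofReal_re, sub_self, mul_zero, add_zero]
      · simp only [footPoint, Complex.add_im, Complex.im_ofReal_mul, Complex.sub_im,
          Complex.ofReal_im]
        field_simp [h1.ne]
        ring
    rw [e]
    ring
  · rcases le_total z.re (1 / 2) with hle | hle
    · left
      have := hS.mem_segment (u := 0) (v := lowVertex ϑ) (t := 2 * z.re) (by linarith)
        (by linarith)
      convert this using 2
      refine Complex.ext ?_ ?_
      · simp only [footPoint, zero_add, sub_zero, Complex.re_ofReal_mul, lowVertex_re]; ring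
      · simp only [footPoint, zero_add, sub_zero, Complex.im_ofReal_mul, lowVertex_im]
        rw [min_eq_left (by linarith)]; ring
    · right
      have := hS.mem_segment (u := lowVertex ϑ) (v := 1) (t := 2 * z.re - 1) (by linarith)
        (by linarith)
      convert this using 2
      refine Complex.ext ?_ ?_
      · simp only [footPoint, Complex.add_re, Complex.re_ofReal_mul, Complex.sub_re,
          Complex.one_re, lowVertex_re]; ring
      · simp only [footPoint, Complex.add_im, Complex.im_ofReal_mul, Complex.sub_im,
          Complex.one_im, lowVertex_im]
        rw [min_eq_right (by linarith)]; ring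

/-- Both difference vectors are real multiples of i(S 1 - S 0), so its ℓ¹ norm cancels and the
quotient does not depend on the orientation of the fiber. -/
theorem projection_ratio :
    (|(S z.re).re - (S z).re| + |(S z.re).im - (S z).im|) /
      (|(S z.re).re - (S (footPoint (Real.tan ϑ) z)).re| +
        |(S z.re).im - (S (footPoint (Real.tan ϑ) z)).im|) =
      1 - tooth (Real.tan ϑ) z := by
  rw [tooth_of_mem hz]
  obtain ⟨h1, h2, h3⟩ := hz
  have hμ' : 0 < Real.tan ϑ * min z.re (1 - z.re) := by
    have : 0 < Real.tan ϑ * min z.re (1 - z.re) + z.im := by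
      rcases min_choice z.re (1 - z.re) with h | h <;> rw [h] <;> assumption
    linarith
  have e1 : S z.re - S z = ((-z.im : ℝ) : ℂ) * ((S 1 - S 0) * Complex.I) := by
    rw [hS.comp_sub]
    have : (z : ℂ) = z.re + z.im * Complex.I := (Complex.re_add_im z).symm
    push_cast
    linear_combination (-(S 1 - S 0)) * this
  have e2 : S z.re - S (footPoint (Real.tan ϑ) z) =
      ((Real.tan ϑ * min z.re (1 - z.re) : ℝ) : ℂ) * ((S 1 - S 0) * Complex.I) := by
    rw [hS.comp_sub]
    have : footPoint (Real.tan ϑ) z = z.re +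
        ((-(Real.tan ϑ * min z.re (1 - z.re)) : ℝ) : ℂ) * Complex.I :=
      (Complex.re_add_im (footPoint (Real.tan ϑ) z)).symm
    push_cast at this ⊢
    linear_combination (-(S 1 - S 0)) * this
  have hb : (S 1 - S 0) * Complex.I ≠ 0 := mul_ne_zero hS.sub_ne Complex.I_ne_zero
  simp only [← Complex.sub_re, ← Complex.sub_im]
  rw [e1, e2]
  generalize (S 1 - S 0) * Complex.I = b at *
  have hb' : 0 < |b.re| + |b.im| := by
    by_contra hcon
    have l1 := abs_nonneg b.re
    have l2 := abs_nonneg b.im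
    exact hb (Complex.ext (abs_eq_zero.1 (by linarith)) (abs_eq_zero.1 (by linarith)))
  simp only [Complex.re_ofReal_mul, Complex.im_ofReal_mul, abs_mul,
    abs_of_pos (show 0 < -z.im by linarith), abs_of_pos hK]
  rw [abs_of_pos (pos_of_mul_pos_right hμ' hK.le), ← mul_add, ← mul_add,
    mul_div_mul_right _ _ hb'.ne']
  ring

end

section
variable {α ϑ : ℝ} (h : Admissible α (Real.tan ϑ)) {m : ℕ} (hm : 3 ≤ m) {a c : ℂ} (hc : c ≠ 0)
include h

theorem innerFibers_eq (n : ℕ) :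
    innerFibers α ϑ m a c n = fibers α (Real.tan ϑ) m a c n := by
  ext x
  rw [mem_fibers, ← innerTriangle_eq h.pos]
  rfl

include hm hc

/-- A point lies in only one fiber of a given level, so whichever pair is chosen belongs to this
fiber. -/
theorem coeff_of_mem_fiber {n j : ℕ} (hj : j < m) {w : List (Fin 4)} (hw : w.length = n) {x : ℂ}
    (hx : x ∈ pieceMap α m a c j w '' lowerTriangle (Real.tan ϑ)) :
    coeff α ϑ m a c n x = 1 - tooth (Real.tan ϑ) (pull (pieceMap α m a c j w) x) := by
  have hS := isSim_pieceMap h hm hc (a := a) j w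
  have hxf : x ∈ innerFibers α ϑ m a c n := by
    rw [innerFibers_eq h]
    exact mem_fibers.2 ⟨j, hj, w, hw, hx⟩
  rw [coeff, if_pos hxf]
  have hz := hS.mem_image.1 hx
  have hex : ∃ pq : ℂ × ℂ, IsProjPair α ϑ m a c n x pq.1 pq.2 := by
    refine ⟨(pieceMap α m a c j w (pull (pieceMap α m a c j w) x).re, pieceMap α m a c j w
      (footPoint (Real.tan ϑ) (pull (pieceMap α m a c j w) x))), j, hj, w, hw, _, rfl, ?_, ?_⟩
    · rw [innerTriangle_eq h.pos]; exact hx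
    · have := projection_exists hS h.pos hz
      rw [hS.apply_pull] at this
      exact this
  have hspec : IsProjPair α ϑ m a c n x (projPair α ϑ m a c n x).1 (projPair α ϑ m a c n x).2 :=
    Classical.epsilon_spec hex
  obtain ⟨i, hi, v, hv, T, rfl, hxv, hp, hin, hq, hq'⟩ := hspec
  rw [innerTriangle_eq h.pos] at hxv
  obtain ⟨rfl, rfl⟩ := fiber_eq h hm hc hi hj (hv.trans hw.symm) hxv hx
  have hxS := hS.apply_pull x
  have hu := projection_unique hS h.pos hz (by exact hp) (by rw [hxS]; exact hin)
    (by rw [hxS]; exact hq) hq'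
  have hr := projection_ratio hS h.pos hz
  rw [hxS] at hr
  rw [hu.1, hu.2, hr]

theorem coeff_eq_cutoff {n : ℕ} {x : ℂ} (hx : x ∉ creases α (Real.tan ϑ) m a c) :
    coeff α ϑ m a c n x = cutoff α (Real.tan ϑ) m a c n x := by
  classical
  by_cases hf : x ∈ fibers α (Real.tan ϑ) m a c n
  · obtain ⟨j, hj, w, hw, hxw⟩ := mem_fibers.1 hf
    rw [coeff_of_mem_fiber h hm hc hj hw hxw, cutoff_of_mem_fiber h hm hc hj hw hx hxw]
  · rw [coeff, innerFibers_eq h, if_neg hf, cutoff_of_notMem_fibers h hm hc hx hf]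

end

/-! The Hardy inequality for the cutoff functions. -/

theorem ofReal_one_div_le (t : ℝ) : ENNReal.ofReal (1 / t) ≤ (ENNReal.ofReal t)⁻¹ := by
  rcases le_or_gt t 0 with ht | ht
  · rw [ENNReal.ofReal_of_nonpos ht, ENNReal.inv_zero]; exact le_top
  · rw [one_div, ENNReal.ofReal_inv_of_pos ht]

/-- The Hardy inequality in a single fiber. -/
theorem IsSim.lintegral_fiber_le {S : ℂ → ℂ} (hS : IsSim S) {K : ℝ} {r : ℝ} (hr : 2 < r)
    {φ : ℂ → ℝ} (hφ : ContDiff ℝ 1 φ) (h0 : φ (S 0) = 0) (h1 : φ (S 1) = 0) {M : ℝ} (hM : 0 ≤ M)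
    {G : ℂ → ℂ} (hG : ∀ᵐ x ∂volume, x ∈ S '' lowerTriangle K →
      ‖G x‖ ≤ M * (1 / ‖x - S 0‖ + 1 / ‖x - S 1‖)) :
    ∫⁻ x in S '' lowerTriangle K, ‖φ x • G x‖ₑ ^ r ≤
      (ENNReal.ofReal M ^ r * 2 ^ (r - 1) * (hardyConst r + hardyConst r)) *
        ∫⁻ x in S '' lowerTriangle K, ‖fderiv ℝ φ x‖ₑ ^ r := by
  have hr0 : 0 ≤ r := by linarith
  have hmeas : MeasurableSet (S '' lowerTriangle K) :=
    (hS.isOpen_image (isOpen_lowerTriangle K)).measurableSet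
  have H0 := hardy_of_starShaped hr hmeas (hS.starShaped (.inl rfl)) hφ h0
  have H1 := hardy_of_starShaped hr hmeas (hS.starShaped (.inr rfl)) hφ h1
  have hφm : Measurable φ := hφ.continuous.measurable
  have hAm : ∀ p : ℂ, Measurable fun x => (‖φ x‖ₑ / ‖x - p‖ₑ) ^ r := fun p => by fun_prop
  have hMt : ENNReal.ofReal M ^ r * 2 ^ (r - 1) ≠ ∞ :=
    ENNReal.mul_ne_top (ENNReal.rpow_ne_top_of_nonneg hr0 ENNReal.ofReal_ne_top)
      (ENNReal.rpow_ne_top_of_nonneg (by linarith) (by norm_num))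
  calc ∫⁻ x in S '' lowerTriangle K, ‖φ x • G x‖ₑ ^ r
      ≤ ∫⁻ x in S '' lowerTriangle K, ENNReal.ofReal M ^ r * 2 ^ (r - 1) *
          ((‖φ x‖ₑ / ‖x - S 0‖ₑ) ^ r + (‖φ x‖ₑ / ‖x - S 1‖ₑ) ^ r) := by
        refine setLIntegral_mono_ae' hmeas ?_
        filter_upwards [hG] with x hx hxm
        have hle : ‖G x‖ₑ ≤ ENNReal.ofReal M * (‖x - S 0‖ₑ⁻¹ + ‖x - S 1‖ₑ⁻¹) := by
          rw [← ofReal_norm]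
          refine (ENNReal.ofReal_le_ofReal (hx hxm)).trans ?_
          rw [ENNReal.ofReal_mul hM, ENNReal.ofReal_add (by positivity) (by positivity),
            ← ofReal_norm (x - S 0), ← ofReal_norm (x - S 1)]
          gcongr <;> exact ofReal_one_div_le _
        calc ‖φ x • G x‖ₑ ^ r
            ≤ (ENNReal.ofReal M * (‖φ x‖ₑ / ‖x - S 0‖ₑ + ‖φ x‖ₑ / ‖x - S 1‖ₑ)) ^ r := by
              gcongr
              rw [enorm_smul]
              calc ‖φ x‖ₑ * ‖G x‖ₑ ≤
                  ‖φ x‖ₑ * (ENNReal.ofReal M * (‖x - S 0‖ₑ⁻¹ + ‖x - S 1‖ₑ⁻¹)) := by gcongr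
                _ = _ := by rw [div_eq_mul_inv, div_eq_mul_inv]; ring
          _ ≤ _ := by
              rw [ENNReal.mul_rpow_of_nonneg _ _ hr0, mul_assoc]
              gcongr
              exact ENNReal.rpow_add_le_mul_rpow_add_rpow _ _ (by linarith)
    _ = ENNReal.ofReal M ^ r * 2 ^ (r - 1) *
          ((∫⁻ x in S '' lowerTriangle K, (‖φ x‖ₑ / ‖x - S 0‖ₑ) ^ r) +
            ∫⁻ x in S '' lowerTriangle K, (‖φ x‖ₑ / ‖x - S 1‖ₑ) ^ r) := by
        rw [lintegral_const_mul' _ _ hMt, lintegral_add_left (hAm _)]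
    _ ≤ ENNReal.ofReal M ^ r * 2 ^ (r - 1) *
          (hardyConst r * (∫⁻ x in S '' lowerTriangle K, ‖fderiv ℝ φ x‖ₑ ^ r) +
            hardyConst r * ∫⁻ x in S '' lowerTriangle K, ‖fderiv ℝ φ x‖ₑ ^ r) := by gcongr
    _ = _ := by ring

/-- The constant in the Hardy inequality for the cutoff functions. -/
def cutoffConst (K r : ℝ) : ℝ≥0∞ :=
  (ENNReal.ofReal ((1 + 1 / K) * (1 + K)) ^ r * 2 ^ (r - 1) *
    (hardyConst r + hardyConst r)) ^ (1 / r)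

theorem cutoffConst_ne_top (K : ℝ) {r : ℝ} (hr : 2 < r) : cutoffConst K r ≠ ∞ := by
  have hH := (hardyConst_lt_top hr).ne
  refine ENNReal.rpow_ne_top_of_nonneg (by positivity) (ENNReal.mul_ne_top (ENNReal.mul_ne_top ?_ ?_)
    (ENNReal.add_ne_top.2 ⟨hH, hH⟩))
  · exact ENNReal.rpow_ne_top_of_nonneg (by linarith) ENNReal.ofReal_ne_top
  · exact ENNReal.rpow_ne_top_of_nonneg (by linarith) (by norm_num)

section
variable {α K : ℝ} (h : Admissible α K) {m : ℕ} (hm : 3 ≤ m) {a c : ℂ} (hc : c ≠ 0)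
include h hm hc

theorem ae_notMem_creases (μ : Measure ℂ) (hμ : μ ≪ volume) :
    ∀ᵐ x ∂μ, x ∉ creases α K m a c :=
  hμ.ae_le (measure_eq_zero_iff_ae_notMem.1 (volume_creases h hm hc))

/-- The gradient vanishes almost everywhere off the fibers, and the fibers of one level are
disjoint. The estimates in single fibers therefore add up with a constant independent of n. -/
theorem lintegral_cutoff_le {r : ℝ} (hr : 2 < r) (n : ℕ) {φ : ℂ → ℝ}
    (hφ : IsTest (domain α m a c) φ) :
    ∫⁻ x, ‖φ x • gradient (cutoff α K m a c n) x‖ₑ ^ r ≤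
      (ENNReal.ofReal ((1 + 1 / K) * (1 + K)) ^ r * 2 ^ (r - 1) *
        (hardyConst r + hardyConst r)) *
        ∫⁻ x in fibers α K m a c n, ‖fderiv ℝ φ x‖ₑ ^ r := by
  have hae := ae_notMem_creases h hm hc (a := a) volume Measure.AbsolutelyContinuous.rfl
  have hmeas := (isOpen_fibers h hm hc (a := a) n).measurableSet
  have hK := h.pos
  have hpd : Set.PairwiseDisjoint (↑(Finset.range m ×ˢ words n))
      fun p : ℕ × List (Fin 4) => pieceMap α m a c p.1 p.2 '' lowerTriangle K := by
    rintro ⟨i, v⟩ hp ⟨j, w⟩ hq hne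
    simp only [Finset.coe_product, Set.mem_prod, Finset.mem_coe, Finset.mem_range,
      mem_words] at hp hq
    refine Set.disjoint_left.2 fun x hx hx' => hne ?_
    obtain ⟨rfl, rfl⟩ := fiber_eq h hm hc hp.1 hq.1 (hp.2.trans hq.2.symm) hx hx'
    rfl
  have hmp : ∀ p ∈ Finset.range m ×ˢ words n,
      MeasurableSet (pieceMap α m a c p.1 p.2 '' lowerTriangle K) := fun p _ =>
    ((isSim_pieceMap h hm hc p.1 p.2).isOpen_image (isOpen_lowerTriangle K)).measurableSet
  have e1 : ∫⁻ x, ‖φ x • gradient (cutoff α K m a c n) x‖ₑ ^ r =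
      ∫⁻ x in fibers α K m a c n, ‖φ x • gradient (cutoff α K m a c n) x‖ₑ ^ r := by
    rw [← lintegral_indicator hmeas]
    refine lintegral_congr_ae ?_
    filter_upwards [hae] with x hx
    by_cases hf : x ∈ fibers α K m a c n
    · rw [Set.indicator_of_mem hf]
    · rw [Set.indicator_of_notMem hf]
      obtain ⟨L, hL, hL0, -⟩ := exists_hasFDerivAt_cutoff h hm hc n hx
      rw [enorm_smul, enorm_gradient, hL.fderiv, hL0 hf, ← ofReal_norm (0 : ℂ →L[ℝ] ℝ), norm_zero,
        ENNReal.ofReal_zero, mul_zero,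
        ENNReal.zero_rpow_of_pos (by linarith)]
  rw [e1, fibers, lintegral_biUnion_finset hpd hmp, lintegral_biUnion_finset hpd hmp,
    Finset.mul_sum]
  refine Finset.sum_le_sum fun p hp => ?_
  simp only [Finset.mem_product, Finset.mem_range, mem_words] at hp
  refine (isSim_pieceMap h hm hc p.1 p.2).lintegral_fiber_le hr hφ.contDiff_one
    (hφ.eq_zero (vertex_notMem_domain h hm hc hp.1 p.2 (.inl rfl)))
    (hφ.eq_zero (vertex_notMem_domain h hm hc hp.1 p.2 (.inr rfl))) (by positivity) ?_
  filter_upwards [hae] with x hx hxp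
  obtain ⟨L, hL, -, hLn⟩ := exists_hasFDerivAt_cutoff h hm hc n hx
  rw [norm_gradient, hL.fderiv]
  exact hLn p.1 hp.1 p.2 hp.2 hxp

theorem isHardyCutoff_cutoff {r : ℝ} (hr : 2 < r) (n : ℕ) :
    IsHardyCutoff (domain α m a c) r (cutoffConst K r)
      (fibers α K m a c n ∪ (prefractal α m a c n)ᶜ) (cutoff α K m a c n) where
  measurableSet := (isOpen_fibers h hm hc n).measurableSet.union
    (isOpen_prefractal α m a c n).measurableSet.compl
  locLip x hx := locLipAt_cutoff h hm hc n fun j hj w =>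
    ⟨fun e => vertex_notMem_domain h hm hc hj w (.inl rfl) (e ▸ hx),
      fun e => vertex_notMem_domain h hm hc hj w (.inr rfl) (e ▸ hx)⟩
  differentiable := by
    filter_upwards [ae_notMem_creases h hm hc (a := a) _ Measure.absolutelyContinuous_restrict]
      with x hx
    obtain ⟨L, hL, -⟩ := exists_hasFDerivAt_cutoff h hm hc n hx
    exact hL.differentiableAt
  mem_Icc := by
    filter_upwards [ae_notMem_creases h hm hc (a := a) _ Measure.absolutelyContinuous_restrict]
      with x hx using cutoff_mem_Icc h hm hc hx
  eq_one := by
    classical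
    filter_upwards [ae_notMem_creases h hm hc (a := a) _ Measure.absolutelyContinuous_restrict]
      with x hx hE
    rw [Set.mem_union, not_or, Set.mem_compl_iff, not_not] at hE
    rw [cutoff_of_notMem_fibers h hm hc hx hE.1, if_pos hE.2]
  hardy φ hφ := by
    have hr0 : 0 < r := by linarith
    rw [eLpNorm_ofReal hr0, eLpNorm_ofReal hr0, cutoffConst,
      ← ENNReal.mul_rpow_of_nonneg _ _ (by positivity)]
    gcongr
    refine (setLIntegral_le_lintegral _ _).trans
      ((lintegral_cutoff_le h hm hc hr n hφ).trans ?_)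
    simp only [enorm_gradient]
    gcongr
    refine Set.subset_inter (fun x hx => ?_) Set.subset_union_left
    exact Set.mem_iUnion.2 ⟨n, fibers_subset_prefractal h hm hc n hx⟩

/-! The measure of the transition regions. -/

omit hm hc in
theorem norm_kochMap_sub (i : Fin 4) (z w : ℂ) :
    ‖kochMap α i z - kochMap α i w‖ = (1 / 2 - halfBase α) * ‖z - w‖ := by
  have hd4 := h.halfBase_lt
  have hβ : 0 < 1 / 2 - halfBase α := by linarith
  have hα := h.alpha_pos
  have hn : ‖(1 / α : ℂ)‖ = 1 / 2 - halfBase α := by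
    rw [← one_div_eq α, ← Complex.ofReal_one, ← Complex.ofReal_div, Complex.norm_real,
      Real.norm_of_nonneg (by positivity)]
  have he : ‖Complex.exp (-(Complex.I * angle α))‖ = 1 := by
    rw [← mul_neg, ← Complex.ofReal_neg, Complex.norm_exp_I_mul_ofReal]
  fin_cases i <;> simp only [kochMap]
  · rw [← hn, ← norm_mul]; congr 1; ring
  · rw [← hn, ← norm_mul, ← mul_one ‖(_ : ℂ) * _‖, ← Complex.norm_exp_I_mul_ofReal (angle α),
      ← norm_mul]
    congr 1; ring
  · rw [← hn, ← norm_mul, ← mul_one ‖(_ : ℂ) * _‖, ← he, ← norm_mul]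
    congr 1; ring
  · rw [← hn, ← norm_mul]; congr 1; ring

theorem norm_pieceMap_sub (j : ℕ) (w : List (Fin 4)) :
    ‖pieceMap α m a c j w 1 - pieceMap α m a c j w 0‖ = ‖c‖ * (1 / 2 - halfBase α) ^ w.length := by
  have hk : ∀ w : List (Fin 4), ‖kochWord α w 1 - kochWord α w 0‖ =
      (1 / 2 - halfBase α) ^ w.length := by
    intro w
    induction w with
    | nil => simp [kochWord]
    | cons i w ih =>
      rw [kochWord, Function.comp, Function.comp, norm_kochMap_sub h, ih, List.length_cons,
        pow_succ']
  rw [pieceMap, Function.comp, Function.comp, (isSim_sideMap hm hc j).comp_sub, norm_mul, hk,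
    sideMap_sub hm, norm_mul, norm_pow, norm_turn hm, one_pow, mul_one]

omit hm hc in
theorem volume_lowerTriangle_ne_top : volume (lowerTriangle K) ≠ ∞ := by
  have hK := h.pos
  refine ((measure_mono fun z hz => ?_).trans_lt
    (measure_ball_lt_top (μ := volume) (x := (0 : ℂ)) (r := 1 + K))).ne
  obtain ⟨h1, h2, h3⟩ := hz
  have ht0 : 0 < z.re := by nlinarith
  have ht1 : z.re < 1 := by nlinarith
  rw [mem_ball_zero_iff]
  refine (Complex.norm_le_abs_re_add_abs_im z).trans_lt ?_
  rw [abs_of_pos ht0, abs_of_neg h1]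
  nlinarith

/-- There are m 4^n fibers, each the image of one triangle under a similitude of ratio |c| α^(-n).
The total area decays like (4/α²)^n, and α > 2. -/
theorem tendsto_volume_fibers :
    Tendsto (fun n => volume (fibers α K m a c n)) atTop (𝓝 0) := by
  have hd := h.halfBase_pos
  have hd4 := h.halfBase_lt
  set β := 1 / 2 - halfBase α with hβ
  have hβ0 : 0 < β := by linarith
  have hle : ∀ n, volume (fibers α K m a c n) ≤
      ENNReal.ofReal (m * ‖c‖ ^ 2 * (4 * β ^ 2) ^ n) * volume (lowerTriangle K) := by
    intro n
    refine (measure_biUnion_finset_le _ _).trans ?_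
    have e : ∀ p ∈ Finset.range m ×ˢ words n,
        volume (pieceMap α m a c p.1 p.2 '' lowerTriangle K) =
          ENNReal.ofReal ((‖c‖ * β ^ n) ^ 2) * volume (lowerTriangle K) := fun p hp => by
      rw [(isSim_pieceMap h hm hc p.1 p.2).volume_image, norm_pieceMap_sub h hm hc,
        mem_words.1 (Finset.mem_product.1 hp).2]
    rw [Finset.sum_congr rfl e, Finset.sum_const, Finset.card_product, Finset.card_range,
      card_words, nsmul_eq_mul, ← mul_assoc]
    gcongr
    rw [← ENNReal.ofReal_natCast, ← ENNReal.ofReal_mul (by positivity)]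
    refine ENNReal.ofReal_le_ofReal (le_of_eq ?_)
    push_cast
    rw [mul_pow 4, mul_pow ‖c‖, ← pow_mul, ← pow_mul, mul_comm n 2]
    ring
  have hlim : Tendsto (fun n : ℕ => ENNReal.ofReal (m * ‖c‖ ^ 2 * (4 * β ^ 2) ^ n) *
      volume (lowerTriangle K)) atTop (𝓝 0) := by
    have h1 : Tendsto (fun n : ℕ => (m * ‖c‖ ^ 2) * (4 * β ^ 2) ^ n) atTop (𝓝 0) := by
      have := (tendsto_pow_atTop_nhds_zero_of_lt_one (r := 4 * β ^ 2) (by positivity)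
        (by nlinarith)).const_mul (m * ‖c‖ ^ 2)
      rwa [mul_zero] at this
    have h2 := ENNReal.tendsto_ofReal h1
    rw [ENNReal.ofReal_zero] at h2
    have h3 := ENNReal.Tendsto.mul_const h2 (.inr (volume_lowerTriangle_ne_top h))
    rwa [zero_mul] at h3
  exact tendsto_of_tendsto_of_tendsto_of_le_of_le tendsto_const_nhds hlim (fun _ => zero_le) hle

/-- Continuity of the measure from above: the domain has finite measure and is the increasing union
of the prefractal domains. -/
theorem tendsto_volume_diff_prefractal :
    Tendsto (fun n => volume (domain α m a c \ prefractal α m a c n)) atTop (𝓝 0) := by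
  have hΩ := volume_domain_ne_top h hm hc (a := a)
  have := tendsto_measure_iInter_atTop (μ := volume)
    (s := fun n => domain α m a c \ prefractal α m a c n)
    (fun n => ((isOpen_domain α m a c).measurableSet.diff
      (isOpen_prefractal α m a c n).measurableSet).nullMeasurableSet)
    (fun n k hnk => Set.sdiff_subset_sdiff_right (prefractal_mono α m a c hnk))
    ⟨0, ne_top_of_le_ne_top hΩ (measure_mono Set.sdiff_subset)⟩
  rw [← Set.sdiff_iUnion] at this
  simpa [domain, Function.comp_def] using this

theorem tendsto_volume_transition :
    Tendsto (fun n => volume (domain α m a c ∩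
      (fibers α K m a c n ∪ (prefractal α m a c n)ᶜ))) atTop (𝓝 0) := by
  have hsum := (tendsto_volume_fibers h hm hc (a := a)).add
    (tendsto_volume_diff_prefractal h hm hc (a := a))
  rw [add_zero] at hsum
  refine tendsto_of_tendsto_of_tendsto_of_le_of_le tendsto_const_nhds hsum (fun _ => zero_le)
    fun n => (measure_mono ?_).trans (measure_union_le _ _)
  rintro x ⟨hx, hx' | hx'⟩
  · exact .inl hx'
  · exact .inr ⟨hx, hx'⟩

end

/-! ### From the opening angle to the slope, and conclusion. -/

/-- The slope of the inner fibers is admissible. -/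
theorem admissible_tan {α ϑ : ℝ} (hα₂ : 2 < α) (hα₄ : α < 4) (hϑ₀ : 0 < ϑ)
    (hϑ : ϑ ≤ min (Real.pi / 2 - angle α) (angle α / 2)) : Admissible α (Real.tan ϑ) := by
  have hH : 0 < height α := by
    refine Real.sqrt_pos.2 ?_
    rw [sub_pos]
    exact one_div_lt_one_div_of_lt (by linarith) hα₄
  have hδ : 0 < halfBase α := by
    rw [halfBase, sub_pos]
    exact one_div_lt_one_div_of_lt (by norm_num) hα₂
  -- The largest admissible slope; it serves only to make `exp_angle` available before tan ϑ is
  -- known to be admissible.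
  have h₀ : Admissible α (min (2 * height α) (halfBase α / height α)) :=
    ⟨hα₂, hα₄, lt_min (by positivity) (by positivity), min_le_left _ _,
      (le_div_iff₀ hH).1 (min_le_right _ _)⟩
  have hexp := exp_angle h₀
  have hα : 0 < α := by linarith
  have hcos : Real.cos (angle α) = α * halfBase α := by
    have := congrArg Complex.re hexp
    rw [mul_comm, Complex.exp_ofReal_mul_I_re] at this
    simpa using this
  have hsin : Real.sin (angle α) = α * height α := by
    have := congrArg Complex.im hexp
    rw [mul_comm, Complex.exp_ofReal_mul_I_im] at this
    simpa using this
  obtain ⟨hϑ1, hϑ2⟩ := le_min_iff.1 hϑ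
  have hθ : angle α < Real.pi / 2 := by linarith
  have hpi := Real.pi_pos
  have hmono := Real.strictMonoOn_tan.monotoneOn
  refine ⟨hα₂, hα₄, Real.tan_pos_of_pos_of_lt_pi_div_two hϑ₀ (by linarith), ?_, ?_⟩
  -- ϑ ≤ θ/2, and tan(θ/2) = sin θ / (1 + cos θ) = H / (1/α + d) = 2H.
  · have h1 : Real.tan ϑ ≤ Real.tan (angle α / 2) :=
      hmono ⟨by linarith, by linarith⟩ ⟨by linarith, by linarith⟩ hϑ2
    refine h1.trans (le_of_eq ?_)
    have hc : 0 < Real.cos (angle α / 2) :=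
      Real.cos_pos_of_mem_Ioo ⟨by linarith, by linarith⟩
    have e1 : Real.sin (angle α) = 2 * Real.sin (angle α / 2) * Real.cos (angle α / 2) := by
      rw [← Real.sin_two_mul]; congr 1; ring
    have e2 : Real.cos (angle α) = 2 * Real.cos (angle α / 2) ^ 2 - 1 := by
      rw [← Real.cos_two_mul]; congr 1; ring
    have e3 : α * halfBase α = α / 2 - 1 := by rw [halfBase]; field_simp
    rw [Real.tan_eq_sin_div_cos, div_eq_iff hc.ne']
    apply mul_left_cancel₀ (mul_ne_zero two_ne_zero hc.ne')
    linear_combination hsin - e1 + 2 * height α * (e2 - hcos - e3)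
  -- ϑ ≤ π/2 - θ, and cot θ = d/H.
  · have h1 : Real.tan ϑ ≤ Real.tan (Real.pi / 2 - angle α) :=
      hmono ⟨by linarith, by linarith⟩ ⟨by linarith, by linarith⟩ hϑ1
    rw [Real.tan_pi_div_two_sub, Real.tan_eq_sin_div_cos (angle α), inv_div, hsin, hcos,
      mul_div_mul_left _ _ hα.ne'] at h1
    exact (le_div_iff₀ hH).1 h1

end Snowflake

end

theorem corollary6p3 (α ϑ : ℝ) (hα₂ : 2 < α) (hα₄ : α < 4)
    (hϑ₀ : 0 < ϑ) (hϑ : ϑ ≤ min (Real.pi / 2 - Snowflake.angle α) (Snowflake.angle α / 2))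
    (m : ℕ) (hm : 3 ≤ m) (a c : ℂ) (hc : c ≠ 0)
    (r : ℝ) (hr : 2 < r) (g u : ℂ → ℝ)
    (hg : Snowflake.MemW (Snowflake.domain α m a c) ∞ g)
    (hu : Snowflake.MemWBdry (Snowflake.domain α m a c) r g u) :
    ∀ s : ℝ, 2 < s → s < r →
      (∀ n : ℕ, Snowflake.MemWBdry (Snowflake.domain α m a c) s g
        (Snowflake.blend α ϑ m a c g u n)) ∧
      (∃ C : ℝ, ∀ n : ℕ, Snowflake.sobolevNorm (Snowflake.domain α m a c) s
        (Snowflake.blend α ϑ m a c g u n) ≤ ENNReal.ofReal C) ∧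
      Tendsto (fun n : ℕ => Snowflake.sobolevNorm (Snowflake.domain α m a c) s
        (fun x => Snowflake.blend α ϑ m a c g u n x - u x)) atTop (𝓝 0) := by
  intro s hs hsr
  have h := Snowflake.admissible_tan hα₂ hα₄ hϑ₀ hϑ
  refine Snowflake.sobolev_blend (Snowflake.isOpen_domain α m a c)
    (Snowflake.volume_domain_ne_top h hm hc) (Snowflake.cutoffConst_ne_top (Real.tan ϑ) hr)
    (Snowflake.isHardyCutoff_cutoff h hm hc hr) (Snowflake.tendsto_volume_transition h hm hc)
    (lam := Snowflake.coeff α ϑ m a c) (fun n => ?_) hg hu hs hsr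
  -- The coefficient function and its locally Lipschitz version differ at most on the null set of
  -- creases, which Sobolev functions do not see.
  filter_upwards [Snowflake.ae_notMem_creases h hm hc (a := a) _
    Measure.absolutelyContinuous_restrict] with x hx
  exact Snowflake.coeff_eq_cutoff h hm hc hx
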